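/- Setup. Let $\mathbb F$ be an algebraically closed field of characteristic $0$, $\mathfrak g$ a finite-dimensional simple Lie algebra over $\mathbb F$ with a non-degenerate symmetric invariant bilinear form $(\cdot|\cdot)$, and $\{f,2x,e\}\subset\mathfrak g$ an $\mathfrak{sl}_2$-triple ($[e,f]=2x$, $[x,e]=e$, $[x,f]=-f$). Write $\mathfrak g_i$ for the $i$-eigenspace of $\operatorname{ad}x$, and assume that $f$ is short: $\mathfrak g=\mathfrak g_{-1}\oplus\mathfrak g_0\oplus\mathfrak g_1$. Let $s\in\mathfrak g_1$ and $z\in\mathbb F$. Let $\mathfrak g_0^f$ be the centralizer of $f$ in $\mathfrak g_0$, and $a\mapsto a^\sharp$ the projection $\mathfrak g_0\to\mathfrak g_0^f$ with kernel $[e,\mathfrak g_{-1}]$. Put $u\circ w=[[e,u],w]$ for $u,w\in\mathfrak g_{-1}$. Let $\mathcal V(\mathfrak g)=S(\mathbb F[\partial]\mathfrak g)$ be the algebra of differential polynomials on $\mathfrak g$, with the $\lambda$-bracket determined by $\{a_\lambda b\}_z=[a,b]+(a|b)\lambda+z(s|[a,b])$ for $a,b\in\mathfrak g$, by sesquilinearity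 and by the left and right Leibniz rules. Let $\mathcal V(\mathfrak g_{\le 1/2})$ be its differential subalgebra generated by $\mathfrak g_{\le 1/2}=\mathfrak g_{-1}\oplus\mathfrak g_0$, and $\rho:\mathcal V(\mathfrak g)\to\mathcal V(\mathfrak g_{\le1/2})$ the differential algebra homomorphism with $\rho(a)=\pi_{\le 1/2}(a)+(f|a)$ for $a\in\mathfrak g$, where $\pi_{\le1/2}:\mathfrak g\to\mathfrak g_{\le1/2}$ is the projection with kernel $\mathfrak g_1$. The classical $\mathcal W$-algebra is $$\mathcal W=\{P\in\mathcal V(\mathfrak g_{\le1/2})\mid\rho\{a_\lambda P\}_z=0\ \text{ for all } a\in\mathfrak g_1\},\qquad \{P_\lambda Q\}_{z,\rho}=\rho\{P_\lambda Q\}_z .$$ Let $\{u_k\}$, $\{u^k\}$ be dual bases of $\mathfrak g_{-1}$ and $\mathfrak g_1$, let $\{a_i\},\{a^i\}$ be dual bases of $\mathfrak g_0^f$, and let $\{c_j\},\{c^j\}$ be dual bases of $\mathfrak g_0$, all with respect to $(\cdot|\cdot)$. For $u\in\mathfrak g_{-1}$ put $$\psi(u)=u-\tfrac12\sum_k[u,u^k][e,u_k]-\tfrac18\sum_k[f,u^k][e,u\circ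 u_k]+\tfrac12\partial[e,u],$$ and let $L=f+\partial x+\tfrac12\sum_jc_jc^j$. Theorem. The elements $a\in\mathfrak g_0^f$ and $\psi(u)$, $u\in\mathfrak g_{-1}$, lie in $\mathcal W$ and generate it as a differential algebra. For $a,b\in\mathfrak g_0^f$ and $u,u_1\in\mathfrak g_{-1}$ (here $u_1$ is an arbitrary element, not the first basis vector): $$\{a_\lambda b\}_{z,\rho}=[a,b]+(a|b)\lambda,$$ $$\{a_\lambda\psi(u_1)\}_{z,\rho}=\psi([a,u_1])+z(s|[a,u_1]),\qquad \{\psi(u)_\lambda b\}_{z,\rho}=\psi([u,b])+z(s|[u,b]),$$ $$\begin{aligned}\{\psi(u)_\lambda\psi(u_1)\}_{z,\rho}={}&\tfrac12\sum_k\psi(u\circ u_k)[u_1,u^k]^\sharp-\tfrac12\sum_k\psi(u_1\circ u_k)[u,u^k]^\sharp\\&+\tfrac14\sum_{h,k}[[e,u_h],[e,u_k]]\,[u,u^h]^\sharp[u_1,u^k]^\sharp-\tfrac12(\partial+2\lambda)\psi(u\circ u_1)\\&+\tfrac14(\partial+2\lambda)\sum_k[[e,u],[e,u_k]]\,[u_1,u^k]^\sharp+\tfrac14\sum_k[[e,u_1],[e,u_k]]\,(\partial+\lambda)[u,u^k]^\sharp\\&-\tfrac14(3\lambda^2+3\lambda\partial+\partial^2)[[e,u],[e,u_1]]+\tfrac14(e|u\circ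 u_1)\lambda^3\\&+\tfrac12z\big([[e,u],[s,u_1]]^\sharp-[[e,u_1],[s,u]]^\sharp\big)-(s|u\circ u_1)z\lambda .\end{aligned}$$ Moreover $$L=\psi(f)+\tfrac12\sum_ia_ia^i,$$ and for $a\in\mathfrak g_0^f$, $u\in\mathfrak g_{-1}$ $$\{L_\lambda a\}_{z,\rho}=(\partial+\lambda)a,\qquad \{L_\lambda\psi(u)\}_{z,\rho}=(\partial+2\lambda)\psi(u)-\tfrac12(e|u)\lambda^3+2z(s|u)\lambda .$$ -/

import Mathlib

open scoped BigOperators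

namespace ClassicalW

noncomputable section

/-! ### The grading of a Lie algebra by half the eigenvalues of an `sl₂`-element -/

section Grading

variable {F : Type*} [Field F] {g : Type*} [LieRing g] [LieAlgebra F g]

variable (F) in
/-- The eigenspace `g_{n/2}` of `ad x`, for the eigenvalue `n/2`. -/
def gr (x : g) (n : ℤ) : Submodule F g :=
  Module.End.eigenspace (LieAlgebra.ad F g x) ((n : F) / 2)

variable (F) in
/-- `g_{≤ n/2}`, the sum of the `g_{m/2}` with `m ≤ n`. -/
def grLE (x : g) (n : ℤ) : Submodule F g := ⨆ (m : ℤ) (_ : m ≤ n), gr F x m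

variable (F) in
/-- `g_{≥ n/2}`, the sum of the `g_{m/2}` with `n ≤ m`. -/
def grGE (x : g) (n : ℤ) : Submodule F g := ⨆ (m : ℤ) (_ : n ≤ m), gr F x m

variable (F) in
/-- The `ad x`-eigenvalues are `-1, 0, 1`, that is `g = g_{-1} ⊕ g_0 ⊕ g_1` (a sum of eigenspaces
for distinct eigenvalues is automatically direct). -/
def IsShort (x : g) : Prop := gr F x (-2) ⊔ gr F x 0 ⊔ gr F x 2 = ⊤

variable (F) in
/-- The centralizer `g^f` of `f`. -/
def cent (f : g) : Submodule F g := LinearMap.ker (LieAlgebra.ad F g f)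

variable (F) in
/-- `g_0^f = g^f ∩ g_0`. -/
def cent0 (f x : g) : Submodule F g := cent F f ⊓ gr F x 0

open Classical in
/-- The projection onto `p` with kernel `q`, when `p` and `q` are complementary. -/
def projAlong (p q : Submodule F g) : g →ₗ[F] g :=
  if h : IsCompl p q then p.projection q h else 0

variable (F) in
/-- The projection `π_{≤ 1/2} : g → g_{≤ 1/2}` with kernel `g_{≥ 1}`. -/
def projLE (x : g) : g →ₗ[F] g := projAlong (grLE F x 1) (grGE F x 2)

variable (F) in
/-- The map `a ↦ a^♯`: on `g_{≤ 1/2} = g^f ⊕ [e, g_{≤ -1/2}]` it is the projection onto `g^f` with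
kernel `[e, g_{≤ -1/2}]`; it is extended to all of `g` by zero on `g_{≥ 1}`. -/
def sharp (e f x : g) : g →ₗ[F] g :=
  projAlong (cent F f) ((grLE F x (-1)).map (LieAlgebra.ad F g e : g →ₗ[F] g) ⊔ grGE F x 2)

/-- The Jordan product `u ∘ w = [[e, u], w]` (used on `g_{-1}`). -/
def jord (e u w : g) : g := ⁅⁅e, u⁆, w⁆

end Grading

/-! ### Differential polynomials and `λ`-brackets -/

section DiffPoly

variable {F : Type*} [Field F] {ι : Type*}

/-- The algebra of differential polynomials in the variables `u_i`, `i ∈ ι`; the variable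
`u_i^{(n)}` is `X (i, n)`. -/
abbrev DPoly (ι F : Type*) [Field F] : Type _ := MvPolynomial (ι × ℕ) F

/-- The derivation `∂` with `∂ u_i^{(n)} = u_i^{(n+1)}`. -/
def del : Derivation F (DPoly ι F) (DPoly ι F) :=
  MvPolynomial.mkDerivation F fun p => MvPolynomial.X (p.1, p.2 + 1)

/-- `∂` acting on the coefficients of a polynomial in `λ`; polynomials in `λ` with coefficients in
`DPoly ι F` are `Polynomial (DPoly ι F)`, and `λ` is `Polynomial.X`. -/
def delCoeff : Polynomial (DPoly ι F) →ₗ[F] Polynomial (DPoly ι F) :=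
  Polynomial.lsum fun n =>
    (Polynomial.monomial (R := DPoly ι F) n).restrictScalars F ∘ₗ (del (F := F) (ι := ι)).toLinearMap

/-- The operator `λ + ∂` on polynomials in `λ`. -/
def lamDel : Polynomial (DPoly ι F) →ₗ[F] Polynomial (DPoly ι F) :=
  LinearMap.mulLeft F (Polynomial.X : Polynomial (DPoly ι F)) + delCoeff

/-- `H(λ + ∂) P`, for `H = ∑ c_k λ^k`, is `∑ c_k (λ + ∂)^k P`. -/
def opSubst (H P : Polynomial (DPoly ι F)) : Polynomial (DPoly ι F) :=
  H.sum fun k c => Polynomial.C c * (lamDel ^ k) P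

/-- The `λ`-bracket on differential polynomials with `{u_i λ u_j} = H j i`, extended by
sesquilinearity and the Leibniz rules, i.e. by the master formula
`{P λ Q} = ∑ ∂Q/∂u_j^{(n)} (λ+∂)^n H_{ji}(λ+∂) (-λ-∂)^m ∂P/∂u_i^{(m)}`. All terms outside
the finite sets of variables occurring in `P` and in `Q` vanish. -/
def masterBracket (H : ι → ι → Polynomial (DPoly ι F)) (P Q : DPoly ι F) :
    Polynomial (DPoly ι F) :=
  ∑ p ∈ P.vars, ∑ q ∈ Q.vars,
    Polynomial.C (MvPolynomial.pderiv q Q) *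
      (lamDel ^ q.2) (opSubst (H q.1 p.1)
        ((-1 : F) ^ p.2 • (lamDel ^ p.2) (Polynomial.C (MvPolynomial.pderiv p P))))

end DiffPoly

/-! ### The classical `W`-algebra -/

section W

variable {F : Type*} [Field F] {g : Type*} [LieRing g] [LieAlgebra F g] {ι : Type*}

/-- The inclusion of `g` in `V(g) = S(F[∂] g)`. A basis `b` of `g` identifies `V(g)` with the
differential polynomials in the variables `b i`. -/
def inc (b : Module.Basis ι F g) : g →ₗ[F] DPoly ι F :=
  b.constr F fun i => MvPolynomial.X (i, 0)

/-- The bracket `{a λ c}_z = [a,c] + (a|c) λ + z (s|[a,c])` of elements of `g`. -/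
def affGen (b : Module.Basis ι F g) (B : LinearMap.BilinForm F g) (s : g) (z : F) (a c : g) :
    Polynomial (DPoly ι F) :=
  Polynomial.C (inc b ⁅a, c⁆) + algebraMap F _ (B a c) * Polynomial.X
    + algebraMap F _ (z * B s ⁅a, c⁆)

/-- The `λ`-bracket `{· λ ·}_z` on `V(g)`. -/
def affBracket (b : Module.Basis ι F g) (B : LinearMap.BilinForm F g) (s : g) (z : F)
    (P Q : DPoly ι F) : Polynomial (DPoly ι F) :=
  masterBracket (fun j i => affGen b B s z (b i) (b j)) P Q

/-- `V(g_{≤ 1/2})`, as a differential subalgebra of `V(g)`. -/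
def VLE (b : Module.Basis ι F g) (x : g) : Subalgebra F (DPoly ι F) :=
  Algebra.adjoin F {P | ∃ a ∈ grLE F x 1, ∃ n : ℕ, P = del^[n] (inc b a)}

/-- The differential algebra homomorphism `ρ` with `ρ(a) = π_{≤ 1/2}(a) + (f|a)` for `a ∈ g`. -/
def rho (b : Module.Basis ι F g) (B : LinearMap.BilinForm F g) (f x : g) :
    DPoly ι F →ₐ[F] DPoly ι F :=
  MvPolynomial.aeval fun p =>
    del^[p.2] (inc b (projLE F x (b p.1)) + algebraMap F _ (B f (b p.1)))

/-- `{P λ Q}_{z,ρ} = ρ {P λ Q}_z`, with `ρ` applied to the coefficients. -/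
def wBracket (b : Module.Basis ι F g) (B : LinearMap.BilinForm F g) (f x s : g) (z : F)
    (P Q : DPoly ι F) : Polynomial (DPoly ι F) :=
  (affBracket b B s z P Q).map (rho b B f x : DPoly ι F →+* DPoly ι F)

/-- The classical `W`-algebra: the `P ∈ V(g_{≤ 1/2})` with `ρ {a λ P}_z = 0` for all
`a ∈ g_{≥ 1/2}`. -/
def W (b : Module.Basis ι F g) (B : LinearMap.BilinForm F g) (f x s : g) (z : F) :
    Set (DPoly ι F) :=
  {P | P ∈ VLE b x ∧ ∀ a ∈ grGE F x 1, wBracket b B f x s z (inc b a) P = 0}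

/-- `ψ(w) = w - ½ ∑ [w,u^k][e,u_k] - ⅛ ∑ [f,u^k][e,w∘u_k] + ½ ∂[e,w]`, where `u k = u_k` and
`u' k = u^k` are dual bases of `g_{-1}` and `g_1`. -/
def psi (b : Module.Basis ι F g) (e f : g) {x : g} {K : Type*} [Fintype K]
    (u : Module.Basis K F (gr F x (-2))) (u' : Module.Basis K F (gr F x 2)) (w : g) : DPoly ι F :=
  inc b w
    - (1 / 2 : F) • ∑ k, inc b ⁅w, (u' k : g)⁆ * inc b ⁅e, (u k : g)⁆
    - (1 / 8 : F) • ∑ k, inc b ⁅f, (u' k : g)⁆ * inc b ⁅e, jord e w (u k : g)⁆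
    + (1 / 2 : F) • del (inc b ⁅e, w⁆)

/-- The Virasoro element
`L = f + x' + ½ ∑ c_j c^j + ∑ v^k [f,v_k] + ½ ∑ v^k ∂v_k`, where `c j = c_j`, `c' j = c^j` are
dual bases of `g_0`, and `v k = v_k`, `v' k = v^k` are bases of `g_{1/2}` with
`(f|[v_h, v^k]) = δ_{hk}`. -/
def virasoro (b : Module.Basis ι F g) (f x : g)
    {J₀ : Type*} [Fintype J₀] (c c' : Module.Basis J₀ F (gr F x 0))
    {Jh : Type*} [Fintype Jh] (v v' : Module.Basis Jh F (gr F x 1)) : DPoly ι F :=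
  inc b f + del (inc b x) + (1 / 2 : F) • ∑ j, inc b (c j : g) * inc b (c' j : g)
    + ∑ k, inc b (v' k : g) * inc b ⁅f, (v k : g)⁆
    + (1 / 2 : F) • ∑ k, inc b (v' k : g) * del (inc b (v k : g))

end W

end

end ClassicalW

/-!
The bracket `{P λ Q}` is a polynomial in `λ`, and `F` is infinite, so it is determined by its
values at the scalars `λ = l`. At a scalar `l` the master formula makes `Q ↦ {P λ Q}` a derivation
`adL l P` of `V(g)` with `D ∂ = (l + ∂) D`, and such a derivation is determined by its values on
`g` (`eval_affBracket`, `derivation_ext_inc`). The term `z (s|[a,c])` is absorbed by the shifted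
generators `incS p = p + z (s|p)`: in terms of these the bracket does not involve `z` any more.
Since `s ∈ g_1`, only the generators in `g_{-1}` are really shifted, so that `psiS w`, the element
`ψ(w)` written in the shifted generators, is `ψ(w) + z (s|w)`. This is where all terms with `z` in
the table come from.

Invariance. The elements of `g_0^f` and the `psiS w` are annihilated by `ρ {n_{λ+∂} ·}_→ h` for
all `n ∈ g_1` and all `h`, and not only for `h = 1`; for `psiS w` this is the contraction identity
`contract_psi`. Together with the Jacobi identity, needed only when the first two arguments are an
element of `g` and a polynomial of degree at most two (`adOp_one_comm_adL`), it follows that the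
brackets of the generators are invariant again (`rho_adOp_adL`).

Structure. The algebra `V(g_{≤ 1/2})` consists of the differential polynomials in the `ψ(u_k)`,
`a_i` and `[e,u_k]`. In these coordinates, and at a scalar value of `λ`, the operators
`ρ {u^k λ ·}` become derivations which annihilate the `ψ(u_k)` and the `a_i`, and which are
constant on the
`[e,u_k]` (`lamDer_toCoords`). As this holds for all values of `λ`, the coordinates of an
invariant do not involve the `[e,u_k]`. Hence the `ψ(u_k)` and `a_i` generate the invariants
(`mem_adjoin_of_invariant`). Moreover an invariant is determined by its image under the projection
`sharpHom` to the differential polynomials on `g^f` (`eq_zero_of_sharpHom`).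

Brackets. Both sides of each formula of the table are invariant, so they only need to be compared
after `sharpHom`. This projection kills `[e,g_{-1}]`, and therefore nearly all terms of the
bracket of the explicit expressions `ψ(w)`; what is left is a short computation (`adL_psiS_psiS`,
`rearrange_bracket`). The formulas for the Virasoro element follow, since it is the sum of `ψ(f)`
and the Sugawara element of `g_0^f` (`virasoro_eq`).
-/

namespace ClassicalW

noncomputable section

set_option linter.unusedSectionVars false

/-! ### Differential polynomials and the `λ`-bracket at scalar values of `λ` -/

section Calculus

variable {F : Type*} [Field F] {ι : Type*}

@[simp] lemma del_C (c : F) : del (ι := ι) (MvPolynomial.C c : DPoly ι F) = 0 :=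
  MvPolynomial.derivation_C _ c

@[simp] lemma del_algebraMap (c : F) : del (ι := ι) (algebraMap F (DPoly ι F) c) = 0 :=
  Derivation.map_algebraMap _ c

lemma del_X (p : ι × ℕ) :
    del (F := F) (MvPolynomial.X p) = MvPolynomial.X (p.1, p.2 + 1) :=
  MvPolynomial.mkDerivation_X F _ p

lemma X_eq_iterate_del (i : ι) (n : ℕ) :
    (MvPolynomial.X (i, n) : DPoly ι F) = del^[n] (MvPolynomial.X (i, 0)) := by
  induction n with
  | zero => rfl
  | succ n ih => rw [Function.iterate_succ_apply', ← ih, del_X]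

/-- The operator `λ + ∂` on differential polynomials, for a scalar value `l` of `λ`. -/
def shift (l : F) : DPoly ι F →ₗ[F] DPoly ι F :=
  l • LinearMap.id + (del (F := F) (ι := ι)).toLinearMap

lemma shift_apply (l : F) (P : DPoly ι F) : shift l P = l • P + del P := rfl

lemma shift_one (l : F) : shift l (1 : DPoly ι F) = l • 1 := by
  simp [shift_apply]

lemma shift_eq_C_mul (l : F) (P : DPoly ι F) : shift l P = MvPolynomial.C l * P + del P := by
  rw [shift_apply, MvPolynomial.smul_eq_C_mul]

lemma eval_lamDel (l : F) (P : Polynomial (DPoly ι F)) :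
    (lamDel P).eval (MvPolynomial.C l) = shift l (P.eval (MvPolynomial.C l)) := by
  induction P using Polynomial.induction_on' with
  | add P Q hP hQ => simp only [map_add, Polynomial.eval_add, hP, hQ]
  | monomial n a =>
    have h : delCoeff (Polynomial.monomial n a) = Polynomial.monomial n (del a) := by
      simp [delCoeff, Polynomial.lsum_apply, Polynomial.sum_monomial_index]
    rw [lamDel, LinearMap.add_apply, h, shift_eq_C_mul]
    simp only [LinearMap.mulLeft_apply, Polynomial.eval_add, Polynomial.eval_mul,
      Polynomial.eval_X, Polynomial.eval_monomial, Derivation.leibniz, smul_eq_mul,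
      ← map_pow, del_C]
    ring

lemma eval_lamDel_pow (l : F) (n : ℕ) (P : Polynomial (DPoly ι F)) :
    ((lamDel ^ n) P).eval (MvPolynomial.C l) = (shift l ^ n) (P.eval (MvPolynomial.C l)) := by
  induction n with
  | zero => simp
  | succ n ih => simp only [pow_succ', Module.End.mul_apply, eval_lamDel, ih]

lemma eval_opSubst_affine (l : F) (A : DPoly ι F) (c : F) (P : Polynomial (DPoly ι F)) :
    (opSubst (Polynomial.C A + Polynomial.C (algebraMap F _ c) * Polynomial.X) P).eval
        (MvPolynomial.C l) =
      A * P.eval (MvPolynomial.C l) + c • shift l (P.eval (MvPolynomial.C l)) := by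
  have h : ∀ n : ℕ, Polynomial.C (0 : DPoly ι F) * (lamDel ^ n) P = 0 := by simp
  rw [opSubst, Polynomial.sum_add_index _ _ _ h (by intro i a b; rw [map_add, add_mul]),
    Polynomial.sum_C_index (h 0), ← pow_one Polynomial.X, Polynomial.C_mul_X_pow_eq_monomial,
    Polynomial.sum_monomial_index _ _ (h 1)]
  simp [eval_lamDel, MvPolynomial.smul_eq_C_mul, MvPolynomial.algebraMap_eq]

/-- A polynomial in `λ` is determined by its values at the scalars. -/
lemma eq_of_forall_eval_C [CharZero F] {P Q : Polynomial (DPoly ι F)}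
    (h : ∀ l : F, P.eval (MvPolynomial.C l) = Q.eval (MvPolynomial.C l)) : P = Q := by
  refine Polynomial.eq_of_infinite_eval_eq P Q
    (Set.Infinite.mono (s := Set.range MvPolynomial.C) ?_ ?_)
  · rintro _ ⟨l, rfl⟩; exact h l
  · exact Set.infinite_range_of_injective (MvPolynomial.C_injective _ _)

/-- The derivation `D` with `D ∂ = (λ + ∂) D` and given values on the variables `u_i`. -/
def lamDer (l : F) (c : ι → DPoly ι F) : Derivation F (DPoly ι F) (DPoly ι F) :=
  MvPolynomial.mkDerivation F fun q => (shift l ^ q.2) (c q.1)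

lemma lamDer_X (l : F) (c : ι → DPoly ι F) (q : ι × ℕ) :
    lamDer l c (MvPolynomial.X q) = (shift l ^ q.2) (c q.1) :=
  MvPolynomial.mkDerivation_X F _ q

lemma lamDer_del (l : F) (c : ι → DPoly ι F) (P : DPoly ι F) :
    lamDer l c (del P) = shift l (lamDer l c P) := by
  induction P using MvPolynomial.induction_on with
  | C c => simp
  | add P Q hP hQ => simp only [map_add, hP, hQ]
  | mul_X P q hP =>
    have h : lamDer l c (del (MvPolynomial.X q)) = shift l (lamDer l c (MvPolynomial.X q)) := by
      rw [del_X, lamDer_X, lamDer_X, pow_succ', Module.End.mul_apply]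
    simp only [Derivation.leibniz, map_add, smul_eq_mul, hP, h]
    simp only [shift_apply, Derivation.leibniz, smul_eq_mul, mul_add, mul_smul_comm]
    ring

/-- A derivation is determined by the partial derivatives. -/
lemma derivation_apply_eq_sum_vars (D : Derivation F (DPoly ι F) (DPoly ι F)) (Q : DPoly ι F) :
    ∑ q ∈ Q.vars, MvPolynomial.pderiv q Q * D (MvPolynomial.X q) = D Q := by
  classical
  have key : ∀ (s : Finset (ι × ℕ)),
      ((∑ q ∈ s, D (MvPolynomial.X q) • MvPolynomial.pderiv q :
        Derivation F (DPoly ι F) (DPoly ι F))) Q =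
      ∑ q ∈ s, MvPolynomial.pderiv q Q * D (MvPolynomial.X q) := by
    intro s
    induction s using Finset.induction_on with
    | empty => simp
    | insert a s ha ih =>
      rw [Finset.sum_insert ha, Finset.sum_insert ha, Derivation.add_apply, ih,
        Derivation.smul_apply, smul_eq_mul, mul_comm]
  rw [← key]
  refine MvPolynomial.derivation_eq_of_forall_mem_vars fun i hi => ?_
  have key' : ∀ (s : Finset (ι × ℕ)),
      ((∑ q ∈ s, D (MvPolynomial.X q) • MvPolynomial.pderiv q :
        Derivation F (DPoly ι F) (DPoly ι F))) (MvPolynomial.X i) =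
      if i ∈ s then D (MvPolynomial.X i) else 0 := by
    intro s
    induction s using Finset.induction_on with
    | empty => simp
    | insert a s ha ih =>
      rw [Finset.sum_insert ha, Derivation.add_apply, ih, Derivation.smul_apply]
      by_cases h : i = a
      · subst h; simp [ha]
      · simp [MvPolynomial.pderiv_X_of_ne h, h]
  rw [key', if_pos hi]

section VarSum

variable {M : Type*} [AddCommGroup M] [Module F M] (G : ι × ℕ → DPoly ι F →ₗ[F] M)

lemma sum_vars_eq_sum (P : DPoly ι F) {s : Finset (ι × ℕ)} (hs : P.vars ⊆ s) :
    ∑ p ∈ P.vars, G p (MvPolynomial.pderiv p P) = ∑ p ∈ s, G p (MvPolynomial.pderiv p P) := by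
  refine Finset.sum_subset hs fun p _ hp => ?_
  rw [MvPolynomial.pderiv_eq_zero_of_notMem_vars hp, map_zero]

/-- The linear map `P ↦ ∑ G_p (∂P/∂p)`, the sum over the variables `p` of `P`. -/
def varSum : DPoly ι F →ₗ[F] M where
  toFun P := ∑ p ∈ P.vars, G p (MvPolynomial.pderiv p P)
  map_add' P Q := by
    classical
    rw [sum_vars_eq_sum G (P + Q) (MvPolynomial.vars_add_subset P Q),
      sum_vars_eq_sum G P (Finset.subset_union_left (s₂ := Q.vars)),
      sum_vars_eq_sum G Q (Finset.subset_union_right (s₁ := P.vars)), ← Finset.sum_add_distrib]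
    simp
  map_smul' c P := by
    have h : (c • P).vars ⊆ P.vars := by
      intro p hp
      rw [MvPolynomial.mem_vars_iff_mem_support] at hp ⊢
      obtain ⟨d, hd, hpd⟩ := hp
      exact ⟨d, MvPolynomial.support_smul hd, hpd⟩
    rw [sum_vars_eq_sum G (c • P) h]
    simp [Finset.smul_sum]

lemma varSum_eq (P : DPoly ι F) {s : Finset (ι × ℕ)} (hs : P.vars ⊆ s) :
    varSum G P = ∑ p ∈ s, G p (MvPolynomial.pderiv p P) := sum_vars_eq_sum G P hs

lemma varSum_one : varSum G 1 = 0 := by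
  rw [varSum_eq G 1 (s := ∅) (by simp)]; simp

lemma varSum_X (p : ι × ℕ) : varSum G (MvPolynomial.X p) = G p 1 := by
  rw [varSum_eq G _ (s := {p}) (by simp [MvPolynomial.vars_X])]; simp

lemma varSum_X_mul_X (p q : ι × ℕ) : varSum G (MvPolynomial.X p * MvPolynomial.X q) =
    G p (MvPolynomial.X q) + G q (MvPolynomial.X p) := by
  classical
  rw [varSum_eq G _ (s := {p} ∪ {q})
    ((MvPolynomial.vars_mul _ _).trans (by simp [MvPolynomial.vars_X]))]
  by_cases h : p = q
  · subst h; simp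
  · rw [Finset.sum_union (by simpa using h)]
    rw [Finset.sum_singleton, Finset.sum_singleton, MvPolynomial.pderiv_mul,
      MvPolynomial.pderiv_mul, MvPolynomial.pderiv_X_self, MvPolynomial.pderiv_X_self,
      MvPolynomial.pderiv_X_of_ne h, MvPolynomial.pderiv_X_of_ne (Ne.symm h)]
    simp

end VarSum

end Calculus

section AffineBracket

variable {F : Type*} [Field F] {g : Type*} [LieRing g] [LieAlgebra F g] {ι : Type*}
variable (b : Module.Basis ι F g)

@[simp] lemma inc_basis (i : ι) : inc b (b i) = MvPolynomial.X (i, 0) := by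
  simp [inc, Module.Basis.constr_basis]

/-- Differential induction on `V(g)`. -/
lemma dpoly_induction {p : DPoly ι F → Prop} (hC : ∀ c : F, p (algebraMap F _ c))
    (hadd : ∀ P Q, p P → p Q → p (P + Q)) (hmul : ∀ P Q, p P → p Q → p (P * Q))
    (hdel : ∀ P, p P → p (del P)) (hX : ∀ i, p (inc b (b i))) (P : DPoly ι F) : p P := by
  induction P using MvPolynomial.induction_on with
  | C c => exact hC c
  | add P Q hP hQ => exact hadd P Q hP hQ
  | mul_X P i hP =>
    refine hmul P _ hP ?_
    obtain ⟨i, n⟩ := i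
    induction n with
    | zero => rw [← inc_basis b]; exact hX i
    | succ n ih => have := hdel _ ih; rwa [del_X] at this

/-- The derivation `D` of `V(g)` with `D ∂ = (λ + ∂) D` and given values on `g`. -/
def evDer (l : F) : (g →ₗ[F] DPoly ι F) →ₗ[F] Derivation F (DPoly ι F) (DPoly ι F) where
  toFun c := lamDer l fun i => c (b i)
  map_add' c d := MvPolynomial.derivation_ext fun i => by simp [lamDer_X]
  map_smul' r c := MvPolynomial.derivation_ext fun i => by simp [lamDer_X]

lemma evDer_X (l : F) (c : g →ₗ[F] DPoly ι F) (q : ι × ℕ) :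
    evDer b l c (MvPolynomial.X q) = (shift l ^ q.2) (c (b q.1)) :=
  lamDer_X l (fun i => c (b i)) q

@[simp] lemma evDer_inc (l : F) (c : g →ₗ[F] DPoly ι F) (r : g) : evDer b l c (inc b r) = c r := by
  have : (evDer b l c).toLinearMap ∘ₗ inc b = c := b.ext fun i => by
    simp [evDer_X]
  exact LinearMap.congr_fun this r

lemma evDer_del (l : F) (c : g →ₗ[F] DPoly ι F) (P : DPoly ι F) :
    evDer b l c (del P) = shift l (evDer b l c P) :=
  lamDer_del l (fun i => c (b i)) P

/-- Derivations with `D ∂ = (λ + ∂) D` are determined by their values on `g`. -/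
lemma derivation_ext_inc {l : F} {D D' : Derivation F (DPoly ι F) (DPoly ι F)}
    (hD : ∀ P, D (del P) = shift l (D P)) (hD' : ∀ P, D' (del P) = shift l (D' P))
    (h : ∀ r, D (inc b r) = D' (inc b r)) (P : DPoly ι F) : D P = D' P := by
  induction P using dpoly_induction b with
  | hC c => simp
  | hadd P Q hP hQ => simp only [map_add, hP, hQ]
  | hmul P Q hP hQ => simp only [Derivation.leibniz, hP, hQ]
  | hdel P hP => rw [hD, hD', hP]
  | hX i => exact h _

variable (B : LinearMap.BilinForm F g) (s : g) (z : F)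

/-- The inclusion of `g` in `V(g)`, shifted by constants as `p ↦ p + z (s|p)`. In terms of the
shifted generators the bracket `{· λ ·}_z` takes the form of `{· λ ·}_0`. -/
def incS : g →ₗ[F] DPoly ι F := inc b + z • (Algebra.linearMap F (DPoly ι F) ∘ₗ B s)

lemma incS_apply (p : g) : incS b B s z p = inc b p + algebraMap F _ (z * B s p) := by
  simp [incS, Algebra.smul_def]

/-- The linear map `r ↦ {p_{λ+∂} r}_→ h` on `g`, for `p ∈ g` and `h ∈ V(g)`. -/
def adVal (l : F) : g →ₗ[F] DPoly ι F →ₗ[F] g →ₗ[F] DPoly ι F :=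
  LinearMap.mk₂ F (fun p h => LinearMap.mulRight F h ∘ₗ incS b B s z ∘ₗ
      (LieAlgebra.ad F g p : g →ₗ[F] g) + (B p).smulRight (shift l h))
    (by intro p q h; ext r; simp [add_mul, add_smul]; ring)
    (by intro c p h; ext r; simp [smul_smul])
    (by intro p h k; ext r; simp [mul_add]; ring)
    (by intro c p h; ext r; simp [smul_comm c])

lemma adVal_apply (l : F) (p : g) (h : DPoly ι F) (r : g) :
    adVal b B s z l p h r = incS b B s z ⁅p, r⁆ * h + B p r • shift l h := by
  simp [adVal]

/-- The derivation `Q ↦ {p_{λ+∂} Q}_→ h` of `V(g)`. -/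
def adOp (l : F) (p : g) (h : DPoly ι F) : Derivation F (DPoly ι F) (DPoly ι F) :=
  evDer b l (adVal b B s z l p h)

/-- The left adjoint action `P ↦ {P λ ·}_z` at a scalar value of `λ`, as a map to derivations. -/
def adL (l : F) : DPoly ι F →ₗ[F] Derivation F (DPoly ι F) (DPoly ι F) :=
  evDer b l ∘ₗ varSum fun p => adVal b B s z l (b p.1) ∘ₗ ((-1 : F) ^ p.2 • shift l ^ p.2)

/-- The master formula at a scalar value of `λ`. -/
lemma eval_affBracket (l : F) (P Q : DPoly ι F) :
    (affBracket b B s z P Q).eval (MvPolynomial.C l) = adL b B s z l P Q := by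
  rw [← derivation_apply_eq_sum_vars (adL b B s z l P) Q, affBracket, masterBracket,
    Finset.sum_comm, Polynomial.eval_finsetSum]
  refine Finset.sum_congr rfl fun q _ => ?_
  rw [adL, LinearMap.comp_apply, evDer_X, varSum_eq _ P subset_rfl, Polynomial.eval_finsetSum,
    LinearMap.sum_apply, map_sum, Finset.mul_sum]
  refine Finset.sum_congr rfl fun p _ => ?_
  have h : affGen b B s z (b p.1) (b q.1) = Polynomial.C (incS b B s z ⁅b p.1, b q.1⁆) +
      Polynomial.C (algebraMap F _ (B (b p.1) (b q.1))) * Polynomial.X := by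
    rw [affGen, incS_apply, Polynomial.C_add, Polynomial.algebraMap_apply,
      Polynomial.algebraMap_apply]
    ring
  simp only [Polynomial.eval_mul, Polynomial.eval_C, eval_lamDel_pow, h, eval_opSubst_affine,
    Polynomial.eval_smul, LinearMap.comp_apply, adVal_apply, LinearMap.smul_apply]

lemma adOp_del (l : F) (p : g) (h P : DPoly ι F) :
    adOp b B s z l p h (del P) = shift l (adOp b B s z l p h P) := evDer_del _ _ _ _

lemma adL_del (l : F) (P Q : DPoly ι F) :
    adL b B s z l P (del Q) = shift l (adL b B s z l P Q) := evDer_del _ _ _ _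

lemma derivation_incS (D : Derivation F (DPoly ι F) (DPoly ι F)) (r : g) :
    D (incS b B s z r) = D (inc b r) := by
  simp [incS_apply]

lemma adOp_incS (l : F) (p : g) (h : DPoly ι F) (r : g) :
    adOp b B s z l p h (incS b B s z r) = incS b B s z ⁅p, r⁆ * h + B p r • shift l h := by
  rw [derivation_incS, adOp, evDer_inc, adVal_apply]

lemma adOp_inc (l : F) (p : g) (h : DPoly ι F) (r : g) :
    adOp b B s z l p h (inc b r) = incS b B s z ⁅p, r⁆ * h + B p r • shift l h := by
  rw [adOp, evDer_inc, adVal_apply]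

lemma adOp_one_incS (l : F) (p q : g) :
    adOp b B s z l p 1 (incS b B s z q) = incS b B s z ⁅p, q⁆ + (B p q * l) • 1 := by
  rw [adOp_incS, mul_one, shift_one, smul_smul]

lemma adOp_add_left (l : F) (p q : g) (h : DPoly ι F) :
    adOp b B s z l (p + q) h = adOp b B s z l p h + adOp b B s z l q h := by
  simp [adOp]

lemma adOp_add_right (l : F) (p : g) (h k : DPoly ι F) :
    adOp b B s z l p (h + k) = adOp b B s z l p h + adOp b B s z l p k := by
  simp [adOp]

lemma adOp_smul_right (l : F) (p : g) (c : F) (h : DPoly ι F) :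
    adOp b B s z l p (c • h) = c • adOp b B s z l p h := by
  simp [adOp]

@[simp] lemma adL_one (l : F) : adL b B s z l 1 = 0 := by
  simp [adL, varSum_one]

@[simp] lemma adL_algebraMap (l c : F) : adL b B s z l (algebraMap F _ c) = 0 := by
  rw [Algebra.algebraMap_eq_smul_one, map_smul, adL_one, smul_zero]

lemma adL_inc (l : F) (p : g) : adL b B s z l (inc b p) = adOp b B s z l p 1 := by
  have : adL b B s z l ∘ₗ inc b = evDer b l ∘ₗ (adVal b B s z l).flip 1 := b.ext fun i => by
    simp [adL, varSum_X]
  exact LinearMap.congr_fun this p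

lemma adL_incS (l : F) (p : g) : adL b B s z l (incS b B s z p) = adOp b B s z l p 1 := by
  rw [incS_apply, map_add, adL_algebraMap, add_zero, adL_inc]

lemma adL_del_inc (l : F) (p : g) :
    adL b B s z l (del (inc b p)) = -l • adOp b B s z l p 1 := by
  have : adL b B s z l ∘ₗ del.toLinearMap ∘ₗ inc b = -l • (evDer b l ∘ₗ (adVal b B s z l).flip 1) :=
    b.ext fun i => by
      simp [adL, del_X, varSum_X, shift_one]
  exact LinearMap.congr_fun this p

lemma adL_del_incS (l : F) (p : g) :
    adL b B s z l (del (incS b B s z p)) = -l • adOp b B s z l p 1 := by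
  rw [incS_apply, map_add, del_algebraMap, add_zero, adL_del_inc]

lemma adL_inc_mul_inc (l : F) (p q : g) : adL b B s z l (inc b p * inc b q) =
    adOp b B s z l p (inc b q) + adOp b B s z l q (inc b p) := by
  have : ((LinearMap.mul F (DPoly ι F)).compl₁₂ (inc b) (inc b)).compr₂ (adL b B s z l) =
      ((adVal b B s z l).compl₂ (inc b)).compr₂ (evDer b l) +
      (((adVal b B s z l).compl₂ (inc b)).compr₂ (evDer b l)).flip :=
    b.ext fun i => b.ext fun j => by
      simp [adL, varSum_X_mul_X]
  exact LinearMap.congr_fun (LinearMap.congr_fun this p) q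

lemma adL_incS_mul_incS (l : F) (p q : g) : adL b B s z l (incS b B s z p * incS b B s z q) =
    adOp b B s z l p (incS b B s z q) + adOp b B s z l q (incS b B s z p) := by
  simp only [incS_apply, mul_add, add_mul, map_add, adL_inc_mul_inc, adOp_add_right,
    Algebra.algebraMap_eq_smul_one, mul_smul_comm, smul_mul_assoc, one_mul, mul_one, map_smul,
    adL_inc, adOp_smul_right, adL_one, smul_zero]
  module

/-- The span of the constants, the elements of `g` and `∂g`, and the products of two elements
of `g`. -/
def quad : Submodule F (DPoly ι F) := Submodule.span F
  ({1} ∪ Set.range (incS b B s z) ∪ Set.range (fun p => del (incS b B s z p)) ∪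
    Set.range (fun p : g × g => incS b B s z p.1 * incS b B s z p.2))

lemma quad_induction {p : DPoly ι F → Prop} (h1 : p 1) (hadd : ∀ P Q, p P → p Q → p (P + Q))
    (hsmul : ∀ (c : F) P, p P → p (c • P)) (hJ : ∀ q, p (incS b B s z q))
    (hdel : ∀ q, p (del (incS b B s z q)))
    (hmul : ∀ q r, p (incS b B s z q * incS b B s z r)) {P : DPoly ι F}
    (hP : P ∈ quad b B s z) : p P := by
  induction hP using Submodule.span_induction with
  | mem P h =>
    rcases h with ((h | ⟨q, rfl⟩) | ⟨q, rfl⟩) | ⟨⟨q, r⟩, rfl⟩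
    · rw [h]; exact h1
    · exact hJ q
    · exact hdel q
    · exact hmul q r
  | zero => simpa using hsmul 0 1 h1
  | add P Q _ _ hP hQ => exact hadd P Q hP hQ
  | smul c P _ hP => exact hsmul c P hP

lemma one_mem_quad : (1 : DPoly ι F) ∈ quad b B s z :=
  Submodule.subset_span (Or.inl (Or.inl (Or.inl rfl)))

lemma incS_mem_quad (p : g) : incS b B s z p ∈ quad b B s z :=
  Submodule.subset_span (Or.inl (Or.inl (Or.inr ⟨p, rfl⟩)))

lemma del_incS_mem_quad (p : g) : del (incS b B s z p) ∈ quad b B s z :=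
  Submodule.subset_span (Or.inl (Or.inr ⟨p, rfl⟩))

lemma incS_mul_incS_mem_quad (p q : g) : incS b B s z p * incS b B s z q ∈ quad b B s z :=
  Submodule.subset_span (Or.inr ⟨(p, q), rfl⟩)

lemma adOp_one_mem_quad (l : F) (p : g) {P : DPoly ι F} (hP : P ∈ quad b B s z) :
    adOp b B s z l p 1 P ∈ quad b B s z := by
  have h := adOp_one_incS b B s z l p
  refine quad_induction b B s z (p := fun P => adOp b B s z l p 1 P ∈ quad b B s z) ?_ ?_ ?_ ?_ ?_
    ?_ hP
  · simp
  · intro P Q hP hQ; rw [map_add]; exact add_mem hP hQ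
  · intro c P hP; rw [Derivation.map_smul]; exact Submodule.smul_mem _ _ hP
  · intro q
    rw [h]
    exact add_mem (incS_mem_quad b B s z _) (Submodule.smul_mem _ _ (one_mem_quad b B s z))
  · intro q
    rw [adOp_del, h, map_add, shift_apply, map_smul, shift_one, smul_smul]
    exact add_mem (add_mem (Submodule.smul_mem _ _ (incS_mem_quad b B s z _))
      (del_incS_mem_quad b B s z _))
      (Submodule.smul_mem _ _ (one_mem_quad b B s z))
  · intro q r
    rw [Derivation.leibniz, h, h, smul_add, smul_add, smul_eq_mul, smul_eq_mul, smul_eq_mul,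
      smul_eq_mul, mul_smul_comm, mul_smul_comm, mul_one, mul_one]
    exact add_mem
      (add_mem (incS_mul_incS_mem_quad b B s z _ _)
        (Submodule.smul_mem _ _ (incS_mem_quad b B s z _)))
      (add_mem (incS_mul_incS_mem_quad b B s z _ _)
        (Submodule.smul_mem _ _ (incS_mem_quad b B s z _)))

variable {B}

lemma derivation_shift {l m : F} {D : Derivation F (DPoly ι F) (DPoly ι F)}
    (hD : ∀ P, D (del P) = shift l (D P)) (h : DPoly ι F) :
    D (shift m h) = shift (l + m) (D h) := by
  simp only [shift_apply, map_add, Derivation.map_smul, hD, add_smul]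
  abel

lemma commutator_del {l m : F} {D D' : Derivation F (DPoly ι F) (DPoly ι F)}
    (hD : ∀ P, D (del P) = shift l (D P)) (hD' : ∀ P, D' (del P) = shift m (D' P))
    (P : DPoly ι F) : ⁅D, D'⁆ (del P) = shift (l + m) (⁅D, D'⁆ P) := by
  rw [Derivation.commutator_apply, hD, hD', derivation_shift hD, derivation_shift hD',
    Derivation.commutator_apply, map_sub, add_comm m l]

/-- The commutator of `{a λ ·}` and `{p_{μ+∂} ·}_→ h`. -/
lemma adOp_one_comm_adOp (hBi : ∀ p q r : g, B ⁅p, q⁆ r = B p ⁅q, r⁆) (l m : F)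
    (a p : g) (h Q : DPoly ι F) :
    adOp b B s z l a 1 (adOp b B s z m p h Q) - adOp b B s z m p h (adOp b B s z l a 1 Q) =
      adOp b B s z (l + m) ⁅a, p⁆ h Q +
        adOp b B s z (l + m) p (adOp b B s z l a 1 h) Q := by
  rw [← Derivation.commutator_apply, ← Derivation.add_apply]
  refine derivation_ext_inc b (l := l + m)
    (commutator_del (fun P => adOp_del ..) (fun P => adOp_del ..))
    (fun P => by simp only [Derivation.add_apply, adOp_del, map_add]) (fun r => ?_) Q
  have e1 : B p ⁅a, r⁆ = -B ⁅a, p⁆ r := by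
    rw [← hBi, ← lie_skew, map_neg, LinearMap.neg_apply]
  have e2 : incS b B s z ⁅a, ⁅p, r⁆⁆ =
      incS b B s z ⁅⁅a, p⁆, r⁆ + incS b B s z ⁅p, ⁅a, r⁆⁆ := by
    rw [leibniz_lie a p r, map_add]
  have e3 : shift (l + m) h = l • h + shift m h := by
    simp only [shift_apply, add_smul, add_assoc]
  simp only [Derivation.commutator_apply, Derivation.add_apply, adOp_inc, map_add,
    Derivation.leibniz, smul_eq_mul, Derivation.map_smul, adOp_incS, e1, e2, e3,
    derivation_shift (fun P => adOp_del b B s z l a 1 P), Derivation.map_one_eq_zero, hBi a p r,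
    shift_one, mul_one]
  simp only [Algebra.smul_def, map_neg, mul_zero]
  ring

/-- The Jacobi identity, with an element of `g` in the first argument and a polynomial of degree
at most two in the second. -/
lemma adOp_one_comm_adL (hBi : ∀ p q r : g, B ⁅p, q⁆ r = B p ⁅q, r⁆) (l m : F)
    (a : g) {P : DPoly ι F} (hP : P ∈ quad b B s z) (Q : DPoly ι F) :
    adOp b B s z l a 1 (adL b B s z m P Q) - adL b B s z m P (adOp b B s z l a 1 Q) =
      adL b B s z (l + m) (adOp b B s z l a 1 P) Q := by
  refine quad_induction b B s z (p := fun P => adOp b B s z l a 1 (adL b B s z m P Q) -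
    adL b B s z m P (adOp b B s z l a 1 Q) =
      adL b B s z (l + m) (adOp b B s z l a 1 P) Q) ?_ ?_ ?_ ?_ ?_ ?_ hP
  · simp
  · intro P R hP hR
    simp only [map_add, Derivation.add_apply, ← hP, ← hR]
    abel
  · intro c P hP
    simp only [map_smul, Derivation.map_smul, Derivation.smul_apply, ← hP, smul_sub]
  · intro p
    rw [adL_incS, adOp_one_comm_adOp b s z hBi, adOp_one_incS, map_add, adL_incS, map_smul,
      adL_one]
    simp [adOp]
  · intro p
    rw [adL_del_incS, Derivation.smul_apply, Derivation.smul_apply, Derivation.map_smul, ← smul_sub,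
      adOp_one_comm_adOp b s z hBi, adOp_del, adOp_one_incS, shift_apply]
    simp only [map_add, map_smul, Derivation.map_smul, Derivation.add_apply, Derivation.smul_apply,
      adL_incS, adL_del_incS, adL_one, Derivation.map_one_eq_zero, smul_zero,
      add_zero]
    have : adOp b B s z (l + m) p 0 = 0 := by simp [adOp]
    rw [this, Derivation.zero_apply]
    module
  · intro p q
    have h1 := adOp_one_comm_adOp b s z hBi l m a p (incS b B s z q) Q
    have h2 := adOp_one_comm_adOp b s z hBi l m a q (incS b B s z p) Q
    rw [adL_incS_mul_incS, Derivation.add_apply, Derivation.add_apply, map_add,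
      add_sub_add_comm, h1, h2]
    simp only [Derivation.leibniz, adOp_one_incS, smul_eq_mul, mul_add, map_add,
      Derivation.add_apply, adL_incS_mul_incS, mul_smul_comm, mul_one, map_smul,
      Derivation.smul_apply, adL_incS, adOp_add_right, adOp_smul_right]
    abel

end AffineBracket

/-! ### Short `sl₂`-triples -/

section ShortGrading

variable {F : Type*} [Field F] {g : Type*} [LieRing g] [LieAlgebra F g]

/-- An `sl₂`-triple `{f, 2x, e}` with `f` short, in a Lie algebra with a symmetric invariant
bilinear form. -/
structure ShortTriple (B : LinearMap.BilinForm F g) (e f x : g) : Prop where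
  symm : ∀ p q : g, B p q = B q p
  inv : ∀ p q r : g, B ⁅p, q⁆ r = B p ⁅q, r⁆
  lie_x_e : ⁅x, e⁆ = e
  lie_x_f : ⁅x, f⁆ = -f
  lie_e_f : ⁅e, f⁆ = (2 : F) • x
  short : IsShort F x

lemma mem_gr {x p : g} {n : ℤ} : p ∈ gr F x n ↔ ⁅x, p⁆ = ((n : F) / 2) • p := by
  rw [gr, Module.End.mem_eigenspace_iff, LieAlgebra.ad_apply]

lemma lie_mem_gr {x p q : g} {m n k : ℤ} (hp : p ∈ gr F x m) (hq : q ∈ gr F x n)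
    (hk : m + n = k) : ⁅p, q⁆ ∈ gr F x k := by
  rw [mem_gr] at *
  subst hk
  rw [leibniz_lie, hp, hq, smul_lie, lie_smul, ← add_smul]
  congr 1
  push_cast
  ring

variable [CharZero F]

lemma mem_gr_neg {x p : g} : p ∈ gr F x (-2) ↔ ⁅x, p⁆ = -p := by
  rw [mem_gr]; norm_num

lemma mem_gr_zero {x p : g} : p ∈ gr F x 0 ↔ ⁅x, p⁆ = 0 := by
  rw [mem_gr]; norm_num

lemma mem_gr_pos {x p : g} : p ∈ gr F x 2 ↔ ⁅x, p⁆ = p := by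
  rw [mem_gr]; norm_num

namespace ShortTriple

variable {B : LinearMap.BilinForm F g} {e f x : g}

lemma exists_decomp (H : ShortTriple B e f x) (p : g) :
    ∃ a ∈ gr F x (-2), ∃ b ∈ gr F x 0, ∃ c ∈ gr F x 2, p = a + b + c := by
  have hp : p ∈ gr F x (-2) ⊔ gr F x 0 ⊔ gr F x 2 := by rw [H.short]; trivial
  obtain ⟨q, hq, c, hc, rfl⟩ := Submodule.mem_sup.1 hp
  obtain ⟨a, ha, b, hb, rfl⟩ := Submodule.mem_sup.1 hq
  exact ⟨a, ha, b, hb, c, hc, rfl⟩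

lemma ad_cube (H : ShortTriple B e f x) (p : g) : ⁅x, ⁅x, ⁅x, p⁆⁆⁆ = ⁅x, p⁆ := by
  obtain ⟨a, ha, b, hb, c, hc, rfl⟩ := H.exists_decomp p
  rw [mem_gr_neg] at ha
  rw [mem_gr_zero] at hb
  rw [mem_gr_pos] at hc
  simp [ha, hb, hc]

lemma eq_zero_of_mem_gr (H : ShortTriple B e f x) {m : ℤ} (hm : m ≠ -2) (hm' : m ≠ 0)
    (hm2 : m ≠ 2) {p : g} (hp : p ∈ gr F x m) : p = 0 := by
  have h := H.ad_cube p
  rw [mem_gr] at hp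
  simp only [hp, lie_smul, smul_smul] at h
  rw [← sub_eq_zero, ← sub_smul, smul_eq_zero] at h
  refine h.resolve_left fun h => ?_
  have h' : ((m * (m - 2) * (m + 2) : ℤ) : F) = 0 := by
    push_cast
    linear_combination 8 * h
  rw [Int.cast_eq_zero, mul_eq_zero, mul_eq_zero] at h'
  omega

lemma grLE_one (H : ShortTriple B e f x) : grLE F x 1 = gr F x (-2) ⊔ gr F x 0 := by
  refine le_antisymm (iSup₂_le fun m hm => ?_) (sup_le ?_ ?_)
  · by_cases h1 : m = -2
    · subst h1; exact le_sup_left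
    by_cases h2 : m = 0
    · subst h2; exact le_sup_right
    · intro p hp
      rw [H.eq_zero_of_mem_gr h1 h2 (by omega) hp]
      exact zero_mem _
  · exact le_iSup₂_of_le (-2) (by norm_num) le_rfl
  · exact le_iSup₂_of_le 0 (by norm_num) le_rfl

lemma grLE_neg_one (H : ShortTriple B e f x) : grLE F x (-1) = gr F x (-2) := by
  refine le_antisymm (iSup₂_le fun m hm => ?_) (le_iSup₂_of_le (-2) (by norm_num) le_rfl)
  by_cases h1 : m = -2
  · subst h1; exact le_rfl
  · intro p hp
    rw [H.eq_zero_of_mem_gr h1 (by omega) (by omega) hp]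
    exact zero_mem _

lemma grGE_eq (H : ShortTriple B e f x) {n : ℤ} (h0 : 0 < n) (hn : n ≤ 2) :
    grGE F x n = gr F x 2 := by
  refine le_antisymm (iSup₂_le fun m hm => ?_) (le_iSup₂_of_le 2 hn le_rfl)
  by_cases h1 : m = 2
  · subst h1; exact le_rfl
  · intro p hp
    rw [H.eq_zero_of_mem_gr (by omega) (by omega) h1 hp]
    exact zero_mem _

lemma form_eq_zero (H : ShortTriple B e f x) {m n : ℤ} (h : m + n ≠ 0) {p q : g}
    (hp : p ∈ gr F x m) (hq : q ∈ gr F x n) : B p q = 0 := by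
  rw [mem_gr] at hp hq
  have h1 : B ⁅p, x⁆ q = B p ⁅x, q⁆ := H.inv p x q
  rw [← lie_skew, hp, hq] at h1
  simp only [map_neg, map_smul, LinearMap.neg_apply, LinearMap.smul_apply, smul_eq_mul] at h1
  have h2 : ((m + n : ℤ) : F) * B p q = 0 := by
    push_cast
    linear_combination -2 * h1
  exact (mul_eq_zero.1 h2).resolve_left (Int.cast_ne_zero.2 h)

lemma e_mem (H : ShortTriple B e f x) : e ∈ gr F x 2 := mem_gr_pos.2 H.lie_x_e

lemma f_mem (H : ShortTriple B e f x) : f ∈ gr F x (-2) := mem_gr_neg.2 H.lie_x_f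

lemma lie_eq_zero_of_neg (H : ShortTriple B e f x) {u w : g} (hu : u ∈ gr F x (-2))
    (hw : w ∈ gr F x (-2)) : ⁅u, w⁆ = 0 :=
  H.eq_zero_of_mem_gr (m := -4) (by norm_num) (by norm_num) (by norm_num)
    (lie_mem_gr hu hw (by norm_num))

lemma lie_eq_zero_of_pos (H : ShortTriple B e f x) {u w : g} (hu : u ∈ gr F x 2)
    (hw : w ∈ gr F x 2) : ⁅u, w⁆ = 0 :=
  H.eq_zero_of_mem_gr (m := 4) (by norm_num) (by norm_num) (by norm_num)
    (lie_mem_gr hu hw (by norm_num))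

lemma lie_f_e (H : ShortTriple B e f x) : ⁅f, e⁆ = -((2 : F) • x) := by
  rw [← lie_skew, H.lie_e_f]

lemma lie_e_mem (H : ShortTriple B e f x) {u : g} (hu : u ∈ gr F x (-2)) : ⁅e, u⁆ ∈ gr F x 0 :=
  lie_mem_gr H.e_mem hu (by norm_num)

lemma lie_f_mem (H : ShortTriple B e f x) {n : g} (hn : n ∈ gr F x 2) : ⁅f, n⁆ ∈ gr F x 0 :=
  lie_mem_gr H.f_mem hn (by norm_num)

lemma lie_f_mem_neg (H : ShortTriple B e f x) {p : g} (hp : p ∈ gr F x 0) :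
    ⁅f, p⁆ ∈ gr F x (-2) :=
  lie_mem_gr H.f_mem hp (by norm_num)

lemma jord_mem (H : ShortTriple B e f x) {u w : g} (hu : u ∈ gr F x (-2))
    (hw : w ∈ gr F x (-2)) : jord e u w ∈ gr F x (-2) :=
  lie_mem_gr (H.lie_e_mem hu) hw (by norm_num)

lemma lie_f_lie_e (H : ShortTriple B e f x) {u : g} (hu : u ∈ gr F x (-2)) :
    ⁅f, ⁅e, u⁆⁆ = (2 : F) • u := by
  rw [leibniz_lie, H.lie_f_e, H.lie_eq_zero_of_neg H.f_mem hu, lie_zero, add_zero, neg_lie,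
    smul_lie, mem_gr_neg.1 hu, smul_neg, neg_neg]

lemma lie_e_lie_f (H : ShortTriple B e f x) {n : g} (hn : n ∈ gr F x 2) :
    ⁅e, ⁅f, n⁆⁆ = (2 : F) • n := by
  rw [leibniz_lie, H.lie_e_f, H.lie_eq_zero_of_pos H.e_mem hn, lie_zero, add_zero,
    smul_lie, mem_gr_pos.1 hn]

lemma lie_e_lie_f_lie_f (H : ShortTriple B e f x) {n : g} (hn : n ∈ gr F x 2) :
    ⁅e, ⁅f, ⁅f, n⁆⁆⁆ = (2 : F) • ⁅f, n⁆ := by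
  rw [leibniz_lie, H.lie_e_f, H.lie_e_lie_f hn, lie_smul, smul_lie,
    mem_gr_zero.1 (H.lie_f_mem hn), smul_zero, zero_add]

lemma mem_cent0 {p : g} : p ∈ cent0 F f x ↔ ⁅f, p⁆ = 0 ∧ p ∈ gr F x 0 := by
  simp [cent0, cent]

lemma lie_e_eq_zero (H : ShortTriple B e f x) {p : g} (hp : p ∈ cent0 F f x) : ⁅e, p⁆ = 0 := by
  obtain ⟨h1, h2⟩ := mem_cent0.1 hp
  have h3 := H.lie_e_lie_f (lie_mem_gr H.e_mem h2 (by norm_num))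
  rw [leibniz_lie f e p, H.lie_f_e, h1, neg_lie, smul_lie, mem_gr_zero.1 h2] at h3
  simpa using h3.symm

lemma jord_comm (H : ShortTriple B e f x) {u w : g} (hu : u ∈ gr F x (-2))
    (hw : w ∈ gr F x (-2)) : jord e u w = jord e w u := by
  have h : ⁅e, ⁅u, w⁆⁆ = 0 := by rw [H.lie_eq_zero_of_neg hu hw, lie_zero]
  rw [leibniz_lie, ← lie_skew u] at h
  exact add_neg_eq_zero.1 h

lemma lie_neg_lie_e (H : ShortTriple B e f x) {u w : g} (hu : u ∈ gr F x (-2))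
    (hw : w ∈ gr F x (-2)) : ⁅w, ⁅e, u⁆⁆ = -jord e w u := by
  rw [← lie_skew, ← H.jord_comm hu hw]; rfl

lemma lie_lie_e_mem_cent0 (H : ShortTriple B e f x) {u w : g} (hu : u ∈ gr F x (-2))
    (hw : w ∈ gr F x (-2)) : ⁅⁅e, u⁆, ⁅e, w⁆⁆ ∈ cent0 F f x := by
  refine mem_cent0.2 ⟨?_, lie_mem_gr (H.lie_e_mem hu) (H.lie_e_mem hw) (by norm_num)⟩
  rw [leibniz_lie, H.lie_f_lie_e hu, H.lie_f_lie_e hw, smul_lie, lie_smul, H.lie_neg_lie_e hw hu,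
    ← smul_add]
  change (2 : F) • (-jord e u w + jord e u w) = 0
  simp

lemma sub_mem_cent0 (H : ShortTriple B e f x) {p : g} (hp : p ∈ gr F x 0) :
    p - (1 / 2 : F) • ⁅e, ⁅f, p⁆⁆ ∈ cent0 F f x := by
  have h := H.lie_f_mem_neg hp
  refine mem_cent0.2 ⟨?_, sub_mem hp (Submodule.smul_mem _ _ (H.lie_e_mem h))⟩
  rw [lie_sub, lie_smul, H.lie_f_lie_e h, smul_smul]
  norm_num

lemma lie_f_lie_f (H : ShortTriple B e f x) {n : g} (hn : n ∈ gr F x 2) :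
    ⁅f, ⁅f, n⁆⁆ ∈ gr F x (-2) := H.lie_f_mem_neg (H.lie_f_mem hn)

/-- `projLE` is not the junk value of `projAlong`: the two subspaces are complementary. -/
lemma isCompl_grLE_grGE (H : ShortTriple B e f x) : IsCompl (grLE F x 1) (grGE F x 2) := by
  rw [H.grLE_one, H.grGE_eq (by norm_num) le_rfl]
  refine ⟨Submodule.disjoint_def.2 fun p hp hp2 => ?_, codisjoint_iff.2 H.short⟩
  obtain ⟨a, ha, c, hc, rfl⟩ := Submodule.mem_sup.1 hp
  rw [mem_gr_neg] at ha
  rw [mem_gr_zero] at hc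
  rw [mem_gr_pos, lie_add, ha, hc, add_zero] at hp2
  have h3 := congrArg (fun q => ⁅x, q⁆) hp2
  simp only [lie_neg, lie_add, ha, hc, add_zero, neg_neg] at h3
  have h4 : (2 : F) • a = 0 := by rw [two_smul]; nth_rw 1 [h3]; simp
  have h5 : a = 0 := by simpa using h4
  rw [h5] at hp2 ⊢
  simpa using hp2.symm

lemma projLE_of_pos (H : ShortTriple B e f x) {p : g} (hp : p ∈ gr F x 2) :
    projLE F x p = 0 := by
  rw [projLE, projAlong, dif_pos H.isCompl_grLE_grGE, Submodule.projection_apply_eq_zero_iff,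
    H.grGE_eq (by norm_num) le_rfl]
  exact hp

/-- `sharp` is not the junk value of `projAlong`: the two subspaces are complementary. -/
lemma isCompl_cent (H : ShortTriple B e f x) : IsCompl (cent F f)
    ((grLE F x (-1)).map (LieAlgebra.ad F g e : g →ₗ[F] g) ⊔ grGE F x 2) := by
  rw [H.grLE_neg_one, H.grGE_eq (by norm_num) le_rfl]
  refine ⟨Submodule.disjoint_def.2 fun p hp hp2 => ?_, codisjoint_iff.2 (eq_top_iff.2 ?_)⟩
  · obtain ⟨q, ⟨y, hy, rfl⟩, n, hn, rfl⟩ := Submodule.mem_sup.1 hp2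
    have h1 : ⁅f, ⁅e, y⁆ + n⁆ = 0 := hp
    rw [lie_add, H.lie_f_lie_e hy] at h1
    have h2 : ⁅x, ⁅f, n⁆⁆ = 0 := mem_gr_zero.1 (H.lie_f_mem hn)
    -- `ad x` separates the components in `g_{-1}` and `g_0`
    have h3 := congrArg (fun q => ⁅x, q⁆) h1
    simp only [lie_add, lie_smul, mem_gr_neg.1 hy, h2, lie_zero, add_zero, smul_neg] at h3
    have h4 : y = 0 := by simpa using h3
    have h5 := H.lie_e_lie_f hn
    rw [h4, smul_zero, zero_add] at h1
    rw [h1, lie_zero] at h5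
    have h6 : n = 0 := by simpa using h5.symm
    rw [h4, h6]; simp
  · intro p _
    obtain ⟨a, ha, c, hc, n, hn, rfl⟩ := H.exists_decomp p
    have h1 : a + (c - (1 / 2 : F) • ⁅e, ⁅f, c⁆⁆) ∈ cent F f := by
      refine add_mem ?_ (H.sub_mem_cent0 hc).1
      exact H.lie_eq_zero_of_neg H.f_mem ha
    refine Submodule.mem_sup.2 ⟨_, h1, ⁅e, (1 / 2 : F) • ⁅f, c⁆⁆ + n, ?_, ?_⟩
    · exact Submodule.mem_sup.2 ⟨_, ⟨_, Submodule.smul_mem _ _ (H.lie_f_mem_neg hc), rfl⟩, n, hn,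
        rfl⟩
    · rw [lie_smul]; abel

lemma sharp_of_cent (H : ShortTriple B e f x) {p : g} (hp : p ∈ cent F f) :
    sharp F e f x p = p := by
  rw [sharp, projAlong, dif_pos H.isCompl_cent]
  exact Submodule.projection_apply_of_mem_left _ hp

lemma sharp_of_neg (H : ShortTriple B e f x) {p : g} (hp : p ∈ gr F x (-2)) :
    sharp F e f x p = p := H.sharp_of_cent (H.lie_eq_zero_of_neg H.f_mem hp)

lemma sharp_of_cent0 (H : ShortTriple B e f x) {p : g} (hp : p ∈ cent0 F f x) :
    sharp F e f x p = p := H.sharp_of_cent hp.1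

lemma sharp_lie_e (H : ShortTriple B e f x) {u : g} (hu : u ∈ gr F x (-2)) :
    sharp F e f x ⁅e, u⁆ = 0 := by
  rw [sharp, projAlong, dif_pos H.isCompl_cent, Submodule.projection_apply_eq_zero_iff,
    H.grLE_neg_one]
  exact Submodule.mem_sup_left ⟨u, hu, rfl⟩

lemma sharp_of_zero (H : ShortTriple B e f x) {p : g} (hp : p ∈ gr F x 0) :
    sharp F e f x p = p - (1 / 2 : F) • ⁅e, ⁅f, p⁆⁆ := by
  conv_lhs => rw [← sub_add_cancel p ((1 / 2 : F) • ⁅e, ⁅f, p⁆⁆)]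
  rw [map_add, map_smul, H.sharp_lie_e (H.lie_f_mem_neg hp), smul_zero, add_zero,
    H.sharp_of_cent0 (H.sub_mem_cent0 hp)]

lemma sharp_mem_cent0 (H : ShortTriple B e f x) {p : g} (hp : p ∈ gr F x 0) :
    sharp F e f x p ∈ cent0 F f x := by
  rw [H.sharp_of_zero hp]; exact H.sub_mem_cent0 hp

lemma sharp_lie_f (H : ShortTriple B e f x) {n : g} (hn : n ∈ gr F x 2) :
    sharp F e f x ⁅f, n⁆ = 0 := by
  have h := congrArg (sharp F e f x) (H.lie_e_lie_f_lie_f hn)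
  rw [H.sharp_lie_e (H.lie_f_lie_f hn), map_smul] at h
  simpa using h.symm

lemma sharp_lie_lie_e_lie_e (H : ShortTriple B e f x) {u w : g} (hu : u ∈ gr F x (-2))
    (hw : w ∈ gr F x (-2)) : sharp F e f x ⁅w, ⁅e, ⁅e, u⁆⁆⁆ = ⁅⁅e, u⁆, ⁅e, w⁆⁆ := by
  have h : ⁅w, ⁅e, ⁅e, u⁆⁆⁆ = ⁅⁅e, u⁆, ⁅e, w⁆⁆ - ⁅e, jord e u w⁆ := by
    rw [← lie_skew, lie_lie e ⁅e, u⁆ w, neg_sub]; rfl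
  rw [h, map_sub, H.sharp_lie_e (H.jord_mem hu hw), sub_zero,
    H.sharp_of_cent0 (H.lie_lie_e_mem_cent0 hu hw)]

/-- The pairing of `g_1` with `[e, g_{-1}]` through `f`. -/
lemma form_f_lie_lie_e (H : ShortTriple B e f x) {n : g} (hn : n ∈ gr F x 2) (u : g) :
    B f ⁅n, ⁅e, u⁆⁆ = -2 * B n u := by
  rw [← H.inv, ← H.inv, ← lie_skew, H.lie_e_lie_f hn]
  simp

lemma form_f_lie_cent0 (H : ShortTriple B e f x) {n p : g} (hp : p ∈ cent0 F f x) :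
    B f ⁅n, p⁆ = 0 := by
  rw [← lie_skew, map_neg, ← H.inv, (mem_cent0.1 hp).1]; simp

lemma form_lie_e_cent0 (H : ShortTriple B e f x) {u p : g} (hp : p ∈ cent0 F f x) :
    B ⁅e, u⁆ p = 0 := by
  rw [H.symm, ← H.inv, ← lie_skew, H.lie_e_eq_zero hp]; simp

lemma form_lie_e_lie_e (H : ShortTriple B e f x) (u w : g) :
    B ⁅e, u⁆ ⁅e, w⁆ = -B e (jord e u w) := by
  rw [← H.inv, ← lie_skew, jord, ← H.inv, map_neg, LinearMap.neg_apply]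

end ShortTriple

section Dual

variable {B : LinearMap.BilinForm F g} {M : Type*} [AddCommGroup M] [Module F M]

/-- Expansion of an element of `p` in dual bases of `p` and `q`. -/
lemma sum_form_smul {K : Type*} [Fintype K] [DecidableEq K] {p q : Submodule F g}
    {u : Module.Basis K F p} {u' : Module.Basis K F q}
    (hu : ∀ h k, B (u h : g) (u' k : g) = if h = k then 1 else 0) {w : g} (hw : w ∈ p)
    (φ : g →ₗ[F] M) : ∑ k, B w (u' k : g) • φ (u k : g) = φ w := by
  have h : ∀ k, B w (u' k : g) = u.repr ⟨w, hw⟩ k := by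
    intro k
    have := congrArg (fun v : p => B (v : g) (u' k : g)) (u.sum_repr ⟨w, hw⟩)
    simp only [Submodule.coe_sum, Submodule.coe_smul, map_sum, map_smul, LinearMap.sum_apply,
      LinearMap.smul_apply, hu, smul_eq_mul, mul_ite, mul_one, mul_zero, Finset.sum_ite_eq',
      Finset.mem_univ, if_true] at this
    exact this.symm
  have h2 := congrArg (fun v : p => φ (v : g)) (u.sum_repr ⟨w, hw⟩)
  simp only [Submodule.coe_sum, Submodule.coe_smul, map_sum, map_smul] at h2
  simp only [h, h2]

variable {e f x : g} {K : Type*} [Fintype K] [DecidableEq K]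
  {u : Module.Basis K F (gr F x (-2))} {u' : Module.Basis K F (gr F x 2)}

lemma ShortTriple.dual_symm (H : ShortTriple B e f x) {K : Type*} [DecidableEq K]
    {p q : Submodule F g} {u : Module.Basis K F p} {u' : Module.Basis K F q}
    (hu : ∀ h k, B (u h : g) (u' k : g) = if h = k then 1 else 0) (h k : K) :
    B (u' h : g) (u k : g) = if h = k then 1 else 0 := by
  rw [H.symm, hu]; simp only [eq_comm]

/-- The identity in `g` behind the invariance of `ψ(w)`. -/
lemma ShortTriple.lie_identity (H : ShortTriple B e f x) {n w : g} (hn : n ∈ gr F x 2)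
    (hw : w ∈ gr F x (-2)) :
    (1 / 2 : F) • ⁅e, ⁅⁅f, n⁆, w⁆⁆ - (1 / 4 : F) • ⁅f, ⁅n, ⁅e, w⁆⁆⁆
      + (1 / 8 : F) • ⁅e, jord e w ⁅⁅f, n⁆, f⁆⁆ = 0 := by
  -- With `m = [f,[f,n]]` one has `[f,n] = ½ [e,m]` and `n = ¼ [e,[e,m]]`.
  set m := ⁅f, ⁅f, n⁆⁆ with hm
  have hmem : m ∈ gr F x (-2) := H.lie_f_lie_f hn
  have h1 : ⁅f, n⁆ = (1 / 2 : F) • ⁅e, m⁆ := by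
    rw [hm, H.lie_e_lie_f_lie_f hn, smul_smul]; norm_num
  have h2 : n = (1 / 4 : F) • ⁅e, ⁅e, m⁆⁆ := by
    rw [hm, H.lie_e_lie_f_lie_f hn, lie_smul, H.lie_e_lie_f hn, smul_smul, smul_smul]; norm_num
  have h3 : ⁅⁅f, n⁆, w⁆ = (1 / 2 : F) • jord e m w := by rw [h1, smul_lie, jord]
  have h4 : ⁅⁅f, n⁆, f⁆ = -m := by rw [← lie_skew]
  have h5 : ⁅n, w⁆ = (1 / 4 : F) • (⁅e, jord e m w⁆ - ⁅⁅e, m⁆, ⁅e, w⁆⁆) := by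
    conv_lhs => rw [h2]
    rw [smul_lie, lie_lie e, jord]
  have h6 : ⁅f, ⁅n, ⁅e, w⁆⁆⁆ = (1 / 2 : F) • ⁅e, jord e m w⁆ := by
    rw [leibniz_lie, H.lie_f_lie_e hw, lie_smul, h5, h1, smul_lie]
    module
  have h7 : jord e w (-m) = -jord e m w := by
    rw [← H.jord_comm hw hmem]; simp [jord]
  rw [h3, h4, h6, h7]
  simp only [lie_smul, lie_neg]
  module

/-- Contraction of the quadratic part of `ψ(w)` with the functional `p ↦ (f|[n,p])`. -/
lemma ShortTriple.contract_psi (H : ShortTriple B e f x)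
    (hu : ∀ h k, B (u h : g) (u' k : g) = if h = k then 1 else 0)
    {n w : g} (hn : n ∈ gr F x 2) (hw : w ∈ gr F x (-2)) (φ : g →ₗ[F] M) :
    (1 / 2 : F) • ∑ k, (B f ⁅n, ⁅e, (u k : g)⁆⁆ • φ ⁅w, (u' k : g)⁆
        + B f ⁅n, ⁅w, (u' k : g)⁆⁆ • φ ⁅e, (u k : g)⁆)
      + (1 / 8 : F) • ∑ k, (B f ⁅n, ⁅e, jord e w (u k)⁆⁆ • φ ⁅f, (u' k : g)⁆
        + B f ⁅n, ⁅f, (u' k : g)⁆⁆ • φ ⁅e, jord e w (u k)⁆) = φ ⁅n, w⁆ := by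
  have hu' := H.dual_symm hu
  have hfn : ⁅f, n⁆ ∈ gr F x 0 := H.lie_f_mem hn
  have hnew : ⁅n, ⁅e, w⁆⁆ ∈ gr F x 2 := lie_mem_gr hn (H.lie_e_mem hw) (by norm_num)
  have s1 : ∑ k, B f ⁅n, ⁅e, (u k : g)⁆⁆ • φ ⁅w, (u' k : g)⁆ = φ ((-2 : F) • ⁅w, n⁆) := by
    have := sum_form_smul hu' (Submodule.smul_mem _ (-2 : F) hn)
      (φ ∘ₗ (LieAlgebra.ad F g w : g →ₗ[F] g))
    simp only [LinearMap.comp_apply, LieAlgebra.ad_apply, map_smul,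
      LinearMap.smul_apply, smul_eq_mul] at this
    rw [map_smul, ← this]
    exact Finset.sum_congr rfl fun k _ => by rw [H.form_f_lie_lie_e hn]
  have s2 : ∑ k, B f ⁅n, ⁅w, (u' k : g)⁆⁆ • φ ⁅e, (u k : g)⁆ = φ ⁅e, ⁅⁅f, n⁆, w⁆⁆ := by
    have := sum_form_smul hu (lie_mem_gr hfn hw (by norm_num))
      (φ ∘ₗ (LieAlgebra.ad F g e : g →ₗ[F] g))
    simp only [LinearMap.comp_apply, LieAlgebra.ad_apply] at this
    rw [← this]
    exact Finset.sum_congr rfl fun k _ => by rw [H.inv, H.inv]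
  have s3 : ∑ k, B f ⁅n, ⁅e, jord e w (u k)⁆⁆ • φ ⁅f, (u' k : g)⁆ =
      φ ((-2 : F) • ⁅f, ⁅n, ⁅e, w⁆⁆⁆) := by
    have := sum_form_smul hu' (Submodule.smul_mem _ (-2 : F) hnew)
      (φ ∘ₗ (LieAlgebra.ad F g f : g →ₗ[F] g))
    simp only [LinearMap.comp_apply, LieAlgebra.ad_apply, map_smul,
      LinearMap.smul_apply, smul_eq_mul] at this
    rw [map_smul, ← this]
    exact Finset.sum_congr rfl fun k _ => by
      rw [H.form_f_lie_lie_e hn, H.inv, jord]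
  have s4 : ∑ k, B f ⁅n, ⁅f, (u' k : g)⁆⁆ • φ ⁅e, jord e w (u k)⁆ =
      φ ⁅e, jord e w ⁅⁅f, n⁆, f⁆⁆ := by
    have := sum_form_smul hu (lie_mem_gr hfn H.f_mem (by norm_num))
      (φ ∘ₗ (LieAlgebra.ad F g e : g →ₗ[F] g) ∘ₗ (LieAlgebra.ad F g ⁅e, w⁆ : g →ₗ[F] g))
    simp only [LinearMap.comp_apply, LieAlgebra.ad_apply] at this
    simp only [jord]
    rw [← this]
    exact Finset.sum_congr rfl fun k _ => by rw [H.inv, H.inv]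
  rw [Finset.sum_add_distrib, Finset.sum_add_distrib, s1, s2, s3, s4, ← map_add, ← map_add,
    ← map_smul, ← map_smul, ← map_add]
  congr 1
  have h := H.lie_identity hn hw
  rw [← lie_skew n w]
  rw [← sub_eq_zero, ← h]
  module

end Dual

end ShortGrading

/-! ### The homomorphism `ρ` and the invariants -/

section Invariants

variable {F : Type*} [Field F] {g : Type*} [LieRing g] [LieAlgebra F g] {ι : Type*}
variable (b : Module.Basis ι F g) {B : LinearMap.BilinForm F g} {e f x : g} {s : g} {z : F}

lemma inc_mem_VLE {p : g} (hp : p ∈ grLE F x 1) : inc b p ∈ VLE b x :=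
  Algebra.subset_adjoin ⟨p, hp, 0, rfl⟩

lemma del_mem_adjoin {S : Set (DPoly ι F)} (hS : ∀ P ∈ S, del P ∈ Algebra.adjoin F S)
    {P : DPoly ι F} (hP : P ∈ Algebra.adjoin F S) : del P ∈ Algebra.adjoin F S := by
  induction hP using Algebra.adjoin_induction with
  | mem P hP => exact hS P hP
  | algebraMap c => rw [del_algebraMap]; exact zero_mem _
  | add P Q _ _ hP hQ => rw [map_add]; exact add_mem hP hQ
  | mul P Q hP' hQ' hP hQ =>
    rw [Derivation.leibniz]; exact add_mem (mul_mem hP' hQ) (mul_mem hQ' hP)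

lemma del_mem_VLE {P : DPoly ι F} (hP : P ∈ VLE b x) : del P ∈ VLE b x := by
  refine del_mem_adjoin ?_ hP
  rintro _ ⟨a, ha, n, rfl⟩
  exact Algebra.subset_adjoin ⟨a, ha, n + 1, (Function.iterate_succ_apply' _ _ _).symm⟩

lemma shift_mem_VLE (l : F) {P : DPoly ι F} (hP : P ∈ VLE b x) : shift l P ∈ VLE b x := by
  rw [shift_apply]; exact add_mem (Subalgebra.smul_mem _ hP l) (del_mem_VLE b hP)

/-- Differential induction on `V(g_{≤ 1/2})`. -/
lemma VLE_induction {p : DPoly ι F → Prop} (hC : ∀ c : F, p (algebraMap F _ c))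
    (hadd : ∀ P Q, p P → p Q → p (P + Q))
    (hmul : ∀ P Q, P ∈ VLE b x → Q ∈ VLE b x → p P → p Q → p (P * Q))
    (hdel : ∀ P, P ∈ VLE b x → p P → p (del P)) (hX : ∀ a ∈ grLE F x 1, p (inc b a))
    {P : DPoly ι F} (hP : P ∈ VLE b x) : p P := by
  induction hP using Algebra.adjoin_induction with
  | mem P h =>
    obtain ⟨a, ha, n, rfl⟩ := h
    induction n with
    | zero => exact hX a ha
    | succ n ih =>
      rw [Function.iterate_succ_apply']
      exact hdel _ (Algebra.subset_adjoin ⟨a, ha, n, rfl⟩) ih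
  | algebraMap c => exact hC c
  | add P Q _ _ hP hQ => exact hadd P Q hP hQ
  | mul P Q hP' hQ' hP hQ => exact hmul P Q hP' hQ' hP hQ

/-- A homomorphism commuting with `∂` on the variables commutes with `∂`. -/
lemma aeval_iterate_del {κ : Type*} {c : ι → DPoly κ F} (P : DPoly ι F) :
    MvPolynomial.aeval (fun p : ι × ℕ => del^[p.2] (c p.1)) (del P) =
      del (MvPolynomial.aeval (fun p : ι × ℕ => del^[p.2] (c p.1)) P) := by
  induction P using MvPolynomial.induction_on with
  | C r => simp
  | add P Q hP hQ => simp only [map_add, hP, hQ]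
  | mul_X P q hP =>
    simp only [Derivation.leibniz, map_add, smul_eq_mul, map_mul, hP, del_X,
      MvPolynomial.aeval_X, Function.iterate_succ_apply']

lemma aeval_iterate_del_inc {κ : Type*} (c : g →ₗ[F] DPoly κ F) (r : g) :
    MvPolynomial.aeval (fun p : ι × ℕ => del^[p.2] (c (b p.1))) (inc b r) = c r := by
  have : (MvPolynomial.aeval (fun p : ι × ℕ => del^[p.2] (c (b p.1)))).toLinearMap ∘ₗ inc b = c :=
    b.ext fun i => by simp
  exact LinearMap.congr_fun this r

lemma rho_del (P : DPoly ι F) : rho b B f x (del P) = del (rho b B f x P) :=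
  aeval_iterate_del (c := fun i => inc b (projLE F x (b i)) + algebraMap F _ (B f (b i))) P

lemma rho_shift (l : F) (P : DPoly ι F) : rho b B f x (shift l P) = shift l (rho b B f x P) := by
  simp only [shift_apply, map_add, map_smul, rho_del]

lemma rho_inc (r : g) :
    rho b B f x (inc b r) = inc b (projLE F x r) + algebraMap F _ (B f r) :=
  aeval_iterate_del_inc b (inc b ∘ₗ projLE F x + Algebra.linearMap F (DPoly ι F) ∘ₗ B f) r

/-- Derivations followed by `ρ` are determined by the values on `g`. -/
lemma rho_derivation_ext {l : F} {D D' : Derivation F (DPoly ι F) (DPoly ι F)}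
    (hD : ∀ P, D (del P) = shift l (D P)) (hD' : ∀ P, D' (del P) = shift l (D' P))
    (h : ∀ r, rho b B f x (D (inc b r)) = rho b B f x (D' (inc b r))) (P : DPoly ι F) :
    rho b B f x (D P) = rho b B f x (D' P) := by
  induction P using dpoly_induction b with
  | hC c => simp
  | hadd P Q hP hQ => simp only [map_add, hP, hQ]
  | hmul P Q hP hQ => simp only [Derivation.leibniz, map_add, smul_eq_mul, map_mul, hP, hQ]
  | hdel P hP => rw [hD, hD', rho_shift, rho_shift, hP]
  | hX i => exact h _

/-- A derivation `D` with `D ∂ = (λ + ∂) D` that `ρ` annihilates on `g_{≥ 1}` does, up to `ρ`, only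
depend on `ρ` of its argument. -/
lemma rho_derivation_rho {l : F} {D : Derivation F (DPoly ι F) (DPoly ι F)}
    (hD : ∀ P, D (del P) = shift l (D P))
    (h : ∀ r, rho b B f x (D (inc b r)) = rho b B f x (D (inc b (projLE F x r))))
    (hrho : ∀ P, rho b B f x (rho b B f x P) = rho b B f x P) (P : DPoly ι F) :
    rho b B f x (D P) = rho b B f x (D (rho b B f x P)) := by
  induction P using dpoly_induction b with
  | hC c => simp
  | hadd P Q hP hQ => simp only [map_add, hP, hQ]
  | hmul P Q hP hQ =>
    simp only [Derivation.leibniz, map_add, smul_eq_mul, map_mul, hP, hQ, hrho]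
  | hdel P hP => rw [hD, rho_del, hD, rho_shift, rho_shift, hP]
  | hX i => rw [h, rho_inc, map_add, Derivation.map_algebraMap, add_zero]

variable [CharZero F]

namespace ShortTriple

variable {b}

lemma mem_grLE_of_neg (H : ShortTriple B e f x) {p : g} (hp : p ∈ gr F x (-2)) :
    p ∈ grLE F x 1 := by
  rw [H.grLE_one]; exact Submodule.mem_sup_left hp

lemma mem_grLE_of_zero (H : ShortTriple B e f x) {p : g} (hp : p ∈ gr F x 0) :
    p ∈ grLE F x 1 := by
  rw [H.grLE_one]; exact Submodule.mem_sup_right hp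

lemma exists_decomp_grLE (H : ShortTriple B e f x) (p : g) :
    ∃ q ∈ grLE F x 1, ∃ n ∈ gr F x 2, p = q + n := by
  obtain ⟨a, ha, c, hc, n, hn, rfl⟩ := H.exists_decomp p
  exact ⟨a + c, add_mem (H.mem_grLE_of_neg ha) (H.mem_grLE_of_zero hc), n, hn, rfl⟩

lemma lie_mem_grLE (H : ShortTriple B e f x) {p q : g} (hp : p ∈ grLE F x 1)
    (hq : q ∈ grLE F x 1) : ⁅p, q⁆ ∈ grLE F x 1 := by
  rw [H.grLE_one] at hp hq
  obtain ⟨a, ha, c, hc, rfl⟩ := Submodule.mem_sup.1 hp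
  obtain ⟨a', ha', c', hc', rfl⟩ := Submodule.mem_sup.1 hq
  rw [add_lie, lie_add, lie_add, H.lie_eq_zero_of_neg ha ha', zero_add]
  refine add_mem (H.mem_grLE_of_neg (lie_mem_gr ha hc' (by norm_num))) (add_mem
    (H.mem_grLE_of_neg (lie_mem_gr hc ha' (by norm_num)))
    (H.mem_grLE_of_zero (lie_mem_gr hc hc' (by norm_num))))

lemma form_f_grLE (H : ShortTriple B e f x) {p : g} (hp : p ∈ grLE F x 1) : B f p = 0 := by
  rw [H.grLE_one] at hp
  obtain ⟨a, ha, c, hc, rfl⟩ := Submodule.mem_sup.1 hp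
  rw [map_add, H.form_eq_zero (by norm_num) H.f_mem ha,
    H.form_eq_zero (by norm_num) H.f_mem hc, add_zero]

lemma projLE_of_mem (H : ShortTriple B e f x) {p : g} (hp : p ∈ grLE F x 1) :
    projLE F x p = p := by
  rw [projLE, projAlong, dif_pos H.isCompl_grLE_grGE]
  exact Submodule.projection_apply_of_mem_left _ hp

lemma rho_inc_of_mem (H : ShortTriple B e f x) {p : g} (hp : p ∈ grLE F x 1) :
    rho b B f x (inc b p) = inc b p := by
  rw [rho_inc, H.form_f_grLE hp, H.projLE_of_mem hp]; simp

lemma incS_mem {p : g} (hp : p ∈ grLE F x 1) :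
    incS b B s z p ∈ VLE b x := by
  rw [incS_apply]; exact add_mem (inc_mem_VLE b hp) (Subalgebra.algebraMap_mem _ _)

lemma rho_incS_of_mem (H : ShortTriple B e f x) {p : g} (hp : p ∈ grLE F x 1) :
    rho b B f x (incS b B s z p) = incS b B s z p := by
  rw [incS_apply, map_add, H.rho_inc_of_mem hp, AlgHom.commutes]

lemma rho_of_mem (H : ShortTriple B e f x) {P : DPoly ι F} (hP : P ∈ VLE b x) :
    rho b B f x P = P := by
  refine VLE_induction b (x := x) (p := fun P => rho b B f x P = P) ?_ ?_ ?_ ?_ ?_ hP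
  · exact fun c => AlgHom.commutes _ _
  · intro P Q hP hQ; rw [map_add, hP, hQ]
  · intro P Q _ _ hP hQ; rw [map_mul, hP, hQ]
  · intro P _ hP; rw [rho_del, hP]
  · exact fun a ha => H.rho_inc_of_mem ha

lemma incS_of_zero (H : ShortTriple B e f x) (hs : s ∈ gr F x 2) {p : g} (hp : p ∈ gr F x 0) :
    incS b B s z p = inc b p := by
  rw [incS_apply, H.form_eq_zero (by norm_num) hs hp]; simp

lemma rho_incS_of_pos (H : ShortTriple B e f x) (hs : s ∈ gr F x 2) {n : g}
    (hn : n ∈ gr F x 2) : rho b B f x (incS b B s z n) = algebraMap F _ (B f n) := by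
  rw [incS_apply, H.form_eq_zero (by norm_num) hs hn, map_add, rho_inc, H.projLE_of_pos hn]
  simp

lemma rho_rho (H : ShortTriple B e f x) (P : DPoly ι F) :
    rho b B f x (rho b B f x P) = rho b B f x P := by
  induction P using dpoly_induction b with
  | hC c => simp only [AlgHom.commutes]
  | hadd P Q hP hQ => simp only [map_add, hP, hQ]
  | hmul P Q hP hQ => simp only [map_mul, hP, hQ]
  | hdel P hP => simp only [rho_del, hP]
  | hX i =>
    obtain ⟨q, hq, n, hn, h⟩ := H.exists_decomp_grLE (b i)
    have h' : projLE F x (b i) = q := by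
      rw [h, map_add, H.projLE_of_mem hq, H.projLE_of_pos hn, add_zero]
    rw [rho_inc, h', map_add, H.rho_inc_of_mem hq, AlgHom.commutes]

lemma adOp_mem (H : ShortTriple B e f x) (l : F) {p : g} (hp : p ∈ grLE F x 1)
    {h P : DPoly ι F} (hh : h ∈ VLE b x) (hP : P ∈ VLE b x) :
    adOp b B s z l p h P ∈ VLE b x := by
  refine VLE_induction b (p := fun P => adOp b B s z l p h P ∈ VLE b x) ?_ ?_ ?_ ?_ ?_ hP
  · intro c; rw [Derivation.map_algebraMap]; exact zero_mem _
  · intro P Q hP hQ; rw [map_add]; exact add_mem hP hQ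
  · intro P Q hP' hQ' hP hQ
    rw [Derivation.leibniz]; exact add_mem (mul_mem hP' hQ) (mul_mem hQ' hP)
  · intro P _ hP; rw [adOp_del]; exact shift_mem_VLE b l hP
  · intro r hr
    rw [adOp_inc]
    exact add_mem (mul_mem (incS_mem (H.lie_mem_grLE hp hr)) hh)
      (Subalgebra.smul_mem _ (shift_mem_VLE b l hh) _)

/-- Up to `ρ`, the derivation `{p_{λ+∂} ·}_→ h` only depends on `ρ(h)`. -/
lemma rho_adOp_rho (H : ShortTriple B e f x) (l : F) (p : g) (h P : DPoly ι F) :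
    rho b B f x (adOp b B s z l p (rho b B f x h) P) = rho b B f x (adOp b B s z l p h P) := by
  refine rho_derivation_ext b (l := l) (fun P => adOp_del ..) (fun P => adOp_del ..)
    (fun r => ?_) P
  simp only [adOp_inc, map_add, map_mul, map_smul, rho_shift, H.rho_rho]

end ShortTriple

variable (B f x s z) in
/-- The elements annihilated by `ρ{n_{λ+∂} ·}_→ h` for all `n ∈ g_1` and all `h`. Invariance is the
case `h = 1`; arbitrary `h` occur when the Jacobi identity is applied to brackets of products. -/
def StrongInv (Q : DPoly ι F) : Prop :=
  ∀ n ∈ gr F x 2, ∀ (l : F) (h : DPoly ι F), rho b B f x (adOp b B s z l n h Q) = 0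

namespace StrongInv

variable {b}

lemma add {P Q : DPoly ι F} (hP : StrongInv b B f x s z P) (hQ : StrongInv b B f x s z Q) :
    StrongInv b B f x s z (P + Q) := by
  intro n hn l h; rw [map_add, map_add, hP n hn, hQ n hn, add_zero]

lemma smul (c : F) {P : DPoly ι F} (hP : StrongInv b B f x s z P) :
    StrongInv b B f x s z (c • P) := by
  intro n hn l h; rw [Derivation.map_smul, map_smul, hP n hn, smul_zero]

lemma mul {P Q : DPoly ι F} (hP : StrongInv b B f x s z P) (hQ : StrongInv b B f x s z Q) :
    StrongInv b B f x s z (P * Q) := by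
  intro n hn l h
  rw [Derivation.leibniz, map_add, smul_eq_mul, smul_eq_mul, map_mul, map_mul, hP n hn, hQ n hn]
  simp

end StrongInv

variable (B f x s z) in
/-- The `P` of degree at most two that are strongly invariant and for which the derivation `{P λ ·}`
preserves `V(g_{≤ 1/2})` and is compatible with `ρ`, the latter because `ρ` annihilates its values
on `g_1`. Their brackets with strongly invariant elements are invariant. -/
structure LeftInv (P : DPoly ι F) : Prop where
  quad : P ∈ quad b B s z
  mem : ∀ (l : F) (Q : DPoly ι F), Q ∈ VLE b x → adL b B s z l P Q ∈ VLE b x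
  inv : StrongInv b B f x s z P
  left : ∀ n ∈ gr F x 2, ∀ l : F, rho b B f x (adL b B s z l P (inc b n)) = 0

namespace LeftInv

variable {b}

lemma add {P Q : DPoly ι F} (hP : LeftInv b B f x s z P) (hQ : LeftInv b B f x s z Q) :
    LeftInv b B f x s z (P + Q) where
  quad := add_mem hP.quad hQ.quad
  mem l R hR := by
    rw [map_add, Derivation.add_apply]; exact add_mem (hP.mem l R hR) (hQ.mem l R hR)
  inv := hP.inv.add hQ.inv
  left n hn l := by
    rw [map_add, Derivation.add_apply, map_add, hP.left n hn, hQ.left n hn, add_zero]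

lemma smul (c : F) {P : DPoly ι F} (hP : LeftInv b B f x s z P) :
    LeftInv b B f x s z (c • P) where
  quad := Submodule.smul_mem _ _ hP.quad
  mem l R hR := by
    rw [map_smul, Derivation.smul_apply]; exact Subalgebra.smul_mem _ (hP.mem l R hR) c
  inv := hP.inv.smul c
  left n hn l := by
    rw [map_smul, Derivation.smul_apply, map_smul, hP.left n hn, smul_zero]

lemma zero : LeftInv b B f x s z 0 where
  quad := zero_mem _
  mem l R _ := by simp
  inv n _ l h := by simp
  left n _ l := by simp

lemma sum {α : Type*} (t : Finset α) {P : α → DPoly ι F}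
    (hP : ∀ i ∈ t, LeftInv b B f x s z (P i)) : LeftInv b B f x s z (∑ i ∈ t, P i) :=
  Finset.sum_induction _ _ (fun _ _ => add) zero hP

end LeftInv

namespace ShortTriple

variable {b}

/-- With a strongly invariant right argument, `ρ{P λ Q}` only depends on `ρ(P)`. -/
lemma rho_adL_rho (H : ShortTriple B e f x) (hs : s ∈ gr F x 2) (l : F) {P Q : DPoly ι F}
    (hP : P ∈ quad b B s z) (hQ : StrongInv b B f x s z Q) :
    rho b B f x (adL b B s z l P Q) = rho b B f x (adL b B s z l (rho b B f x P) Q) := by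
  have key : ∀ r : g, ∃ q, ∃ c : F, rho b B f x (incS b B s z r) = incS b B s z q + c • 1 ∧
      ∀ h, rho b B f x (adOp b B s z l r h Q) = rho b B f x (adOp b B s z l q h Q) := by
    intro r
    obtain ⟨q, hq, n, hn, rfl⟩ := H.exists_decomp_grLE r
    refine ⟨q, B f n, ?_, fun h => ?_⟩
    · rw [map_add, map_add, H.rho_incS_of_mem hq, H.rho_incS_of_pos hs hn,
        Algebra.algebraMap_eq_smul_one]
    · rw [adOp_add_left, Derivation.add_apply, map_add, hQ n hn, add_zero]
  refine quad_induction b B s z (p := fun P => rho b B f x (adL b B s z l P Q) =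
    rho b B f x (adL b B s z l (rho b B f x P) Q)) ?_ ?_ ?_ ?_ ?_ ?_ hP
  · simp
  · intro P R hP hR; simp only [map_add, Derivation.add_apply, hP, hR]
  · intro c P hP; simp only [map_smul, Derivation.smul_apply, hP]
  · intro r
    obtain ⟨q, c, h1, h2⟩ := key r
    rw [h1, adL_incS, h2, map_add, map_smul, adL_one, smul_zero, add_zero, adL_incS]
  · intro r
    obtain ⟨q, c, h1, h2⟩ := key r
    rw [rho_del, h1, adL_del_incS, map_add, Derivation.map_smul, Derivation.map_one_eq_zero,
      smul_zero, add_zero, adL_del_incS, Derivation.smul_apply, Derivation.smul_apply,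
      map_smul, map_smul, h2]
  · intro r r'
    obtain ⟨q, c, h1, h2⟩ := key r
    obtain ⟨q', c', h1', h2'⟩ := key r'
    have h3 := H.rho_adOp_rho (b := b) (s := s) (z := z) l q (incS b B s z r') Q
    have h4 := H.rho_adOp_rho (b := b) (s := s) (z := z) l q' (incS b B s z r) Q
    rw [adL_incS_mul_incS, Derivation.add_apply, map_add, h2, h2', ← h3, ← h4, map_mul, h1, h1']
    simp only [add_mul, mul_add, map_add, adL_incS_mul_incS, Derivation.add_apply,
      adOp_add_right, smul_mul_assoc, one_mul, mul_smul_comm, mul_one, map_smul,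
      Derivation.smul_apply, adL_incS, adL_one, adOp_smul_right, smul_zero,
      Derivation.zero_apply, map_zero]
    module

lemma rho_adL_right (H : ShortTriple B e f x) (l : F) {P : DPoly ι F}
    (hP : LeftInv b B f x s z P) (Q : DPoly ι F) :
    rho b B f x (adL b B s z l P Q) = rho b B f x (adL b B s z l P (rho b B f x Q)) := by
  refine rho_derivation_rho b (l := l) (fun P => adL_del ..) (fun r => ?_) H.rho_rho Q
  obtain ⟨q, hq, n, hn, rfl⟩ := H.exists_decomp_grLE r
  rw [map_add (projLE F x), H.projLE_of_mem hq, H.projLE_of_pos hn, map_add (inc b),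
    map_add, map_add, hP.left n hn]
  simp

/-- The bracket of invariants is invariant. -/
lemma rho_adOp_adL (H : ShortTriple B e f x) (hs : s ∈ gr F x 2) (l m : F) {P Q : DPoly ι F}
    (hP : LeftInv b B f x s z P) (hQ : StrongInv b B f x s z Q) {a : g} (ha : a ∈ gr F x 2) :
    rho b B f x (adOp b B s z l a 1 (adL b B s z m P Q)) = 0 := by
  -- by the Jacobi identity `{a,{P,Q}} = {P,{a,Q}} + {{a,P},Q}`, and `ρ` annihilates both terms
  have h := adOp_one_comm_adL b s z H.inv l m a hP.quad Q
  rw [sub_eq_iff_eq_add] at h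
  rw [h, map_add, H.rho_adL_right m hP, hQ a ha,
    H.rho_adL_rho hs (l + m) (adOp_one_mem_quad b B s z l a hP.quad) hQ, hP.inv a ha]
  simp

end ShortTriple

end Invariants

/-! ### The generators `ψ(w)` -/

section Generators

variable {F : Type*} [Field F] {g : Type*} [LieRing g] [LieAlgebra F g] {ι : Type*}
variable (b : Module.Basis ι F g) {B : LinearMap.BilinForm F g} {e f x : g} {s : g} {z : F}
variable {K : Type*} [Fintype K] (u : Module.Basis K F (gr F x (-2)))
  (u' : Module.Basis K F (gr F x 2))

variable (e f) in
/-- The part of `ψ(w)` that lies in `V(g_0)`, for `g` mapped to an algebra of differential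
polynomials by `φ`. -/
def psiQuad {κ : Type*} (φ : g →ₗ[F] DPoly κ F) : g →ₗ[F] DPoly κ F where
  toFun w := -((1 / 2 : F) • ∑ k, φ ⁅w, (u' k : g)⁆ * φ ⁅e, (u k : g)⁆)
    - (1 / 8 : F) • ∑ k, φ ⁅f, (u' k : g)⁆ * φ ⁅e, jord e w (u k : g)⁆
    + (1 / 2 : F) • del (φ ⁅e, w⁆)
  map_add' v w := by
    simp only [jord, add_lie, lie_add, map_add, add_mul, mul_add, Finset.sum_add_distrib, smul_add]
    abel
  map_smul' c w := by
    simp only [jord, smul_lie, lie_smul, map_smul, Derivation.map_smul, smul_mul_assoc,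
      mul_smul_comm, ← Finset.smul_sum, RingHom.id_apply, smul_sub, smul_add, smul_neg]
    simp only [smul_comm _ c]

lemma psiQuad_apply {κ : Type*} (φ : g →ₗ[F] DPoly κ F) (w : g) : psiQuad e f u u' φ w =
    -((1 / 2 : F) • ∑ k, φ ⁅w, (u' k : g)⁆ * φ ⁅e, (u k : g)⁆)
    - (1 / 8 : F) • ∑ k, φ ⁅f, (u' k : g)⁆ * φ ⁅e, jord e w (u k : g)⁆
    + (1 / 2 : F) • del (φ ⁅e, w⁆) := rfl

lemma psi_eq_inc_add (w : g) : psi b e f u u' w = inc b w + psiQuad e f u u' (inc b) w := by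
  rw [psi, psiQuad_apply]; abel

variable (B s z e f) in
/-- The elements `ψ(w)` in terms of the shifted generators. -/
def psiS : g →ₗ[F] DPoly ι F := incS b B s z + psiQuad e f u u' (incS b B s z)

variable [CharZero F]

namespace ShortTriple

variable {u u'}

/-- `ψ` only involves `g_0`, except for its linear term. -/
lemma map_psiQuad (H : ShortTriple B e f x) {κ κ' : Type*} {φ : g →ₗ[F] DPoly κ F}
    {φ' : g →ₗ[F] DPoly κ' F} (θ : DPoly κ F →ₐ[F] DPoly κ' F)
    (hθ : ∀ P, θ (del P) = del (θ P)) (h : ∀ p ∈ gr F x 0, θ (φ p) = φ' p) {w : g}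
    (hw : w ∈ gr F x (-2)) : θ (psiQuad e f u u' φ w) = psiQuad e f u u' φ' w := by
  have h1 : ∀ k, θ (φ ⁅w, (u' k : g)⁆) = φ' ⁅w, (u' k : g)⁆ := fun k =>
    h _ (lie_mem_gr hw (u' k).2 (by norm_num))
  have h2 : ∀ k, θ (φ ⁅e, (u k : g)⁆) = φ' ⁅e, (u k : g)⁆ := fun k => h _ (H.lie_e_mem (u k).2)
  have h3 : ∀ k, θ (φ ⁅f, (u' k : g)⁆) = φ' ⁅f, (u' k : g)⁆ := fun k =>
    h _ (H.lie_f_mem (u' k).2)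
  have h4 : ∀ k, θ (φ ⁅e, jord e w (u k : g)⁆) = φ' ⁅e, jord e w (u k : g)⁆ := fun k =>
    h _ (H.lie_e_mem (H.jord_mem hw (u k).2))
  simp only [psiQuad_apply, map_add, map_sub, map_neg, map_smul, map_sum, map_mul, hθ, h1, h2, h3,
    h4, h _ (H.lie_e_mem hw)]

/-- Only `g_{-1}` is affected by the shift of the generators, since `s ∈ g_1`. -/
lemma psi_eq (H : ShortTriple B e f x) (hs : s ∈ gr F x 2) {w : g} (hw : w ∈ gr F x (-2)) :
    psi b e f u u' w = psiS b B e f s z u u' w - algebraMap F _ (z * B s w) := by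
  have h := H.map_psiQuad (u := u) (u' := u') (φ := inc b) (φ' := incS b B s z)
    (AlgHom.id F (DPoly ι F)) (fun P => rfl) (fun p hp => (H.incS_of_zero hs hp).symm) hw
  rw [AlgHom.id_apply] at h
  rw [psi_eq_inc_add, h, psiS, LinearMap.add_apply, incS_apply]
  abel

lemma lie_u_mem {w : g} (hw : w ∈ gr F x (-2)) (k : K) :
    ⁅w, (u' k : g)⁆ ∈ gr F x 0 := lie_mem_gr hw (u' k).2 (by norm_num)

lemma psiS_mem (H : ShortTriple B e f x) {w : g} (hw : w ∈ gr F x (-2)) :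
    psiS b B e f s z u u' w ∈ VLE b x := by
  have h0 : ∀ p ∈ gr F x 0, incS b B s z p ∈ VLE b x := fun p hp =>
    incS_mem (H.mem_grLE_of_zero hp)
  rw [psiS, LinearMap.add_apply, psiQuad_apply]
  refine add_mem (incS_mem (H.mem_grLE_of_neg hw)) (add_mem (sub_mem (neg_mem
    (Subalgebra.smul_mem _ (sum_mem fun k _ => ?_) _))
    (Subalgebra.smul_mem _ (sum_mem fun k _ => ?_) _))
    (Subalgebra.smul_mem _ (del_mem_VLE b (h0 _ (H.lie_e_mem hw))) _))
  · exact mul_mem (h0 _ (lie_u_mem hw k)) (h0 _ (H.lie_e_mem (u k).2))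
  · exact mul_mem (h0 _ (H.lie_f_mem (u' k).2)) (h0 _ (H.lie_e_mem (H.jord_mem hw (u k).2)))

lemma psiS_mem_quad (w : g) : psiS b B e f s z u u' w ∈ quad b B s z := by
  rw [psiS, LinearMap.add_apply, psiQuad_apply]
  exact add_mem (incS_mem_quad b B s z _) (add_mem (sub_mem (neg_mem
    (Submodule.smul_mem _ _ (sum_mem fun k _ => incS_mul_incS_mem_quad b B s z _ _)))
    (Submodule.smul_mem _ _ (sum_mem fun k _ => incS_mul_incS_mem_quad b B s z _ _)))
    (Submodule.smul_mem _ _ (del_incS_mem_quad b B s z _)))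

lemma rho_adOp_zero (H : ShortTriple B e f x) {n p : g} (hn : n ∈ gr F x 2)
    (hp : p ∈ gr F x 0) (hs : s ∈ gr F x 2) (l : F) (h : DPoly ι F) :
    rho b B f x (adOp b B s z l n h (incS b B s z p)) = B f ⁅n, p⁆ • rho b B f x h := by
  rw [adOp_incS, H.form_eq_zero (by norm_num) hn hp, zero_smul, add_zero, map_mul,
    H.rho_incS_of_pos hs (lie_mem_gr hn hp (by norm_num)), ← Algebra.smul_def]

lemma rho_adOp_pos (H : ShortTriple B e f x) {n p : g} (hn : n ∈ gr F x 2)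
    (hp : p ∈ gr F x 0) (hs : s ∈ gr F x 2) (l : F) (h : DPoly ι F) :
    rho b B f x (adOp b B s z l p h (inc b n)) = -B f ⁅n, p⁆ • rho b B f x h := by
  rw [adOp_inc, H.form_eq_zero (by norm_num) hp hn, zero_smul, add_zero, map_mul,
    H.rho_incS_of_pos hs (lie_mem_gr hp hn (by norm_num)), ← Algebra.smul_def, ← lie_skew,
    map_neg]

lemma strongInv_incS (H : ShortTriple B e f x) (hs : s ∈ gr F x 2) {p : g}
    (hp : p ∈ cent0 F f x) : StrongInv b B f x s z (incS b B s z p) := by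
  intro n hn l h
  rw [H.rho_adOp_zero b hn (mem_cent0.1 hp).2 hs, H.form_f_lie_cent0 hp, zero_smul]

/-- The quadratic terms of `ψ(w)` cancel the contribution `[n,w]` of the linear term, by
`contract_psi`, and the term `½ ∂[e,w]` cancels `(n|w)(λ+∂)`. -/
lemma strongInv_psiS [DecidableEq K] (H : ShortTriple B e f x) (hs : s ∈ gr F x 2)
    (hu : ∀ h k, B (u h : g) (u' k : g) = if h = k then 1 else 0) {w : g}
    (hw : w ∈ gr F x (-2)) : StrongInv b B f x s z (psiS b B e f s z u u' w) := by
  intro n hn l h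
  have h0 : ∀ p ∈ gr F x 0, rho b B f x (adOp b B s z l n h (incS b B s z p)) =
      B f ⁅n, p⁆ • rho b B f x h := fun p hp => H.rho_adOp_zero b hn hp hs l h
  have hρ : ∀ p ∈ gr F x 0, rho b B f x (incS b B s z p) = incS b B s z p := fun p hp =>
    H.rho_incS_of_mem (H.mem_grLE_of_zero hp)
  have hmul : ∀ p ∈ gr F x 0, ∀ q ∈ gr F x 0,
      rho b B f x (adOp b B s z l n h (incS b B s z p * incS b B s z q)) =
        (B f ⁅n, q⁆ • incS b B s z p + B f ⁅n, p⁆ • incS b B s z q) * rho b B f x h := by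
    intro p hp q hq
    rw [Derivation.leibniz, map_add, smul_eq_mul, smul_eq_mul, map_mul, map_mul, h0 p hp, h0 q hq,
      hρ p hp, hρ q hq, add_mul, smul_mul_assoc, smul_mul_assoc, mul_smul_comm, mul_smul_comm]
  have hlin : rho b B f x (adOp b B s z l n h (incS b B s z w)) =
      incS b B s z ⁅n, w⁆ * rho b B f x h + B n w • shift l (rho b B f x h) := by
    rw [adOp_incS, map_add, map_mul, map_smul, rho_shift,
      hρ _ (lie_mem_gr hn hw (by norm_num))]
  have hc := H.contract_psi hu hn hw (incS b B s z)
  have s1 : ∑ k, rho b B f x (adOp b B s z l n h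
      (incS b B s z ⁅w, (u' k : g)⁆ * incS b B s z ⁅e, (u k : g)⁆)) =
      (∑ k, (B f ⁅n, ⁅e, (u k : g)⁆⁆ • incS b B s z ⁅w, (u' k : g)⁆
        + B f ⁅n, ⁅w, (u' k : g)⁆⁆ • incS b B s z ⁅e, (u k : g)⁆)) * rho b B f x h := by
    rw [Finset.sum_mul]
    exact Finset.sum_congr rfl fun k _ =>
      hmul _ (lie_u_mem hw k) _ (H.lie_e_mem (u k).2)
  have s2 : ∑ k, rho b B f x (adOp b B s z l n h
      (incS b B s z ⁅f, (u' k : g)⁆ * incS b B s z ⁅e, jord e w (u k : g)⁆)) =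
      (∑ k, (B f ⁅n, ⁅e, jord e w (u k)⁆⁆ • incS b B s z ⁅f, (u' k : g)⁆
        + B f ⁅n, ⁅f, (u' k : g)⁆⁆ • incS b B s z ⁅e, jord e w (u k)⁆)) * rho b B f x h := by
    rw [Finset.sum_mul]
    exact Finset.sum_congr rfl fun k _ =>
      hmul _ (H.lie_f_mem (u' k).2) _ (H.lie_e_mem (H.jord_mem hw (u k).2))
  rw [psiS, LinearMap.add_apply, psiQuad_apply]
  simp only [map_add, map_sub, map_neg, map_smul, Derivation.map_smul, map_sum, adOp_del,
    rho_shift, hlin, h0 _ (H.lie_e_mem hw), s1, s2, H.form_f_lie_lie_e hn, ← hc, add_mul,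
    smul_mul_assoc]
  module

lemma adL_sum_apply {α : Type*} (t : Finset α) (P : α → DPoly ι F) (l : F) (Q : DPoly ι F) :
    adL b B s z l (∑ i ∈ t, P i) Q = ∑ i ∈ t, adL b B s z l (P i) Q := by
  classical
  induction t using Finset.induction_on with
  | empty => simp
  | insert a t ha ih =>
    rw [Finset.sum_insert ha, Finset.sum_insert ha, map_add, Derivation.add_apply, ih]

lemma adL_psiS_apply (w : g) (l : F) (Q : DPoly ι F) :
    adL b B s z l (psiS b B e f s z u u' w) Q = adOp b B s z l w 1 Q
      - (1 / 2 : F) • ∑ k, (adOp b B s z l ⁅w, (u' k : g)⁆ (incS b B s z ⁅e, (u k : g)⁆) Q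
        + adOp b B s z l ⁅e, (u k : g)⁆ (incS b B s z ⁅w, (u' k : g)⁆) Q)
      - (1 / 8 : F) • ∑ k,
        (adOp b B s z l ⁅f, (u' k : g)⁆ (incS b B s z ⁅e, jord e w (u k : g)⁆) Q
        + adOp b B s z l ⁅e, jord e w (u k : g)⁆ (incS b B s z ⁅f, (u' k : g)⁆) Q)
      - (l / 2) • adOp b B s z l ⁅e, w⁆ 1 Q := by
  rw [psiS, LinearMap.add_apply, psiQuad_apply]
  simp only [map_add, map_sub, map_neg, map_smul, Derivation.add_apply, Derivation.sub_apply,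
    Derivation.neg_apply, Derivation.smul_apply, adL_sum_apply, adL_incS, adL_incS_mul_incS,
    adL_del_incS]
  module

lemma leftInv_incS (H : ShortTriple B e f x) (hs : s ∈ gr F x 2) {p : g}
    (hp : p ∈ cent0 F f x) : LeftInv b B f x s z (incS b B s z p) where
  quad := incS_mem_quad b B s z p
  mem l Q hQ := by
    rw [adL_incS]
    exact H.adOp_mem l (H.mem_grLE_of_zero (mem_cent0.1 hp).2) (one_mem _) hQ
  inv := H.strongInv_incS b hs hp
  left n hn l := by
    rw [adL_incS, H.rho_adOp_pos b hn (mem_cent0.1 hp).2 hs, H.form_f_lie_cent0 hp]; simp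

lemma leftInv_incS_mul_incS (H : ShortTriple B e f x) (hs : s ∈ gr F x 2) {p q : g}
    (hp : p ∈ cent0 F f x) (hq : q ∈ cent0 F f x) :
    LeftInv b B f x s z (incS b B s z p * incS b B s z q) where
  quad := incS_mul_incS_mem_quad b B s z p q
  mem l Q hQ := by
    have hp' := H.mem_grLE_of_zero (mem_cent0.1 hp).2
    have hq' := H.mem_grLE_of_zero (mem_cent0.1 hq).2
    rw [adL_incS_mul_incS]
    exact add_mem (H.adOp_mem l hp' (incS_mem hq') hQ) (H.adOp_mem l hq' (incS_mem hp') hQ)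
  inv := (H.strongInv_incS b hs hp).mul (H.strongInv_incS b hs hq)
  left n hn l := by
    rw [adL_incS_mul_incS, Derivation.add_apply, map_add,
      H.rho_adOp_pos b hn (mem_cent0.1 hp).2 hs, H.form_f_lie_cent0 hp,
      H.rho_adOp_pos b hn (mem_cent0.1 hq).2 hs, H.form_f_lie_cent0 hq]; simp

lemma leftInv_psiS [DecidableEq K] (H : ShortTriple B e f x) (hs : s ∈ gr F x 2)
    (hu : ∀ h k, B (u h : g) (u' k : g) = if h = k then 1 else 0) {w : g}
    (hw : w ∈ gr F x (-2)) : LeftInv b B f x s z (psiS b B e f s z u u' w) where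
  quad := psiS_mem_quad b w
  mem l Q hQ := by
    have h0 : ∀ p ∈ gr F x 0, ∀ q ∈ gr F x 0,
        adOp b B s z l p (incS b B s z q) Q ∈ VLE b x := fun p hp q hq =>
      H.adOp_mem l (H.mem_grLE_of_zero hp) (incS_mem (H.mem_grLE_of_zero hq)) hQ
    have hw' := fun k => lie_u_mem (u' := u') hw k
    have he := fun k => H.lie_e_mem (u k).2
    have hf := fun k => H.lie_f_mem (u' k).2
    have hj := fun k => H.lie_e_mem (H.jord_mem hw (u k).2)
    rw [adL_psiS_apply]
    refine sub_mem (sub_mem (sub_mem ?_ (Subalgebra.smul_mem _ (sum_mem fun k _ => ?_) _))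
      (Subalgebra.smul_mem _ (sum_mem fun k _ => ?_) _)) (Subalgebra.smul_mem _ ?_ _)
    · exact H.adOp_mem l (H.mem_grLE_of_neg hw) (one_mem _) hQ
    · exact add_mem (h0 _ (hw' k) _ (he k)) (h0 _ (he k) _ (hw' k))
    · exact add_mem (h0 _ (hf k) _ (hj k)) (h0 _ (hj k) _ (hf k))
    · exact H.adOp_mem l (H.mem_grLE_of_zero (H.lie_e_mem hw)) (one_mem _) hQ
  inv := H.strongInv_psiS b hs hu hw
  left n hn l := by
    have h0 : ∀ p ∈ gr F x 0, ∀ q ∈ gr F x 0,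
        rho b B f x (adOp b B s z l p (incS b B s z q) (inc b n)) =
          -(B f ⁅n, p⁆ • incS b B s z q) := by
      intro p hp q hq
      rw [H.rho_adOp_pos b hn hp hs, H.rho_incS_of_mem (H.mem_grLE_of_zero hq), neg_smul]
    have hlin : rho b B f x (adOp b B s z l w 1 (inc b n)) =
        -incS b B s z ⁅n, w⁆ + (B n w * l) • 1 := by
      rw [adOp_inc, mul_one, shift_one, smul_smul, ← lie_skew, map_neg, map_add, map_neg,
        map_smul, map_one, H.symm w n,
        H.rho_incS_of_mem (H.mem_grLE_of_zero (lie_mem_gr hn hw (by norm_num)))]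
    have s1 : ∑ k, rho b B f x (adOp b B s z l ⁅w, (u' k : g)⁆ (incS b B s z ⁅e, (u k : g)⁆)
          (inc b n) + adOp b B s z l ⁅e, (u k : g)⁆ (incS b B s z ⁅w, (u' k : g)⁆) (inc b n)) =
        -∑ k, (B f ⁅n, ⁅e, (u k : g)⁆⁆ • incS b B s z ⁅w, (u' k : g)⁆
        + B f ⁅n, ⁅w, (u' k : g)⁆⁆ • incS b B s z ⁅e, (u k : g)⁆) := by
      rw [← Finset.sum_neg_distrib]
      refine Finset.sum_congr rfl fun k _ => ?_
      rw [map_add, h0 _ (lie_u_mem hw k) _ (H.lie_e_mem (u k).2),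
        h0 _ (H.lie_e_mem (u k).2) _ (lie_u_mem hw k)]
      abel
    have s2 : ∑ k, rho b B f x
        (adOp b B s z l ⁅f, (u' k : g)⁆ (incS b B s z ⁅e, jord e w (u k : g)⁆) (inc b n)
        + adOp b B s z l ⁅e, jord e w (u k : g)⁆ (incS b B s z ⁅f, (u' k : g)⁆) (inc b n)) =
        -∑ k, (B f ⁅n, ⁅e, jord e w (u k)⁆⁆ • incS b B s z ⁅f, (u' k : g)⁆
        + B f ⁅n, ⁅f, (u' k : g)⁆⁆ • incS b B s z ⁅e, jord e w (u k)⁆) := by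
      rw [← Finset.sum_neg_distrib]
      refine Finset.sum_congr rfl fun k _ => ?_
      rw [map_add, h0 _ (H.lie_f_mem (u' k).2) _ (H.lie_e_mem (H.jord_mem hw (u k).2)),
        h0 _ (H.lie_e_mem (H.jord_mem hw (u k).2)) _ (H.lie_f_mem (u' k).2)]
      abel
    have hc := H.contract_psi hu hn hw (incS b B s z)
    rw [adL_psiS_apply, map_sub, map_sub, map_sub, map_smul, map_smul, map_smul, map_sum, map_sum,
      s1, s2, hlin, H.rho_adOp_pos b hn (H.lie_e_mem hw) hs, map_one, H.form_f_lie_lie_e hn, ← hc]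
    module

end ShortTriple

end Generators

/-! ### The structure of the algebra of invariants -/

section Structure

section NoVariable

variable {F : Type*} [Field F] [CharZero F] {σ : Type*}

lemma notMem_vars_of_pderiv_eq_zero {Q : MvPolynomial σ F} {q : σ}
    (h : MvPolynomial.pderiv q Q = 0) : q ∉ Q.vars := by
  intro hq
  obtain ⟨d, hd, hqd⟩ := (MvPolynomial.mem_vars_iff_mem_support q).1 hq
  have hle : Finsupp.single q 1 ≤ d := by
    rw [Finsupp.single_le_iff]
    exact Nat.one_le_iff_ne_zero.2 (Finsupp.mem_support_iff.1 hqd)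
  have h2 := MvPolynomial.coeff_pderiv (i := q) Q (d - Finsupp.single q 1)
  rw [h, tsub_add_cancel_of_le hle, MvPolynomial.coeff_zero, eq_comm, mul_eq_zero] at h2
  rcases h2 with h2 | h2
  · exact MvPolynomial.mem_support_iff.1 hd h2
  · exact Nat.cast_add_one_ne_zero _ h2

/-- If `∑_m λ^m ∂P/∂u_k^{(m)}` vanishes for all `λ` then `P` does not involve `u_k`. -/
lemma notMem_vars_of_lamDer_eq_zero {κ : Type*} [DecidableEq κ] (k : κ) {r : F} (hr : r ≠ 0)
    {Q : DPoly κ F}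
    (h : ∀ l : F, lamDer l (fun i => if i = k then MvPolynomial.C r else 0) Q = 0) (m : ℕ) :
    (k, m) ∉ Q.vars := by
  classical
  have hX : ∀ (l : F) (q : κ × ℕ),
      lamDer l (fun i => if i = k then (MvPolynomial.C r : DPoly κ F) else 0)
        (MvPolynomial.X q) = if q.1 = k then MvPolynomial.C r * MvPolynomial.C l ^ q.2 else 0 := by
    rintro l ⟨i, n⟩
    rw [lamDer_X]
    by_cases hi : i = k
    · simp only [hi, if_true]
      induction n with
      | zero => simp
      | succ n ih =>
        rw [pow_succ', Module.End.mul_apply, ih, shift_eq_C_mul, ← map_pow, ← map_mul, del_C,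
          add_zero, map_mul, map_pow]
        ring
    · simp [hi]
  have hR : (∑ q ∈ Q.vars, if q.1 = k then
      Polynomial.monomial q.2 (MvPolynomial.pderiv q Q * MvPolynomial.C r) else 0 :
        Polynomial (DPoly κ F)) = 0 := by
    refine eq_of_forall_eval_C fun l => ?_
    rw [Polynomial.eval_zero, ← h l, ← derivation_apply_eq_sum_vars, Polynomial.eval_finsetSum]
    refine Finset.sum_congr rfl fun q _ => ?_
    rw [hX]
    split_ifs
    · rw [Polynomial.eval_monomial, mul_assoc]
    · simp
  intro hm
  have h2 := congrArg (fun R : Polynomial (DPoly κ F) => R.coeff m) hR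
  simp only [Polynomial.finsetSum_coeff, Polynomial.coeff_zero] at h2
  rw [Finset.sum_eq_single (k, m)] at h2
  · simp only [if_true, Polynomial.coeff_monomial] at h2
    rw [mul_eq_zero] at h2
    refine notMem_vars_of_pderiv_eq_zero (h2.resolve_right ?_) hm
    simpa using hr
  · rintro ⟨i, n⟩ _ hne
    by_cases hi : i = k
    · subst hi
      have : n ≠ m := fun h => hne (by rw [h])
      simp [Polynomial.coeff_monomial, this]
    · simp [hi]
  · intro h; exact absurd hm h

end NoVariable

variable {F : Type*} [Field F] {g : Type*} [LieRing g] [LieAlgebra F g] {ι : Type*}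
variable (b : Module.Basis ι F g) {B : LinearMap.BilinForm F g} {e f x : g} {s : g} {z : F}
variable {K : Type*} [Fintype K] (u : Module.Basis K F (gr F x (-2)))
  (u' : Module.Basis K F (gr F x 2))
variable {J : Type*} [Fintype J] (a a' : Module.Basis J F (cent0 F f x))

variable (B) in
/-- Coordinates on `g_{≤ 1/2}` with respect to the basis `u_k`, `a_i`, `[e,u_k]`, as linear
differential polynomials. -/
def coords : g →ₗ[F] DPoly (K ⊕ J ⊕ K) F :=
  ∑ k, (B.flip (u' k : g)).smulRight (MvPolynomial.X (Sum.inl k, 0))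
    + ∑ i, (B.flip (a' i : g)).smulRight (MvPolynomial.X (Sum.inr (Sum.inl i), 0))
    + (1 / 2 : F) • ∑ k, (B.flip (u' k : g) ∘ₗ (LieAlgebra.ad F g f : g →ₗ[F] g)).smulRight
      (MvPolynomial.X (Sum.inr (Sum.inr k), 0))

lemma coords_apply (p : g) : coords B u' a' p =
    ∑ k, B p (u' k : g) • MvPolynomial.X (Sum.inl k, 0)
    + ∑ i, B p (a' i : g) • MvPolynomial.X (Sum.inr (Sum.inl i), 0)
    + (1 / 2 : F) • ∑ k, B ⁅f, p⁆ (u' k : g) • MvPolynomial.X (Sum.inr (Sum.inr k), 0) := by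
  simp [coords]

variable (B) in
/-- The component in `g_{-1}`. -/
def negPart : g →ₗ[F] g := ∑ k, (B.flip (u' k : g)).smulRight (u k : g)

lemma negPart_apply (p : g) : negPart B u u' p = ∑ k, B p (u' k : g) • (u k : g) := by
  simp [negPart]

variable (B e f) in
/-- Coordinates on `V(g_{≤ 1/2})` as the algebra of differential polynomials in the `ψ(u_k)`, `a_i`
and `[e,u_k]`. -/
def toCoords : DPoly ι F →ₐ[F] DPoly (K ⊕ J ⊕ K) F :=
  MvPolynomial.aeval fun p => del^[p.2]
    ((coords B u' a' - psiQuad e f u u' (coords B u' a') ∘ₗ negPart B u u') (b p.1))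

variable (e f) in
/-- The elements `ψ(u_k)`, `a_i` and `[e,u_k]`. -/
def coordGen : K ⊕ J ⊕ K → DPoly ι F :=
  Sum.elim (fun k => psi b e f u u' (u k)) (Sum.elim (fun i => inc b (a i : g))
    fun k => inc b ⁅e, (u k : g)⁆)

variable (e f) in
/-- The differential algebra homomorphism sending the coordinates to `ψ(u_k)`, `a_i`, `[e,u_k]`. -/
def ofCoords : DPoly (K ⊕ J ⊕ K) F →ₐ[F] DPoly ι F :=
  MvPolynomial.aeval fun p => del^[p.2] (coordGen b e f u u' a p.1)

/-- The homomorphism of differential algebras that kills the coordinates of `[e,g_{-1}]`. -/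
def dropCoords : DPoly (K ⊕ J ⊕ K) F →ₐ[F] DPoly (K ⊕ J ⊕ K) F :=
  MvPolynomial.aeval fun p => del^[p.2]
    (Sum.elim (fun k => MvPolynomial.X (Sum.inl k, 0))
      (Sum.elim (fun i => MvPolynomial.X (Sum.inr (Sum.inl i), 0)) fun _ => 0) p.1)

lemma toCoords_del (P : DPoly ι F) :
    toCoords b B e f u u' a' (del P) = del (toCoords b B e f u u' a' P) :=
  aeval_iterate_del (c := fun i =>
    (coords B u' a' - psiQuad e f u u' (coords B u' a') ∘ₗ negPart B u u') (b i)) P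

lemma toCoords_inc (p : g) : toCoords b B e f u u' a' (inc b p) =
    coords B u' a' p - psiQuad e f u u' (coords B u' a') (negPart B u u' p) :=
  aeval_iterate_del_inc b
    (coords B u' a' - psiQuad e f u u' (coords B u' a') ∘ₗ negPart B u u') p

lemma ofCoords_del (P : DPoly (K ⊕ J ⊕ K) F) :
    ofCoords b e f u u' a (del P) = del (ofCoords b e f u u' a P) :=
  aeval_iterate_del (c := coordGen b e f u u' a) P

lemma dropCoords_del (P : DPoly (K ⊕ J ⊕ K) F) : dropCoords (del P) = del (dropCoords P) :=
  aeval_iterate_del (c := Sum.elim (fun k => MvPolynomial.X (Sum.inl k, 0))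
      (Sum.elim (fun i => MvPolynomial.X (Sum.inr (Sum.inl i), 0)) fun _ => 0)) P

lemma dropCoords_X_inl (k : K) (m : ℕ) :
    dropCoords (F := F) (MvPolynomial.X (Sum.inl k, m) : DPoly (K ⊕ J ⊕ K) F) =
      MvPolynomial.X (Sum.inl k, m) := by
  rw [dropCoords, MvPolynomial.aeval_X, X_eq_iterate_del _ m]; rfl

lemma dropCoords_X_inr_inl (i : J) (m : ℕ) :
    dropCoords (F := F) (MvPolynomial.X (Sum.inr (Sum.inl i), m) : DPoly (K ⊕ J ⊕ K) F) =
      MvPolynomial.X (Sum.inr (Sum.inl i), m) := by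
  rw [dropCoords, MvPolynomial.aeval_X, X_eq_iterate_del _ m]; rfl

lemma dropCoords_X_inr_inr (k : K) :
    dropCoords (F := F) (MvPolynomial.X (Sum.inr (Sum.inr k), 0) : DPoly (K ⊕ J ⊕ K) F) = 0 := by
  rw [dropCoords, MvPolynomial.aeval_X]; rfl

variable (e f x) in
/-- The projection of `V(g)` onto the differential polynomials on `g^f`, along `[e,g_{-1}]`
and `g_1`. -/
def sharpHom : DPoly ι F →ₐ[F] DPoly ι F :=
  MvPolynomial.aeval fun p => del^[p.2] ((inc b ∘ₗ sharp F e f x) (b p.1))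

lemma sharpHom_del (P : DPoly ι F) : sharpHom b e f x (del P) = del (sharpHom b e f x P) :=
  aeval_iterate_del (c := fun i => (inc b ∘ₗ sharp F e f x) (b i)) P

lemma sharpHom_inc (p : g) : sharpHom b e f x (inc b p) = inc b (sharp F e f x p) :=
  aeval_iterate_del_inc b (inc b ∘ₗ sharp F e f x) p

variable [CharZero F] [DecidableEq K] [DecidableEq J]

namespace ShortTriple

variable {b u u' a a'}

lemma negPart_of_neg (hu : ∀ h k, B (u h : g) (u' k : g) = if h = k then 1 else 0) {w : g}
    (hw : w ∈ gr F x (-2)) : negPart B u u' w = w := by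
  rw [negPart_apply]; exact sum_form_smul hu hw LinearMap.id

lemma negPart_of_zero (H : ShortTriple B e f x) {p : g} (hp : p ∈ gr F x 0) :
    negPart B u u' p = 0 := by
  rw [negPart_apply]
  exact Finset.sum_eq_zero fun k _ => by
    rw [H.form_eq_zero (by norm_num) hp (u' k).2, zero_smul]

lemma toCoords_inc_of_zero (H : ShortTriple B e f x) {p : g} (hp : p ∈ gr F x 0) :
    toCoords b B e f u u' a' (inc b p) = coords B u' a' p := by
  rw [toCoords_inc, H.negPart_of_zero hp, map_zero, sub_zero]

lemma toCoords_psi (H : ShortTriple B e f x)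
    (hu : ∀ h k, B (u h : g) (u' k : g) = if h = k then 1 else 0) {w : g}
    (hw : w ∈ gr F x (-2)) :
    toCoords b B e f u u' a' (psi b e f u u' w) = coords B u' a' w := by
  rw [psi_eq_inc_add, map_add, toCoords_inc, negPart_of_neg hu hw,
    H.map_psiQuad (φ' := coords B u' a') _ (toCoords_del b u u' a')
      (fun p hp => H.toCoords_inc_of_zero hp) hw, sub_add_cancel]

lemma coords_of_neg (H : ShortTriple B e f x) {w : g} (hw : w ∈ gr F x (-2)) :
    coords B u' a' w = ∑ k, B w (u' k : g) • MvPolynomial.X (Sum.inl k, 0) := by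
  rw [coords_apply, H.lie_eq_zero_of_neg H.f_mem hw]
  have h : ∀ i, B w (a' i : g) = 0 := fun i =>
    H.form_eq_zero (by norm_num) hw (mem_cent0.1 (a' i).2).2
  simp [h]

lemma coords_of_zero (H : ShortTriple B e f x) {p : g} (hp : p ∈ gr F x 0) :
    coords B u' a' p = ∑ i, B p (a' i : g) • MvPolynomial.X (Sum.inr (Sum.inl i), 0)
    + (1 / 2 : F) • ∑ k, B ⁅f, p⁆ (u' k : g) • MvPolynomial.X (Sum.inr (Sum.inr k), 0) := by
  have h : ∀ k, B p (u' k : g) = 0 := fun k => H.form_eq_zero (by norm_num) hp (u' k).2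
  simp [coords_apply, h]

lemma form_sharp (H : ShortTriple B e f x) {p q : g} (hp : p ∈ gr F x 0)
    (hq : q ∈ cent0 F f x) : B (sharp F e f x p) q = B p q := by
  rw [H.sharp_of_zero hp, map_sub, map_smul, LinearMap.sub_apply, LinearMap.smul_apply,
    H.form_lie_e_cent0 hq]
  simp

lemma ofCoords_coords_of_zero (H : ShortTriple B e f x)
    (hu : ∀ h k, B (u h : g) (u' k : g) = if h = k then 1 else 0)
    (ha : ∀ i j, B (a i : g) (a' j : g) = if i = j then 1 else 0) {p : g} (hp : p ∈ gr F x 0) :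
    ofCoords b e f u u' a (coords B u' a' p) = inc b p := by
  have h1 := sum_form_smul ha (H.sharp_mem_cent0 hp) (inc b)
  simp only [H.form_sharp hp (a' _).2] at h1
  have h2 := sum_form_smul hu (H.lie_f_mem_neg hp)
    (inc b ∘ₗ (LieAlgebra.ad F g e : g →ₗ[F] g))
  simp only [LinearMap.comp_apply, LieAlgebra.ad_apply] at h2
  rw [H.coords_of_zero hp]
  simp only [map_add, map_smul, map_sum, ofCoords, MvPolynomial.aeval_X, coordGen,
    Function.iterate_zero, id_eq, Sum.elim_inr, Sum.elim_inl]
  rw [h1, h2, H.sharp_of_zero hp, map_sub, map_smul, sub_add_cancel]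

lemma ofCoords_coords_of_neg (H : ShortTriple B e f x)
    (hu : ∀ h k, B (u h : g) (u' k : g) = if h = k then 1 else 0) {w : g}
    (hw : w ∈ gr F x (-2)) :
    ofCoords b e f u u' a (coords B u' a' w) = psi b e f u u' w := by
  have h1 := sum_form_smul hu hw (inc b + psiQuad e f u u' (inc b))
  simp only [LinearMap.add_apply, ← psi_eq_inc_add] at h1
  rw [H.coords_of_neg hw]
  simp only [map_smul, map_sum, ofCoords, MvPolynomial.aeval_X, coordGen,
    Function.iterate_zero, id_eq, Sum.elim_inl]
  rw [h1]

lemma ofCoords_toCoords (H : ShortTriple B e f x)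
    (hu : ∀ h k, B (u h : g) (u' k : g) = if h = k then 1 else 0)
    (ha : ∀ i j, B (a i : g) (a' j : g) = if i = j then 1 else 0) {P : DPoly ι F}
    (hP : P ∈ VLE b x) : ofCoords b e f u u' a (toCoords b B e f u u' a' P) = P := by
  refine VLE_induction b (x := x)
    (p := fun P => ofCoords b e f u u' a (toCoords b B e f u u' a' P) = P) ?_ ?_ ?_ ?_ ?_ hP
  · intro c; rw [AlgHom.commutes, AlgHom.commutes]
  · intro P Q hP hQ; rw [map_add, map_add, hP, hQ]
  · intro P Q _ _ hP hQ; rw [map_mul, map_mul, hP, hQ]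
  · intro P _ hP; rw [toCoords_del, ofCoords_del, hP]
  · intro p hp
    rw [H.grLE_one] at hp
    obtain ⟨w, hw, c, hc, rfl⟩ := Submodule.mem_sup.1 hp
    rw [map_add, map_add, map_add, H.toCoords_inc_of_zero hc, H.ofCoords_coords_of_zero hu ha hc]
    congr 1
    rw [toCoords_inc, negPart_of_neg hu hw, map_sub, H.ofCoords_coords_of_neg hu hw,
      H.map_psiQuad (φ' := inc b) _ (ofCoords_del b u u' a)
        (fun p hp => H.ofCoords_coords_of_zero hu ha hp) hw, psi_eq_inc_add, add_sub_cancel_right]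

/-- In the coordinates `ψ(u_k)`, `a_i`, `[e,u_k]`, the operator `ρ{n λ ·}` is a constant coefficient
derivation in the variables `[e,u_k]`. The constant `-2` comes from `(f|[n,[e,u]]) = -2 (n|u)`. -/
lemma lamDer_toCoords (H : ShortTriple B e f x) (hs : s ∈ gr F x 2)
    (hu : ∀ h k, B (u h : g) (u' k : g) = if h = k then 1 else 0) (k₀ : K) (l : F)
    {P : DPoly ι F} (hP : P ∈ VLE b x) :
    lamDer l (fun i => if i = Sum.inr (Sum.inr k₀) then MvPolynomial.C (-2 : F) else 0)
        (toCoords b B e f u u' a' P) =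
      toCoords b B e f u u' a' (rho b B f x (adOp b B s z l (u' k₀ : g) 1 P)) := by
  set D := lamDer l (fun i : K ⊕ J ⊕ K =>
    if i = Sum.inr (Sum.inr k₀) then (MvPolynomial.C (-2 : F) : DPoly (K ⊕ J ⊕ K) F) else 0) with hD
  have hDX : ∀ i : K ⊕ J ⊕ K, D (MvPolynomial.X (i, 0)) =
      if i = Sum.inr (Sum.inr k₀) then MvPolynomial.C (-2 : F) else 0 := by
    intro i; rw [hD, lamDer_X]; simp
  let S : Subalgebra F (DPoly ι F) :=
    { carrier := {P | P ∈ VLE b x ∧ D (toCoords b B e f u u' a' P) =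
        toCoords b B e f u u' a' (rho b B f x (adOp b B s z l (u' k₀ : g) 1 P))}
      mul_mem' := by
        rintro P Q ⟨hP, hP'⟩ ⟨hQ, hQ'⟩
        refine ⟨mul_mem hP hQ, ?_⟩
        simp only [map_mul, Derivation.leibniz, map_add, smul_eq_mul, hP', hQ', H.rho_of_mem hP,
          H.rho_of_mem hQ]
      add_mem' := by
        rintro P Q ⟨hP, hP'⟩ ⟨hQ, hQ'⟩
        refine ⟨add_mem hP hQ, ?_⟩
        simp only [map_add, hP', hQ']
      algebraMap_mem' := by
        intro c
        refine ⟨Subalgebra.algebraMap_mem _ _, ?_⟩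
        simp }
  have hdel : ∀ P ∈ S, del P ∈ S := by
    rintro P ⟨hP, hP'⟩
    refine ⟨del_mem_VLE b hP, ?_⟩
    rw [toCoords_del, adOp_del, rho_shift, hD, lamDer_del, ← hD, hP']
    simp only [shift_apply, map_add, map_smul, toCoords_del]
  have hzero : ∀ p ∈ gr F x 0, inc b p ∈ S := by
    intro p hp
    refine ⟨inc_mem_VLE b (H.mem_grLE_of_zero hp), ?_⟩
    have h1 := H.rho_adOp_zero b (s := s) (z := z) (u' k₀).2 hp hs l 1
    rw [derivation_incS, map_one] at h1
    have h2 : B f ⁅(u' k₀ : g), p⁆ = -B ⁅f, p⁆ (u' k₀ : g) := by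
      rw [← H.inv, ← lie_skew, map_neg, LinearMap.neg_apply, H.inv, H.symm]
    rw [h1, H.toCoords_inc_of_zero hp, H.coords_of_zero hp, h2]
    have h3 : (MvPolynomial.C (-2 : F) : DPoly (K ⊕ J ⊕ K) F) = (-2 : F) • 1 := by
      rw [MvPolynomial.smul_eq_C_mul, mul_one]
    simp only [map_add, map_sum, Derivation.map_smul, hDX, map_smul, map_one, Sum.inr.injEq,
      reduceCtorEq, if_false, smul_zero, Finset.sum_const_zero, zero_add, smul_ite,
      Finset.sum_ite_eq', Finset.mem_univ, if_true, h3]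
    module
  have hpsi : ∀ w ∈ gr F x (-2), psi b e f u u' w ∈ S := by
    intro w hw
    have h1 : psi b e f u u' w = psiS b B e f s z u u' w - algebraMap F _ (z * B s w) :=
      H.psi_eq b hs hw
    refine ⟨?_, ?_⟩
    · rw [h1]; exact sub_mem (H.psiS_mem b hw) (Subalgebra.algebraMap_mem _ _)
    · have h2 := H.strongInv_psiS b (z := z) hs hu hw _ (u' k₀).2 l 1
      rw [H.toCoords_psi hu hw, H.coords_of_neg hw, h1, map_sub, Derivation.map_algebraMap,
        sub_zero, h2, map_zero, map_sum]
      exact Finset.sum_eq_zero fun k _ => by rw [Derivation.map_smul, hDX]; simp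
  have hneg : ∀ w ∈ gr F x (-2), inc b w ∈ S := by
    intro w hw
    have h1 : inc b w = psi b e f u u' w - psiQuad e f u u' (inc b) w := by
      rw [psi_eq_inc_add, add_sub_cancel_right]
    rw [h1, psiQuad_apply]
    refine sub_mem (hpsi w hw) (add_mem (sub_mem (neg_mem
      (Subalgebra.smul_mem _ (sum_mem fun k _ => ?_) _))
      (Subalgebra.smul_mem _ (sum_mem fun k _ => ?_) _))
      (Subalgebra.smul_mem _ (hdel _ (hzero _ (H.lie_e_mem hw))) _))
    · exact mul_mem (hzero _ (lie_u_mem hw k)) (hzero _ (H.lie_e_mem (u k).2))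
    · exact mul_mem (hzero _ (H.lie_f_mem (u' k).2))
        (hzero _ (H.lie_e_mem (H.jord_mem hw (u k).2)))
  have hall : P ∈ S := by
    refine VLE_induction b (p := fun P => P ∈ S) (Subalgebra.algebraMap_mem S)
      (fun P Q => add_mem) (fun P Q _ _ => mul_mem) (fun P _ => hdel P) (fun p hp => ?_) hP
    rw [H.grLE_one] at hp
    obtain ⟨w, hw, c, hc, rfl⟩ := Submodule.mem_sup.1 hp
    rw [map_add]
    exact add_mem (hneg w hw) (hzero c hc)
  exact hall.2

/-- The coordinates of an invariant do not involve the variables `[e,u_k]`. -/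
lemma notMem_vars_toCoords (H : ShortTriple B e f x) (hs : s ∈ gr F x 2)
    (hu : ∀ h k, B (u h : g) (u' k : g) = if h = k then 1 else 0)
    {P : DPoly ι F} (hP : P ∈ VLE b x)
    (hinv : ∀ n ∈ gr F x 2, ∀ l : F, rho b B f x (adOp b B s z l n 1 P) = 0) (k : K) (m : ℕ) :
    (Sum.inr (Sum.inr k), m) ∉ (toCoords b B e f u u' a' P).vars := by
  refine notMem_vars_of_lamDer_eq_zero _ (r := -2) (by norm_num) (fun l => ?_) m
  rw [H.lamDer_toCoords hs hu k l hP, hinv _ (u' k).2, map_zero]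

/-- Invariants are differential polynomials in the `ψ(u_k)` and `a_i`. -/
lemma mem_adjoin_of_invariant (H : ShortTriple B e f x) (hs : s ∈ gr F x 2)
    (hu : ∀ h k, B (u h : g) (u' k : g) = if h = k then 1 else 0)
    (ha : ∀ i j, B (a i : g) (a' j : g) = if i = j then 1 else 0) {P : DPoly ι F}
    (hP : P ∈ VLE b x)
    (hinv : ∀ n ∈ gr F x 2, ∀ l : F, rho b B f x (adOp b B s z l n 1 P) = 0) :
    P ∈ Algebra.adjoin F {P | ∃ n : ℕ, (∃ p ∈ cent0 F f x, P = del^[n] (inc b p)) ∨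
      (∃ w ∈ gr F x (-2), P = del^[n] (psi b e f u u' w))} := by
  have h1 : toCoords b B e f u u' a' P ∈ MvPolynomial.supported F
      {q : (K ⊕ J ⊕ K) × ℕ | ∀ k, q.1 ≠ Sum.inr (Sum.inr k)} := by
    rw [MvPolynomial.mem_supported]
    rintro ⟨i, m⟩ hq k rfl
    exact H.notMem_vars_toCoords hs hu hP hinv k m hq
  rw [MvPolynomial.supported_eq_adjoin_X] at h1
  have h2 := Subalgebra.mem_map.2 ⟨_, h1, H.ofCoords_toCoords hu ha hP⟩
  rw [AlgHom.map_adjoin] at h2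
  refine Algebra.adjoin_mono ?_ h2
  rintro _ ⟨_, ⟨⟨i, m⟩, hi, rfl⟩, rfl⟩
  refine ⟨m, ?_⟩
  rcases i with k | i | k
  · exact Or.inr ⟨u k, (u k).2, by simp [ofCoords, coordGen]⟩
  · exact Or.inl ⟨a i, (a i).2, by simp [ofCoords, coordGen]⟩
  · exact absurd rfl (hi k)

lemma dropCoords_toCoords_sharp (H : ShortTriple B e f x) {p : g} (hp : p ∈ gr F x 0) :
    dropCoords (toCoords b B e f u u' a' (inc b (sharp F e f x p))) =
      dropCoords (toCoords b B e f u u' a' (inc b p)) := by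
  have hc := mem_cent0.1 (H.sharp_mem_cent0 hp)
  rw [H.toCoords_inc_of_zero hp, H.toCoords_inc_of_zero hc.2, H.coords_of_zero hp,
    H.coords_of_zero hc.2, hc.1]
  simp only [H.form_sharp hp (a' _).2, map_add, map_sum, map_smul, dropCoords_X_inr_inr,
    smul_zero, Finset.sum_const_zero, map_zero, LinearMap.zero_apply, zero_smul]

/-- An invariant is determined by its image under the projection to the differential polynomials
on `g^f`. -/
lemma eq_zero_of_sharpHom (H : ShortTriple B e f x) (hs : s ∈ gr F x 2)
    (hu : ∀ h k, B (u h : g) (u' k : g) = if h = k then 1 else 0)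
    (ha : ∀ i j, B (a i : g) (a' j : g) = if i = j then 1 else 0) {P : DPoly ι F}
    (hP : P ∈ VLE b x)
    (hinv : ∀ n ∈ gr F x 2, ∀ l : F, rho b B f x (adOp b B s z l n 1 P) = 0)
    (h0 : sharpHom b e f x P = 0) : P = 0 := by
  -- the coordinates of `P` do not involve the variables that `dropCoords` kills
  have h1 : dropCoords (toCoords b B e f u u' a' P) = toCoords b B e f u u' a' P := by
    have := MvPolynomial.hom_congr_vars (f₁ := (dropCoords (K := K) (J := J) (F := F)).toRingHom)
      (f₂ := RingHom.id _) (p₁ := toCoords b B e f u u' a' P) (p₂ := toCoords b B e f u u' a' P)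
      (by ext c; simp) ?_ rfl
    · simpa using this
    · rintro ⟨i, m⟩ hi _
      rcases i with k | i | k
      · exact dropCoords_X_inl k m
      · exact dropCoords_X_inr_inl i m
      · exact absurd hi (H.notMem_vars_toCoords hs hu hP hinv k m)
  -- `p` and `p^♯` have the same coordinates, except for those killed by `dropCoords`
  have h2 : dropCoords (toCoords b B e f u u' a' P) =
      dropCoords (toCoords b B e f u u' a' (sharpHom b e f x P)) := by
    refine VLE_induction b (x := x) (p := fun P => dropCoords (toCoords b B e f u u' a' P) =
      dropCoords (toCoords b B e f u u' a' (sharpHom b e f x P))) ?_ ?_ ?_ ?_ ?_ hP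
    · intro c; simp only [AlgHom.commutes]
    · intro P Q hP hQ; simp only [map_add, hP, hQ]
    · intro P Q _ _ hP hQ; simp only [map_mul, hP, hQ]
    · intro P _ hP; simp only [sharpHom_del, toCoords_del, dropCoords_del, hP]
    · intro p hp
      rw [H.grLE_one] at hp
      obtain ⟨w, hw, c, hc, rfl⟩ := Submodule.mem_sup.1 hp
      have h3 : sharp F e f x (w + c) = w + sharp F e f x c := by
        rw [map_add, H.sharp_of_neg hw]
      rw [sharpHom_inc, h3, map_add (inc b), map_add (inc b), map_add (toCoords b B e f u u' a'),
        map_add (toCoords b B e f u u' a'), map_add dropCoords, map_add dropCoords,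
        H.dropCoords_toCoords_sharp hc]
  rw [← H.ofCoords_toCoords hu ha hP, ← h1, h2, h0]
  simp

end ShortTriple

end Structure

/-! ### The brackets of the generators -/

section Rearrange

variable {F : Type*} [Field F] {ι : Type*}

/-- The rearrangement of the projected terms of `{ψ(w) λ ψ(y)}`, with `A k = [w,u^k]^♯`,
`A₁ k = [y,u^k]^♯`, `C k = [[e,w],[e,u_k]]`, `C₁ k = [[e,y],[e,u_k]]` and `c = [[e,w],[e,y]]`. -/
lemma rearrange_bracket {K : Type*} [Fintype K] (l β₀ : F) (A A₁ C C₁ Q Q₁ : K → DPoly ι F)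
    (V : K → K → DPoly ι F) (T c : DPoly ι F) (β : K → F)
    (hsym : ∑ k, C k * del (A₁ k) = ∑ k, del (C₁ k) * A k) (hform : ∑ k, β k • A₁ k = -c) :
    -((1 / 2 : F) • ∑ k, Q₁ k * A k) - (l / 2) • T
      - (1 / 2 : F) • ∑ k, A₁ k * (-Q k - (1 / 2 : F) • ∑ h, V h k * A h
          - (1 / 2 : F) • shift l (C k) - (l / 2) • (C k + (β k * l) • (1 : DPoly ι F)))
      + (1 / 2 : F) • (shift l (-T) - (1 / 2 : F) • ∑ k, shift l (-C₁ k * A k)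
          - (1 / 2 : F) • shift l (shift l c)
          - (l / 2) • (shift l c + (-β₀ * l) • shift l (1 : DPoly ι F))) =
      (1 / 2 : F) • ∑ k, Q k * A₁ k - (1 / 2 : F) • ∑ k, Q₁ k * A k
      + (1 / 4 : F) • ∑ h, ∑ k, V h k * A h * A₁ k
      - (1 / 2 : F) • (del T + (2 * l) • T)
      + (1 / 4 : F) • (∑ k, del (C k * A₁ k) + (2 * l) • ∑ k, C k * A₁ k)
      + (1 / 4 : F) • ∑ k, C₁ k * shift l (A k)
      - (1 / 4 : F) • ((3 * l ^ 2) • c + (3 * l) • del c + del (del c))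
      + (1 / 4 * β₀ * l ^ 3) • 1 := by
  have e1 : ∑ k, A₁ k * (-Q k - (1 / 2 : F) • ∑ h, V h k * A h
          - (1 / 2 : F) • shift l (C k) - (l / 2) • (C k + (β k * l) • (1 : DPoly ι F))) =
      -∑ k, Q k * A₁ k - (1 / 2 : F) • ∑ h, ∑ k, V h k * A h * A₁ k
        - l • ((1 / 2 : F) • ∑ k, C k * A₁ k) - (1 / 2 : F) • ∑ k, del (C k) * A₁ k
        - l • ((1 / 2 : F) • ∑ k, C k * A₁ k) - (l * l) • ((1 / 2 : F) • ∑ k, β k • A₁ k) := by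
    rw [Finset.sum_comm]
    simp only [Finset.smul_sum, ← Finset.sum_sub_distrib, ← Finset.sum_neg_distrib]
    refine Finset.sum_congr rfl fun k _ => ?_
    rw [← Finset.smul_sum, ← Finset.smul_sum, ← Finset.sum_mul, div_eq_mul_inv l,
      ← one_div]
    simp only [shift_apply, Algebra.smul_def, map_mul]
    ring
  have e2 : ∑ k, shift l (-C₁ k * A k) =
      -(l • ∑ k, C₁ k * A k) - ∑ k, C k * del (A₁ k) - ∑ k, C₁ k * del (A k) := by
    rw [hsym]
    simp only [Finset.smul_sum, ← Finset.sum_sub_distrib, ← Finset.sum_neg_distrib]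
    refine Finset.sum_congr rfl fun k _ => ?_
    simp only [shift_apply, Derivation.leibniz, map_neg, smul_eq_mul]
    simp only [Algebra.smul_def]
    ring
  have e3 : ∑ k, C₁ k * shift l (A k) = l • ∑ k, C₁ k * A k + ∑ k, C₁ k * del (A k) := by
    simp only [Finset.smul_sum, ← Finset.sum_add_distrib]
    refine Finset.sum_congr rfl fun k _ => ?_
    simp only [shift_apply, Algebra.smul_def]
    ring
  have e4 : ∑ k, del (C k * A₁ k) = ∑ k, C k * del (A₁ k) + ∑ k, del (C k) * A₁ k := by
    rw [← Finset.sum_add_distrib]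
    refine Finset.sum_congr rfl fun k _ => ?_
    rw [Derivation.leibniz, smul_eq_mul, smul_eq_mul, mul_comm (A₁ k)]
  rw [e1, e2, e3, e4, hform, shift_one]
  have q : (1 / 4 : F) = 1 / 2 * (1 / 2) := by
    rw [div_mul_div_comm]; norm_num
  simp only [shift_apply, map_add, map_neg, Derivation.map_smul, div_eq_mul_inv l, ← one_div, q]
  simp only [Algebra.smul_def, map_mul, map_neg, map_pow, map_ofNat]
  ring

end Rearrange

section Brackets

variable {F : Type*} [Field F] [CharZero F] {g : Type*} [LieRing g] [LieAlgebra F g] {ι : Type*}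
variable (b : Module.Basis ι F g) {B : LinearMap.BilinForm F g} {e f x : g} {s : g} {z : F}
variable {K : Type*} [Fintype K] [DecidableEq K] {u : Module.Basis K F (gr F x (-2))}
  {u' : Module.Basis K F (gr F x 2)}
variable {J : Type*} [Fintype J] [DecidableEq J] {a a' : Module.Basis J F (cent0 F f x)}

variable (B f x s z) in
/-- The invariants in `V(g_{≤ 1/2})`, as a subalgebra. -/
def invAlg : Subalgebra F (DPoly ι F) where
  carrier := {P | P ∈ VLE b x ∧ ∀ n ∈ gr F x 2, ∀ l : F, rho b B f x (adOp b B s z l n 1 P) = 0}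
  mul_mem' := by
    rintro P Q ⟨hP, hP'⟩ ⟨hQ, hQ'⟩
    refine ⟨mul_mem hP hQ, fun n hn l => ?_⟩
    rw [Derivation.leibniz, map_add, smul_eq_mul, smul_eq_mul, map_mul, map_mul, hP' n hn,
      hQ' n hn, mul_zero, mul_zero, add_zero]
  add_mem' := by
    rintro P Q ⟨hP, hP'⟩ ⟨hQ, hQ'⟩
    refine ⟨add_mem hP hQ, fun n hn l => ?_⟩
    rw [map_add, map_add, hP' n hn, hQ' n hn, add_zero]
  algebraMap_mem' c := ⟨Subalgebra.algebraMap_mem _ _, fun n hn l => by simp⟩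

lemma del_mem_invAlg {P : DPoly ι F} (hP : P ∈ invAlg b B f x s z) :
    del P ∈ invAlg b B f x s z :=
  ⟨del_mem_VLE b hP.1, fun n hn l => by rw [adOp_del, rho_shift, hP.2 n hn, map_zero]⟩

variable {b}

lemma shift_mem_invAlg {P : DPoly ι F} (l : F)
    (hP : P ∈ invAlg b B f x s z) : shift l P ∈ invAlg b B f x s z := by
  rw [shift_apply]
  exact add_mem (Subalgebra.smul_mem _ hP l) (del_mem_invAlg b hP)

namespace ShortTriple

lemma incS_mem_invAlg (H : ShortTriple B e f x) (hs : s ∈ gr F x 2) {p : g}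
    (hp : p ∈ cent0 F f x) : incS b B s z p ∈ invAlg b B f x s z :=
  ⟨incS_mem (H.mem_grLE_of_zero (mem_cent0.1 hp).2), fun n hn l =>
    H.strongInv_incS b hs hp n hn l 1⟩

lemma inc_mem_invAlg (H : ShortTriple B e f x) (hs : s ∈ gr F x 2) {p : g}
    (hp : p ∈ cent0 F f x) : inc b p ∈ invAlg b B f x s z := by
  rw [← H.incS_of_zero (B := B) (z := z) hs (mem_cent0.1 hp).2]; exact H.incS_mem_invAlg hs hp

lemma psiS_mem_invAlg (H : ShortTriple B e f x) (hs : s ∈ gr F x 2)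
    (hu : ∀ h k, B (u h : g) (u' k : g) = if h = k then 1 else 0) {w : g}
    (hw : w ∈ gr F x (-2)) : psiS b B e f s z u u' w ∈ invAlg b B f x s z :=
  ⟨H.psiS_mem b hw, fun n hn l => H.strongInv_psiS b hs hu hw n hn l 1⟩

lemma adL_mem_invAlg (H : ShortTriple B e f x) (hs : s ∈ gr F x 2) (l : F) {P Q : DPoly ι F}
    (hP : LeftInv b B f x s z P) (hQ : StrongInv b B f x s z Q) (hQ' : Q ∈ VLE b x) :
    adL b B s z l P Q ∈ invAlg b B f x s z :=
  ⟨hP.mem l Q hQ', fun _ hn m => H.rho_adOp_adL hs m l hP hQ hn⟩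

/-- Invariants are equal as soon as their projections to the differential polynomials on `g^f`
are. -/
lemma eq_of_sharpHom_eq (H : ShortTriple B e f x) (hs : s ∈ gr F x 2)
    (hu : ∀ h k, B (u h : g) (u' k : g) = if h = k then 1 else 0)
    (ha : ∀ i j, B (a i : g) (a' j : g) = if i = j then 1 else 0) {P Q : DPoly ι F}
    (hP : P ∈ invAlg b B f x s z) (hQ : Q ∈ invAlg b B f x s z)
    (h : sharpHom b e f x P = sharpHom b e f x Q) : P = Q := by
  have hPQ := sub_mem hP hQ
  exact sub_eq_zero.1 (H.eq_zero_of_sharpHom hs hu ha hPQ.1 hPQ.2 (by rw [map_sub, h, sub_self]))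

lemma sharpHom_shift (l : F) (P : DPoly ι F) :
    sharpHom b e f x (shift l P) = shift l (sharpHom b e f x P) := by
  simp only [shift_apply, map_add, map_smul, sharpHom_del]

lemma sharpHom_incS_of_zero (H : ShortTriple B e f x) (hs : s ∈ gr F x 2) {p : g}
    (hp : p ∈ gr F x 0) : sharpHom b e f x (incS b B s z p) = inc b (sharp F e f x p) := by
  rw [H.incS_of_zero hs hp, sharpHom_inc]

lemma sharpHom_incS_of_neg (H : ShortTriple B e f x) {w : g}
    (hw : w ∈ gr F x (-2)) : sharpHom b e f x (incS b B s z w) = incS b B s z w := by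
  rw [incS_apply, map_add, sharpHom_inc, H.sharp_of_neg hw, AlgHom.commutes]

lemma sharpHom_inc_of_cent0 (H : ShortTriple B e f x) {p : g} (hp : p ∈ cent0 F f x) :
    sharpHom b e f x (inc b p) = inc b p := by
  rw [sharpHom_inc, H.sharp_of_cent0 hp]

lemma sharpHom_incS_lie_e (H : ShortTriple B e f x) (hs : s ∈ gr F x 2) {w : g}
    (hw : w ∈ gr F x (-2)) : sharpHom b e f x (incS b B s z ⁅e, w⁆) = 0 := by
  rw [H.sharpHom_incS_of_zero hs (H.lie_e_mem hw), H.sharp_lie_e hw, map_zero]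

lemma sharpHom_incS_lie_f (H : ShortTriple B e f x) (hs : s ∈ gr F x 2) {n : g}
    (hn : n ∈ gr F x 2) : sharpHom b e f x (incS b B s z ⁅f, n⁆) = 0 := by
  rw [H.sharpHom_incS_of_zero hs (H.lie_f_mem hn), H.sharp_lie_f hn, map_zero]

lemma sharpHom_psiS (H : ShortTriple B e f x) (hs : s ∈ gr F x 2) {w : g}
    (hw : w ∈ gr F x (-2)) :
    sharpHom b e f x (psiS b B e f s z u u' w) = incS b B s z w := by
  have h1 : ∀ k, sharpHom b e f x (incS b B s z ⁅e, (u k : g)⁆) = 0 := fun k =>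
    H.sharpHom_incS_lie_e hs (u k).2
  have h2 : ∀ k, sharpHom b e f x (incS b B s z ⁅f, (u' k : g)⁆) = 0 := fun k =>
    H.sharpHom_incS_lie_f hs (u' k).2
  rw [psiS, LinearMap.add_apply, psiQuad_apply]
  simp only [map_add, map_sub, map_neg, map_smul, map_sum, map_mul, h1, h2, mul_zero, zero_mul,
    Finset.sum_const_zero, smul_zero, sharpHom_del, H.sharpHom_incS_lie_e hs hw, map_zero,
    neg_zero, sub_zero, add_zero, H.sharpHom_incS_of_neg hw]

/-- Only the part of `ψ(w)` that is at most linear in `[e,g_{-1}]` contributes to the projection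
of a bracket. -/
lemma sharpHom_derivation_psiS (H : ShortTriple B e f x) (hs : s ∈ gr F x 2) {w : g}
    (hw : w ∈ gr F x (-2)) {l : F} {D : Derivation F (DPoly ι F) (DPoly ι F)}
    (hD : ∀ P, D (del P) = shift l (D P)) :
    sharpHom b e f x (D (psiS b B e f s z u u' w)) = sharpHom b e f x (D (incS b B s z w))
      - (1 / 2 : F) • ∑ k, inc b (sharp F e f x ⁅w, (u' k : g)⁆) *
          sharpHom b e f x (D (incS b B s z ⁅e, (u k : g)⁆))
      + (1 / 2 : F) • shift l (sharpHom b e f x (D (incS b B s z ⁅e, w⁆))) := by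
  have h1 : ∀ k, sharpHom b e f x (incS b B s z ⁅e, (u k : g)⁆) = 0 := fun k =>
    H.sharpHom_incS_lie_e hs (u k).2
  have h2 : ∀ k, sharpHom b e f x (incS b B s z ⁅f, (u' k : g)⁆) = 0 := fun k =>
    H.sharpHom_incS_lie_f hs (u' k).2
  have h3 : ∀ k, sharpHom b e f x (incS b B s z ⁅e, jord e w (u k : g)⁆) = 0 := fun k =>
    H.sharpHom_incS_lie_e hs (H.jord_mem hw (u k).2)
  have h4 : ∀ k, sharpHom b e f x (incS b B s z ⁅w, (u' k : g)⁆) =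
      inc b (sharp F e f x ⁅w, (u' k : g)⁆) := fun k =>
    H.sharpHom_incS_of_zero hs (lie_u_mem hw k)
  rw [psiS, LinearMap.add_apply, psiQuad_apply]
  simp only [map_add, map_sub, map_neg, map_smul, Derivation.map_smul, map_sum,
    Derivation.leibniz, smul_eq_mul, map_mul, h1, h2, h3, h4, zero_mul, add_zero,
    Finset.sum_const_zero, smul_zero, hD, sharpHom_shift, sub_zero]
  abel

lemma sharpHom_adOp_incS (l : F) (p q : g) (h : DPoly ι F) :
    sharpHom b e f x (adOp b B s z l p h (incS b B s z q)) =
      sharpHom b e f x (incS b B s z ⁅p, q⁆) * sharpHom b e f x h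
        + B p q • shift l (sharpHom b e f x h) := by
  rw [adOp_incS, map_add, map_mul, map_smul, sharpHom_shift]

/-- The projection of `{ψ(w) λ q}`, for `q ∈ g`. -/
lemma sharpHom_adL_psiS_incS (H : ShortTriple B e f x) (hs : s ∈ gr F x 2) {w : g}
    (hw : w ∈ gr F x (-2)) (l : F) (q : g) :
    sharpHom b e f x (adL b B s z l (psiS b B e f s z u u' w) (incS b B s z q)) =
      sharpHom b e f x (incS b B s z ⁅w, q⁆) + (B w q * l) • 1
      - (1 / 2 : F) • ∑ k, (sharpHom b e f x (incS b B s z ⁅⁅e, (u k : g)⁆, q⁆) *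
          inc b (sharp F e f x ⁅w, (u' k : g)⁆)
        + B ⁅e, (u k : g)⁆ q • shift l (inc b (sharp F e f x ⁅w, (u' k : g)⁆)))
      - (l / 2) • (sharpHom b e f x (incS b B s z ⁅⁅e, w⁆, q⁆) + (B ⁅e, w⁆ q * l) • 1) := by
  have h1 : ∀ k, sharpHom b e f x (incS b B s z ⁅e, (u k : g)⁆) = 0 := fun k =>
    H.sharpHom_incS_lie_e hs (u k).2
  have h2 : ∀ k, sharpHom b e f x (incS b B s z ⁅f, (u' k : g)⁆) = 0 := fun k =>
    H.sharpHom_incS_lie_f hs (u' k).2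
  have h3 : ∀ k, sharpHom b e f x (incS b B s z ⁅e, jord e w (u k : g)⁆) = 0 := fun k =>
    H.sharpHom_incS_lie_e hs (H.jord_mem hw (u k).2)
  have h4 : ∀ k, sharpHom b e f x (incS b B s z ⁅w, (u' k : g)⁆) =
      inc b (sharp F e f x ⁅w, (u' k : g)⁆) := fun k =>
    H.sharpHom_incS_of_zero hs (lie_u_mem hw k)
  rw [adL_psiS_apply]
  simp only [map_add, map_sub, map_smul, map_sum, sharpHom_adOp_incS, h1, h2, h3, h4, mul_zero,
    map_zero, smul_zero, add_zero, zero_add, Finset.sum_const_zero, sub_zero, map_one, mul_one,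
    shift_one, smul_smul]

/-- Contraction of `[e,u_k]` with the form, against `[w,u^k]^♯`. -/
lemma sum_form_lie_e_smul {M : Type*} [AddCommGroup M] [Module F M] (H : ShortTriple B e f x)
    (hu : ∀ h k, B (u h : g) (u' k : g) = if h = k then 1 else 0) {w y : g}
    (hw : w ∈ gr F x (-2)) (hy : y ∈ gr F x (-2)) (φ : g →ₗ[F] M) :
    ∑ k, B ⁅e, (u k : g)⁆ ⁅e, y⁆ • φ (sharp F e f x ⁅w, (u' k : g)⁆) =
      φ ⁅⁅e, w⁆, ⁅e, y⁆⁆ := by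
  have hn : -⁅e, ⁅e, y⁆⁆ ∈ gr F x 2 :=
    neg_mem (lie_mem_gr H.e_mem (H.lie_e_mem hy) (by norm_num))
  have h := sum_form_smul (H.dual_symm hu) hn
    (φ ∘ₗ sharp F e f x ∘ₗ (LieAlgebra.ad F g w : g →ₗ[F] g))
  simp only [LinearMap.comp_apply, LieAlgebra.ad_apply] at h
  rw [lie_neg, map_neg, map_neg, H.sharp_lie_lie_e_lie_e hy hw, ← map_neg, lie_skew, lie_skew] at h
  rw [← h]
  refine Finset.sum_congr rfl fun k _ => ?_
  rw [H.symm, ← H.inv]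

/-- The symmetry of `∑ [[e,w],[e,u_k]] ⊗ [y,u^k]^♯` under the exchange of `w` and `y`. -/
lemma sum_lie_lie_e_mul (H : ShortTriple B e f x)
    (hu : ∀ h k, B (u h : g) (u' k : g) = if h = k then 1 else 0) {w y : g}
    (hw : w ∈ gr F x (-2)) (hy : y ∈ gr F x (-2)) {A : Type*} [CommRing A] [Algebra F A]
    (φ φ' : g →ₗ[F] A) :
    ∑ k, φ ⁅⁅e, w⁆, ⁅e, (u k : g)⁆⁆ * φ' (sharp F e f x ⁅y, (u' k : g)⁆) =
      ∑ k, φ' ⁅⁅e, y⁆, ⁅e, (u k : g)⁆⁆ * φ (sharp F e f x ⁅w, (u' k : g)⁆) := by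
  simp only [← fun k => H.sum_form_lie_e_smul hu hw (u k).2 φ,
    ← fun k => H.sum_form_lie_e_smul hu hy (u k).2 φ', Finset.sum_mul]
  rw [Finset.sum_comm]
  refine Finset.sum_congr rfl fun h _ => Finset.sum_congr rfl fun k _ => ?_
  rw [H.symm ⁅e, (u h : g)⁆, smul_mul_assoc, smul_mul_assoc, mul_comm (φ _)]

/-- The projection of `{ψ(w) λ y}` for `y ∈ g_{-1}`. -/
lemma sharpHom_adL_psiS_neg (H : ShortTriple B e f x) (hs : s ∈ gr F x 2) {w y : g}
    (hw : w ∈ gr F x (-2)) (hy : y ∈ gr F x (-2)) (l : F) :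
    sharpHom b e f x (adL b B s z l (psiS b B e f s z u u' w) (incS b B s z y)) =
      -((1 / 2 : F) • ∑ k, incS b B s z (jord e y (u k)) *
          inc b (sharp F e f x ⁅w, (u' k : g)⁆))
      - (l / 2) • incS b B s z (jord e w y) := by
  have h1 : ∀ k, ⁅⁅e, (u k : g)⁆, y⁆ = jord e y (u k) := fun k => H.jord_comm (u k).2 hy
  have h2 : ⁅⁅e, w⁆, y⁆ = jord e w y := rfl
  have h3 : ∀ k, B ⁅e, (u k : g)⁆ y = 0 := fun k =>
    H.form_eq_zero (by norm_num) (H.lie_e_mem (u k).2) hy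
  rw [H.sharpHom_adL_psiS_incS hs hw, H.lie_eq_zero_of_neg hw hy,
    H.form_eq_zero (by norm_num) hw hy, H.form_eq_zero (by norm_num) (H.lie_e_mem hw) hy, h2]
  simp only [h1, h3, map_zero, zero_smul, zero_mul, add_zero, zero_sub,
    H.sharpHom_incS_of_neg (H.jord_mem hy (u _).2), H.sharpHom_incS_of_neg (H.jord_mem hw hy)]

/-- The projection of `{ψ(w) λ [e,y]}` for `y ∈ g_{-1}`. -/
lemma sharpHom_adL_psiS_lie_e (H : ShortTriple B e f x) (hs : s ∈ gr F x 2)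
    (hu : ∀ h k, B (u h : g) (u' k : g) = if h = k then 1 else 0) {w y : g}
    (hw : w ∈ gr F x (-2)) (hy : y ∈ gr F x (-2)) (l : F) :
    sharpHom b e f x (adL b B s z l (psiS b B e f s z u u' w) (incS b B s z ⁅e, y⁆)) =
      -incS b B s z (jord e w y)
      - (1 / 2 : F) • ∑ k, inc b ⁅⁅e, (u k : g)⁆, ⁅e, y⁆⁆ *
          inc b (sharp F e f x ⁅w, (u' k : g)⁆)
      - (1 / 2 : F) • shift l (inc b ⁅⁅e, w⁆, ⁅e, y⁆⁆)
      - (l / 2) • (inc b ⁅⁅e, w⁆, ⁅e, y⁆⁆ + (B ⁅e, w⁆ ⁅e, y⁆ * l) • 1) := by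
  have h1 : ∀ {v : g}, v ∈ gr F x (-2) → sharpHom b e f x (incS b B s z ⁅⁅e, v⁆, ⁅e, y⁆⁆) =
      inc b ⁅⁅e, v⁆, ⁅e, y⁆⁆ := by
    intro v hv
    have h := H.lie_lie_e_mem_cent0 hv hy
    rw [H.sharpHom_incS_of_zero hs (mem_cent0.1 h).2, H.sharp_of_cent0 h]
  have h2 := H.sum_form_lie_e_smul hu hw hy (shift l ∘ₗ inc b)
  simp only [LinearMap.comp_apply] at h2
  rw [H.sharpHom_adL_psiS_incS hs hw, H.lie_neg_lie_e hy hw,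
    H.form_eq_zero (by norm_num) hw (H.lie_e_mem hy), h1 hw, map_neg, map_neg,
    H.sharpHom_incS_of_neg (H.jord_mem hw hy), Finset.sum_add_distrib, h2]
  simp only [h1 (u _).2]
  module

/-- The bracket of `ψ(w)` and `ψ(y)`. -/
lemma adL_psiS_psiS (H : ShortTriple B e f x) (hs : s ∈ gr F x 2)
    (hu : ∀ h k, B (u h : g) (u' k : g) = if h = k then 1 else 0)
    (ha : ∀ i j, B (a i : g) (a' j : g) = if i = j then 1 else 0) {w y : g}
    (hw : w ∈ gr F x (-2)) (hy : y ∈ gr F x (-2)) (l : F) :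
    adL b B s z l (psiS b B e f s z u u' w) (psiS b B e f s z u u' y) =
      (1 / 2 : F) • ∑ k, psiS b B e f s z u u' (jord e w (u k))
          * inc b (sharp F e f x ⁅y, (u' k : g)⁆)
      - (1 / 2 : F) • ∑ k, psiS b B e f s z u u' (jord e y (u k))
          * inc b (sharp F e f x ⁅w, (u' k : g)⁆)
      + (1 / 4 : F) • ∑ h, ∑ k, inc b ⁅⁅e, (u h : g)⁆, ⁅e, (u k : g)⁆⁆
          * inc b (sharp F e f x ⁅w, (u' h : g)⁆) * inc b (sharp F e f x ⁅y, (u' k : g)⁆)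
      - (1 / 2 : F) • (del (psiS b B e f s z u u' (jord e w y))
          + (2 * l) • psiS b B e f s z u u' (jord e w y))
      + (1 / 4 : F) •
          (del (∑ k, inc b ⁅⁅e, w⁆, ⁅e, (u k : g)⁆⁆ * inc b (sharp F e f x ⁅y, (u' k : g)⁆))
            + (2 * l) •
              ∑ k, inc b ⁅⁅e, w⁆, ⁅e, (u k : g)⁆⁆ * inc b (sharp F e f x ⁅y, (u' k : g)⁆))
      + (1 / 4 : F) • ∑ k, inc b ⁅⁅e, y⁆, ⁅e, (u k : g)⁆⁆
          * shift l (inc b (sharp F e f x ⁅w, (u' k : g)⁆))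
      - (1 / 4 : F) • ((3 * l ^ 2) • inc b ⁅⁅e, w⁆, ⁅e, y⁆⁆
          + (3 * l) • del (inc b ⁅⁅e, w⁆, ⁅e, y⁆⁆) + del (del (inc b ⁅⁅e, w⁆, ⁅e, y⁆⁆)))
      + (1 / 4 * B e (jord e w y) * l ^ 3) • 1 := by
  have hψ : ∀ {v : g}, v ∈ gr F x (-2) → psiS b B e f s z u u' v ∈ invAlg b B f x s z :=
    fun hv => H.psiS_mem_invAlg hs hu hv
  have hi : ∀ {p : g}, p ∈ cent0 F f x → inc b p ∈ invAlg b B f x s z :=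
    fun hp => H.inc_mem_invAlg hs hp
  have hjw := fun k => H.jord_mem hw (u k).2
  have hjy := fun k => H.jord_mem hy (u k).2
  have haw := fun k => H.sharp_mem_cent0 (lie_u_mem (u' := u') hw k)
  have hay := fun k => H.sharp_mem_cent0 (lie_u_mem (u' := u') hy k)
  have hcw := fun k => H.lie_lie_e_mem_cent0 hw (u k).2
  have hcy := fun k => H.lie_lie_e_mem_cent0 hy (u k).2
  have hcu := fun h k => H.lie_lie_e_mem_cent0 (u h).2 (u k).2
  have hwy := H.jord_mem hw hy
  have hc := H.lie_lie_e_mem_cent0 hw hy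
  have hS := sum_mem (t := Finset.univ) fun k _ => mul_mem (hi (hcw k)) (hi (hay k))
  refine H.eq_of_sharpHom_eq (z := z) hs hu ha
    (H.adL_mem_invAlg hs l (H.leftInv_psiS b hs hu hw) (H.strongInv_psiS b hs hu hy)
      (H.psiS_mem b hy)) ?_ ?_
  · refine add_mem (sub_mem (add_mem (add_mem (sub_mem (add_mem (sub_mem
      (Subalgebra.smul_mem _ (sum_mem fun k _ => mul_mem (hψ (hjw k)) (hi (hay k))) _)
      (Subalgebra.smul_mem _ (sum_mem fun k _ => mul_mem (hψ (hjy k)) (hi (haw k))) _))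
      (Subalgebra.smul_mem _ (sum_mem fun h _ => sum_mem fun k _ =>
        mul_mem (mul_mem (hi (hcu h k)) (hi (haw h))) (hi (hay k))) _))
      (Subalgebra.smul_mem _ (add_mem (del_mem_invAlg b (hψ hwy))
        (Subalgebra.smul_mem _ (hψ hwy) _)) _))
      (Subalgebra.smul_mem _ (add_mem (del_mem_invAlg b hS) (Subalgebra.smul_mem _ hS _)) _))
      (Subalgebra.smul_mem _ (sum_mem fun k _ =>
        mul_mem (hi (hcy k)) (shift_mem_invAlg l (hi (haw k)))) _))
      (Subalgebra.smul_mem _ (add_mem (add_mem (Subalgebra.smul_mem _ (hi hc) _)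
        (Subalgebra.smul_mem _ (del_mem_invAlg b (hi hc)) _))
        (del_mem_invAlg b (del_mem_invAlg b (hi hc)))) _))
      (Subalgebra.smul_mem _ (one_mem _) _)
  · have hsym := H.sum_lie_lie_e_mul hu hw hy (inc b) (del.toLinearMap ∘ₗ inc b)
    simp only [LinearMap.comp_apply, Derivation.coeFn_coe] at hsym
    have hform := H.sum_form_lie_e_smul hu hy hw (inc b)
    rw [← lie_skew ⁅e, y⁆, map_neg] at hform
    simp only [H.symm ⁅e, (u _ : g)⁆] at hform
    have hcomm : ∀ k, inc b ⁅⁅e, (u k : g)⁆, ⁅e, y⁆⁆ = -inc b ⁅⁅e, y⁆, ⁅e, (u k : g)⁆⁆ :=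
      fun k => by rw [← lie_skew, map_neg]
    have hB := H.form_lie_e_lie_e w y
    rw [H.sharpHom_derivation_psiS hs hy (fun P => adL_del ..), H.sharpHom_adL_psiS_neg hs hw hy,
      H.sharpHom_adL_psiS_lie_e hs hu hw hy]
    simp only [H.sharpHom_adL_psiS_lie_e hs hu hw (u _).2]
    simp only [map_add, map_sub, map_smul, map_sum, map_mul, sharpHom_del, sharpHom_shift,
      H.sharpHom_psiS hs (hjw _), H.sharpHom_psiS hs (hjy _), H.sharpHom_psiS hs hwy,
      H.sharpHom_inc_of_cent0 (haw _), H.sharpHom_inc_of_cent0 (hay _),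
      H.sharpHom_inc_of_cent0 (hcw _), H.sharpHom_inc_of_cent0 (hcy _),
      H.sharpHom_inc_of_cent0 (hcu _ _), H.sharpHom_inc_of_cent0 hc, map_one]
    rw [hB]
    simp only [hcomm]
    exact rearrange_bracket l (B e (jord e w y)) _ _ _ _ _ _
      (fun h k => inc b ⁅⁅e, (u h : g)⁆, ⁅e, (u k : g)⁆⁆) _ _ _ hsym hform

lemma adL_incS_incS (p q : g) (l : F) :
    adL b B s z l (incS b B s z p) (incS b B s z q) = incS b B s z ⁅p, q⁆ + (B p q * l) • 1 := by
  rw [adL_incS, adOp_one_incS]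

lemma lie_cent0_lie_e (H : ShortTriple B e f x) {p : g} (hp : p ∈ cent0 F f x) (w : g) :
    ⁅p, ⁅e, w⁆⁆ = ⁅e, ⁅p, w⁆⁆ := by
  rw [leibniz_lie p e w, ← lie_skew p e, H.lie_e_eq_zero hp]; simp

/-- The projection of `{p_{λ+∂} ψ(w)}_→ h`, for `p ∈ g_0^f`. -/
lemma sharpHom_adOp_psiS (H : ShortTriple B e f x) (hs : s ∈ gr F x 2) {p w : g}
    (hp : p ∈ cent0 F f x) (hw : w ∈ gr F x (-2)) (l : F) (h : DPoly ι F) :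
    sharpHom b e f x (adOp b B s z l p h (psiS b B e f s z u u' w)) =
      incS b B s z ⁅p, w⁆ * sharpHom b e f x h := by
  have hp0 := (mem_cent0.1 hp).2
  have h1 : ∀ {v : g}, v ∈ gr F x (-2) →
      sharpHom b e f x (adOp b B s z l p h (incS b B s z ⁅e, v⁆)) = 0 := by
    intro v hv
    rw [sharpHom_adOp_incS, H.lie_cent0_lie_e hp,
      H.sharpHom_incS_lie_e hs (lie_mem_gr hp0 hv (by norm_num)), H.symm, H.form_lie_e_cent0 hp]
    simp
  rw [H.sharpHom_derivation_psiS hs hw (fun P => adOp_del ..), h1 hw, sharpHom_adOp_incS,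
    H.form_eq_zero (by norm_num) hp0 hw,
    H.sharpHom_incS_of_neg (lie_mem_gr hp0 hw (by norm_num))]
  simp only [h1 (u _).2]
  simp

/-- The bracket of `p ∈ g_0^f` and `ψ(w)`. -/
lemma adL_incS_psiS (H : ShortTriple B e f x) (hs : s ∈ gr F x 2)
    (hu : ∀ h k, B (u h : g) (u' k : g) = if h = k then 1 else 0)
    (ha : ∀ i j, B (a i : g) (a' j : g) = if i = j then 1 else 0) {p w : g}
    (hp : p ∈ cent0 F f x) (hw : w ∈ gr F x (-2)) (l : F) :
    adL b B s z l (incS b B s z p) (psiS b B e f s z u u' w) = psiS b B e f s z u u' ⁅p, w⁆ := by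
  have hpw : ⁅p, w⁆ ∈ gr F x (-2) := lie_mem_gr (mem_cent0.1 hp).2 hw (by norm_num)
  refine H.eq_of_sharpHom_eq (z := z) hs hu ha
    (H.adL_mem_invAlg hs l (H.leftInv_incS b hs hp) (H.strongInv_psiS b hs hu hw)
      (H.psiS_mem b hw)) (H.psiS_mem_invAlg hs hu hpw) ?_
  rw [adL_incS, H.sharpHom_adOp_psiS hs hp hw, H.sharpHom_psiS hs hpw, map_one, mul_one]

/-- The bracket of `ψ(w)` and `q ∈ g_0^f`. -/
lemma adL_psiS_incS (H : ShortTriple B e f x) (hs : s ∈ gr F x 2)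
    (hu : ∀ h k, B (u h : g) (u' k : g) = if h = k then 1 else 0)
    (ha : ∀ i j, B (a i : g) (a' j : g) = if i = j then 1 else 0) {w q : g}
    (hw : w ∈ gr F x (-2)) (hq : q ∈ cent0 F f x) (l : F) :
    adL b B s z l (psiS b B e f s z u u' w) (incS b B s z q) = psiS b B e f s z u u' ⁅w, q⁆ := by
  have hq0 := (mem_cent0.1 hq).2
  have hwq : ⁅w, q⁆ ∈ gr F x (-2) := lie_mem_gr hw hq0 (by norm_num)
  refine H.eq_of_sharpHom_eq (z := z) hs hu ha
    (H.adL_mem_invAlg hs l (H.leftInv_psiS b hs hu hw) (H.strongInv_incS b hs hq)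
      (incS_mem (H.mem_grLE_of_zero hq0))) (H.psiS_mem_invAlg hs hu hwq) ?_
  have h1 : ∀ {v : g}, v ∈ gr F x (-2) → sharpHom b e f x (incS b B s z ⁅⁅e, v⁆, q⁆) = 0 := by
    intro v hv
    rw [← lie_skew, H.lie_cent0_lie_e hq, map_neg, map_neg,
      H.sharpHom_incS_lie_e hs (lie_mem_gr hq0 hv (by norm_num)), neg_zero]
  rw [H.sharpHom_adL_psiS_incS hs hw, H.sharpHom_psiS hs hwq, h1 hw, H.form_lie_e_cent0 hq,
    H.sharpHom_incS_of_neg hwq, H.form_eq_zero (by norm_num) hw hq0]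
  simp only [h1 (u _).2, H.form_lie_e_cent0 hq]
  simp

/-! ### The Virasoro element -/

lemma jord_f (H : ShortTriple B e f x) {w : g} (hw : w ∈ gr F x (-2)) :
    jord e f w = (-2 : F) • w := by
  rw [jord, H.lie_e_f, smul_lie, mem_gr_neg.1 hw]; module

lemma lie_lie_e_f (H : ShortTriple B e f x) {p : g} (hp : p ∈ gr F x 0) :
    ⁅⁅e, f⁆, p⁆ = 0 := by
  rw [H.lie_e_f, smul_lie, mem_gr_zero.1 hp, smul_zero]

/-- The case `w = f` of the bracket of `ψ(w)` and `ψ(y)`. -/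
lemma adL_psiS_f_psiS (H : ShortTriple B e f x) (hs : s ∈ gr F x 2)
    (hu : ∀ h k, B (u h : g) (u' k : g) = if h = k then 1 else 0)
    (ha : ∀ i j, B (a i : g) (a' j : g) = if i = j then 1 else 0) {w : g}
    (hw : w ∈ gr F x (-2)) (l : F) :
    adL b B s z l (psiS b B e f s z u u' f) (psiS b B e f s z u u' w) =
      -∑ k, psiS b B e f s z u u' (u k) * inc b (sharp F e f x ⁅w, (u' k : g)⁆)
      + del (psiS b B e f s z u u' w) + (2 * l) • psiS b B e f s z u u' w
      - (1 / 2 * B e w * l ^ 3) • 1 := by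
  rw [H.adL_psiS_psiS hs hu ha H.f_mem hw, H.jord_f hw, H.lie_lie_e_f (H.lie_e_mem hw)]
  simp only [H.jord_f (u _).2, H.lie_lie_e_f (H.lie_e_mem (u _).2), H.sharp_lie_f (u' _).2,
    map_zero, zero_mul, mul_zero, Finset.sum_const_zero, smul_zero, add_zero, sub_zero, map_smul,
    Derivation.map_smul, smul_mul_assoc, ← Finset.smul_sum, smul_eq_mul]
  module

variable (b) in
/-- The element `½ ∑ a_i a^i` acts on `g_0^f` by `λ + ∂`. -/
lemma casimir_incS (H : ShortTriple B e f x)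
    (ha : ∀ i j, B (a i : g) (a' j : g) = if i = j then 1 else 0) {p : g}
    (hp : p ∈ cent0 F f x) (l : F) :
    adL b B s z l (∑ i, incS b B s z (a i) * incS b B s z (a' i)) (incS b B s z p) =
      (2 : F) • shift l (incS b B s z p) := by
  have ha' := H.dual_symm ha
  have hmem : ∀ {q : g}, q ∈ cent0 F f x → ⁅q, p⁆ ∈ cent0 F f x := by
    intro q hq
    rw [mem_cent0] at hp hq ⊢
    refine ⟨?_, lie_mem_gr hq.2 hp.2 (by norm_num)⟩
    rw [leibniz_lie, hp.1, hq.1]; simp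
  have h1 := sum_form_smul ha hp (shift l ∘ₗ incS b B s z)
  have h2 := sum_form_smul ha' hp (shift l ∘ₗ incS b B s z)
  simp only [LinearMap.comp_apply, H.symm p] at h1 h2
  have h3 : ∑ i, incS b B s z ⁅(a i : g), p⁆ * incS b B s z (a' i) +
      ∑ i, incS b B s z ⁅(a' i : g), p⁆ * incS b B s z (a i) = 0 := by
    simp only [← fun i => sum_form_smul ha (hmem (a i).2) (incS b B s z),
      ← fun i => sum_form_smul ha' (hmem (a' i).2) (incS b B s z), Finset.sum_mul]
    rw [Finset.sum_comm, ← Finset.sum_add_distrib]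
    refine Finset.sum_eq_zero fun i _ => ?_
    rw [← Finset.sum_add_distrib]
    refine Finset.sum_eq_zero fun j _ => ?_
    have : B ⁅(a j : g), p⁆ (a' i) = -B ⁅(a' i : g), p⁆ (a j) := by
      rw [H.inv, ← lie_skew, map_neg, H.symm (a j : g)]
    rw [this, neg_smul, neg_mul, smul_mul_assoc, smul_mul_assoc,
      mul_comm (incS b B s z (a' j : g)), neg_add_cancel]
  rw [adL_sum_apply]
  simp only [adL_incS_mul_incS, Derivation.add_apply, adOp_incS, Finset.sum_add_distrib]
  rw [h1, h2, add_add_add_comm, h3, zero_add, two_smul]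

/-- The projection of the bracket of `∑ a_i a^i` and `ψ(w)`. -/
lemma sharpHom_casimir_psiS (H : ShortTriple B e f x) (hs : s ∈ gr F x 2)
    (hu : ∀ h k, B (u h : g) (u' k : g) = if h = k then 1 else 0)
    (ha : ∀ i j, B (a i : g) (a' j : g) = if i = j then 1 else 0) {w : g}
    (hw : w ∈ gr F x (-2)) (l : F) :
    sharpHom b e f x (adL b B s z l (∑ i, incS b B s z (a i) * incS b B s z (a' i))
      (psiS b B e f s z u u' w)) =
      (2 : F) • ∑ k, incS b B s z (u k) * inc b (sharp F e f x ⁅w, (u' k : g)⁆) := by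
  have ha' := H.dual_symm ha
  have hJ : ∀ {q : g}, q ∈ cent0 F f x → sharpHom b e f x (incS b B s z q) = inc b q := by
    intro q hq
    rw [H.sharpHom_incS_of_zero hs (mem_cent0.1 hq).2, H.sharp_of_cent0 hq]
  -- `[q,w] = ∑ (q|[w,u^k]^♯) u_k` for `q ∈ g_0^f`
  have hq : ∀ {q : g}, q ∈ cent0 F f x →
      incS b B s z ⁅q, w⁆ = ∑ k, B (sharp F e f x ⁅w, (u' k : g)⁆) q • incS b B s z (u k) := by
    intro q hq
    rw [← sum_form_smul hu (lie_mem_gr (mem_cent0.1 hq).2 hw (by norm_num)) (incS b B s z)]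
    refine Finset.sum_congr rfl fun k _ => ?_
    rw [H.form_sharp (lie_u_mem hw k) hq, H.inv, H.symm]
  have h1 : ∑ i, incS b B s z ⁅(a i : g), w⁆ * inc b (a' i) =
      ∑ k, incS b B s z (u k) * inc b (sharp F e f x ⁅w, (u' k : g)⁆) := by
    simp only [hq (a _).2, Finset.sum_mul]
    rw [Finset.sum_comm]
    refine Finset.sum_congr rfl fun k _ => ?_
    rw [← sum_form_smul ha' (H.sharp_mem_cent0 (lie_u_mem hw k)) (inc b), Finset.mul_sum]
    exact Finset.sum_congr rfl fun i _ => by rw [smul_mul_assoc, mul_smul_comm]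
  have h2 : ∑ i, incS b B s z ⁅(a' i : g), w⁆ * inc b (a i) =
      ∑ k, incS b B s z (u k) * inc b (sharp F e f x ⁅w, (u' k : g)⁆) := by
    simp only [hq (a' _).2, Finset.sum_mul]
    rw [Finset.sum_comm]
    refine Finset.sum_congr rfl fun k _ => ?_
    rw [← sum_form_smul ha (H.sharp_mem_cent0 (lie_u_mem hw k)) (inc b), Finset.mul_sum]
    exact Finset.sum_congr rfl fun i _ => by rw [smul_mul_assoc, mul_smul_comm]
  rw [adL_sum_apply, map_sum]
  simp only [adL_incS_mul_incS, Derivation.add_apply, map_add, H.sharpHom_adOp_psiS hs (a _).2 hw,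
    H.sharpHom_adOp_psiS hs (a' _).2 hw, hJ (a _).2, hJ (a' _).2, Finset.sum_add_distrib]
  rw [h1, h2, two_smul]

lemma leftInv_virasoro (H : ShortTriple B e f x) (hs : s ∈ gr F x 2)
    (hu : ∀ h k, B (u h : g) (u' k : g) = if h = k then 1 else 0) :
    LeftInv b B f x s z (psiS b B e f s z u u' f +
      (1 / 2 : F) • ∑ i, incS b B s z (a i) * incS b B s z (a' i)) :=
  (H.leftInv_psiS b hs hu H.f_mem).add
    ((LeftInv.sum _ fun i _ => H.leftInv_incS_mul_incS b hs (a i).2 (a' i).2).smul _)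

lemma adL_virasoro_incS (H : ShortTriple B e f x) (hs : s ∈ gr F x 2)
    (hu : ∀ h k, B (u h : g) (u' k : g) = if h = k then 1 else 0)
    (ha : ∀ i j, B (a i : g) (a' j : g) = if i = j then 1 else 0) {p : g}
    (hp : p ∈ cent0 F f x) (l : F) :
    adL b B s z l (psiS b B e f s z u u' f +
      (1 / 2 : F) • ∑ i, incS b B s z (a i) * incS b B s z (a' i)) (incS b B s z p) =
      shift l (incS b B s z p) := by
  rw [map_add, map_smul, Derivation.add_apply, Derivation.smul_apply,
    H.adL_psiS_incS hs hu ha H.f_mem hp, (mem_cent0.1 hp).1, map_zero, zero_add,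
    H.casimir_incS b ha hp, smul_smul]
  norm_num

/-- After the projection, the sums over `k` in the brackets of `ψ(f)` and of `½ ∑ a_i a^i` with
`ψ(w)` cancel. -/
lemma adL_virasoro_psiS (H : ShortTriple B e f x) (hs : s ∈ gr F x 2)
    (hu : ∀ h k, B (u h : g) (u' k : g) = if h = k then 1 else 0)
    (ha : ∀ i j, B (a i : g) (a' j : g) = if i = j then 1 else 0) {w : g}
    (hw : w ∈ gr F x (-2)) (l : F) :
    adL b B s z l (psiS b B e f s z u u' f +
      (1 / 2 : F) • ∑ i, incS b B s z (a i) * incS b B s z (a' i)) (psiS b B e f s z u u' w) =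
      del (psiS b B e f s z u u' w) + (2 * l) • psiS b B e f s z u u' w
        - (1 / 2 * B e w * l ^ 3) • 1 := by
  have hψ := H.psiS_mem_invAlg (b := b) (z := z) hs hu hw
  refine H.eq_of_sharpHom_eq (z := z) hs hu ha
    (H.adL_mem_invAlg hs l (H.leftInv_virasoro hs hu) (H.strongInv_psiS b hs hu hw)
      (H.psiS_mem b hw))
    (sub_mem (add_mem (del_mem_invAlg b hψ) (Subalgebra.smul_mem _ hψ _))
      (Subalgebra.smul_mem _ (one_mem _) _)) ?_
  rw [map_add, map_smul, Derivation.add_apply, Derivation.smul_apply, map_add, map_smul,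
    H.sharpHom_casimir_psiS hs hu ha hw, H.adL_psiS_f_psiS hs hu ha hw]
  simp only [map_add, map_sub, map_neg, map_smul, map_sum, map_mul, sharpHom_del,
    H.sharpHom_psiS hs hw, H.sharpHom_psiS hs (u _).2,
    H.sharpHom_inc_of_cent0 (H.sharp_mem_cent0 (lie_u_mem hw _)), map_one]
  module

variable (b) in
/-- `∑ c_j c^j = ∑ a_i a^i - ½ ∑ [f,u^k][e,u_k]`. -/
lemma casimir_zero (H : ShortTriple B e f x)
    (hu : ∀ h k, B (u h : g) (u' k : g) = if h = k then 1 else 0)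
    (ha : ∀ i j, B (a i : g) (a' j : g) = if i = j then 1 else 0)
    {J₀ : Type*} [Fintype J₀] [DecidableEq J₀] {c c' : Module.Basis J₀ F (gr F x 0)}
    (hc : ∀ i j, B (c i : g) (c' j : g) = if i = j then 1 else 0) :
    ∑ j, inc b (c j : g) * inc b (c' j : g) = ∑ i, inc b (a i : g) * inc b (a' i : g)
      - (1 / 2 : F) • ∑ k, inc b ⁅f, (u' k : g)⁆ * inc b ⁅e, (u k : g)⁆ := by
  have h1 : ∀ j, inc b (c j : g) = ∑ i, B (c j : g) (a' i : g) • inc b (a i : g)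
      + (1 / 2 : F) • ∑ k, B ⁅f, (c j : g)⁆ (u' k : g) • inc b ⁅e, (u k : g)⁆ := by
    intro j
    have e1 := sum_form_smul ha (H.sharp_mem_cent0 (c j).2) (inc b)
    have e2 := sum_form_smul hu (H.lie_f_mem_neg (c j).2)
      (inc b ∘ₗ (LieAlgebra.ad F g e : g →ₗ[F] g))
    simp only [LinearMap.comp_apply, LieAlgebra.ad_apply] at e2
    simp only [H.form_sharp (c j).2 (a' _).2] at e1
    rw [e1, e2, H.sharp_of_zero (c j).2, map_sub, map_smul, sub_add_cancel]
  have h2 : ∀ i, ∑ j, B (c j : g) (a' i : g) • inc b (c' j : g) = inc b (a' i : g) := by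
    intro i
    rw [← sum_form_smul (H.dual_symm hc) (mem_cent0.1 (a' i).2).2 (inc b)]
    exact Finset.sum_congr rfl fun j _ => by rw [H.symm]
  have h3 : ∀ k, ∑ j, B ⁅f, (c j : g)⁆ (u' k : g) • inc b (c' j : g) =
      -inc b ⁅f, (u' k : g)⁆ := by
    intro k
    rw [← sum_form_smul (H.dual_symm hc) (H.lie_f_mem (u' k).2) (inc b), ← Finset.sum_neg_distrib]
    refine Finset.sum_congr rfl fun j _ => ?_
    rw [← lie_skew, map_neg, LinearMap.neg_apply, H.inv, H.symm (c j : g), neg_smul]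
  have e1 : ∑ j, (∑ i, B (c j : g) (a' i : g) • inc b (a i : g)) * inc b (c' j : g) =
      ∑ i, inc b (a i : g) * inc b (a' i : g) := by
    simp only [Finset.sum_mul]
    rw [Finset.sum_comm]
    refine Finset.sum_congr rfl fun i _ => ?_
    rw [← h2 i, Finset.mul_sum]
    exact Finset.sum_congr rfl fun j _ => by rw [smul_mul_assoc, mul_smul_comm]
  have e2 : ∑ j, (∑ k, B ⁅f, (c j : g)⁆ (u' k : g) • inc b ⁅e, (u k : g)⁆) * inc b (c' j : g) =
      -∑ k, inc b ⁅f, (u' k : g)⁆ * inc b ⁅e, (u k : g)⁆ := by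
    simp only [Finset.sum_mul]
    rw [Finset.sum_comm, ← Finset.sum_neg_distrib]
    refine Finset.sum_congr rfl fun k _ => ?_
    rw [← neg_mul, ← h3 k, Finset.sum_mul]
    exact Finset.sum_congr rfl fun j _ => by rw [smul_mul_assoc, smul_mul_assoc, mul_comm]
  simp only [h1, add_mul, Finset.sum_add_distrib, smul_mul_assoc, ← Finset.smul_sum]
  rw [e1, e2]
  module

variable (b) in
/-- The Virasoro element as the sum of `ψ(f)` and the Sugawara element of `g_0^f`. -/
lemma virasoro_eq (H : ShortTriple B e f x)
    (hu : ∀ h k, B (u h : g) (u' k : g) = if h = k then 1 else 0)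
    (ha : ∀ i j, B (a i : g) (a' j : g) = if i = j then 1 else 0)
    {J₀ : Type*} [Fintype J₀] [DecidableEq J₀] {c c' : Module.Basis J₀ F (gr F x 0)}
    (hc : ∀ i j, B (c i : g) (c' j : g) = if i = j then 1 else 0)
    {Jh : Type*} [Fintype Jh] (v v' : Module.Basis Jh F (gr F x 1)) :
    virasoro b f x c c' v v' =
      psi b e f u u' f + (1 / 2 : F) • ∑ i, inc b (a i : g) * inc b (a' i : g) := by
  have hv' : ∀ k, (v' k : g) = 0 := fun k =>
    H.eq_zero_of_mem_gr (m := 1) (by norm_num) (by norm_num) (by norm_num) (v' k).2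
  rw [virasoro, psi, H.casimir_zero b hu ha hc, H.lie_e_f]
  simp only [hv', H.jord_f (u _).2, lie_smul, map_smul, Derivation.map_smul, map_zero, zero_mul,
    Finset.sum_const_zero, smul_zero, mul_smul_comm, ← Finset.smul_sum]
  module

end ShortTriple

end Brackets

/-! ### The `W`-algebra -/

section WAlgebra

variable {F : Type*} [Field F] [CharZero F] {g : Type*} [LieRing g] [LieAlgebra F g] {ι : Type*}
variable {b : Module.Basis ι F g} {B : LinearMap.BilinForm F g} {e f x : g} {s : g} {z : F}
variable {K : Type*} [Fintype K] [DecidableEq K] {u : Module.Basis K F (gr F x (-2))}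
  {u' : Module.Basis K F (gr F x 2)}
variable {J : Type*} [Fintype J] [DecidableEq J] {a a' : Module.Basis J F (cent0 F f x)}

lemma eval_wBracket (l : F) (P Q : DPoly ι F) :
    (wBracket b B f x s z P Q).eval (MvPolynomial.C l) = rho b B f x (adL b B s z l P Q) := by
  have h : MvPolynomial.C l = (rho b B f x : DPoly ι F →+* DPoly ι F) (MvPolynomial.C l) := by
    simp [rho]
  rw [wBracket, Polynomial.eval_map]
  conv_lhs => rw [h]
  rw [Polynomial.eval₂_at_apply, eval_affBracket]
  rfl

lemma iterate_del_mem_invAlg {P : DPoly ι F} (hP : P ∈ invAlg b B f x s z) (n : ℕ) :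
    del^[n] P ∈ invAlg b B f x s z := by
  induction n with
  | zero => exact hP
  | succ n ih => rw [Function.iterate_succ_apply']; exact del_mem_invAlg b ih

namespace ShortTriple

lemma eval_wBracket_of_leftInv (H : ShortTriple B e f x) (l : F) {P Q : DPoly ι F}
    (hP : LeftInv b B f x s z P) (hQ : Q ∈ VLE b x) :
    (wBracket b B f x s z P Q).eval (MvPolynomial.C l) = adL b B s z l P Q := by
  rw [eval_wBracket, H.rho_of_mem (hP.mem l Q hQ)]

lemma mem_W_iff (H : ShortTriple B e f x) {P : DPoly ι F} :
    P ∈ W b B f x s z ↔ P ∈ invAlg b B f x s z := by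
  refine and_congr_right fun _ => ?_
  rw [H.grGE_eq (by norm_num) (by norm_num)]
  refine forall₂_congr fun n _ => ⟨fun h l => ?_, fun h => eq_of_forall_eval_C fun l => ?_⟩
  · rw [← adL_inc, ← eval_wBracket, h, Polynomial.eval_zero]
  · rw [eval_wBracket, adL_inc, h, Polynomial.eval_zero]

lemma psi_mem_invAlg (H : ShortTriple B e f x) (hs : s ∈ gr F x 2)
    (hu : ∀ h k, B (u h : g) (u' k : g) = if h = k then 1 else 0) {w : g}
    (hw : w ∈ gr F x (-2)) : psi b e f u u' w ∈ invAlg b B f x s z := by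
  rw [H.psi_eq (B := B) (z := z) b hs hw]
  exact sub_mem (H.psiS_mem_invAlg hs hu hw) (Subalgebra.algebraMap_mem _ _)

/-- The structure of the `W`-algebra. -/
lemma W_eq_adjoin (H : ShortTriple B e f x) (hs : s ∈ gr F x 2)
    (hu : ∀ h k, B (u h : g) (u' k : g) = if h = k then 1 else 0)
    (ha : ∀ i j, B (a i : g) (a' j : g) = if i = j then 1 else 0) :
    W b B f x s z = (Algebra.adjoin F {P | ∃ n : ℕ,
      (∃ p ∈ cent0 F f x, P = del^[n] (inc b p)) ∨
      (∃ w ∈ gr F x (-2), P = del^[n] (psi b e f u u' w))} : Set (DPoly ι F)) := by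
  ext P
  rw [H.mem_W_iff, SetLike.mem_coe]
  refine ⟨fun hP => H.mem_adjoin_of_invariant hs hu ha hP.1 hP.2, fun hP => ?_⟩
  refine (Algebra.adjoin_le ?_ : _ ≤ invAlg b B f x s z) hP
  rintro _ ⟨n, ⟨p, hp, rfl⟩ | ⟨w, hw, rfl⟩⟩
  · exact iterate_del_mem_invAlg (H.inc_mem_invAlg hs hp) n
  · exact iterate_del_mem_invAlg (H.psi_mem_invAlg hs hu hw) n

lemma wBracket_inc_inc (H : ShortTriple B e f x) (hs : s ∈ gr F x 2) {p q : g}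
    (hp : p ∈ cent0 F f x) (hq : q ∈ cent0 F f x) :
    wBracket b B f x s z (inc b p) (inc b q) =
      Polynomial.C (inc b ⁅p, q⁆) + algebraMap F _ (B p q) * Polynomial.X := by
  have hp0 := (mem_cent0.1 hp).2
  have hq0 := (mem_cent0.1 hq).2
  refine eq_of_forall_eval_C fun l => ?_
  rw [← H.incS_of_zero (z := z) hs hp0, ← H.incS_of_zero (z := z) hs hq0,
    H.eval_wBracket_of_leftInv l (H.leftInv_incS b hs hp) (incS_mem (H.mem_grLE_of_zero hq0)),
    adL_incS_incS, H.incS_of_zero hs (lie_mem_gr hp0 hq0 (by norm_num))]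
  simp [Polynomial.algebraMap_apply, MvPolynomial.algebraMap_eq, MvPolynomial.smul_eq_C_mul]

/-- Values of the bracket with `ψ(w)` in the second argument. -/
lemma eval_wBracket_psi (H : ShortTriple B e f x) (hs : s ∈ gr F x 2) (l : F) {P : DPoly ι F}
    (hP : LeftInv b B f x s z P) {w : g} (hw : w ∈ gr F x (-2)) :
    (wBracket b B f x s z P (psi b e f u u' w)).eval (MvPolynomial.C l) =
      adL b B s z l P (psiS b B e f s z u u' w) := by
  rw [eval_wBracket, H.psi_eq b hs hw, map_sub, Derivation.map_algebraMap, sub_zero,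
    H.rho_of_mem (hP.mem l _ (H.psiS_mem b hw))]

lemma wBracket_sub_algebraMap (P Q : DPoly ι F) (c : F) :
    wBracket b B f x s z (P - algebraMap F _ c) Q = wBracket b B f x s z P Q :=
  eq_of_forall_eval_C fun l => by
    rw [eval_wBracket, eval_wBracket, map_sub, adL_algebraMap, sub_zero]

lemma wBracket_inc_psi (H : ShortTriple B e f x) (hs : s ∈ gr F x 2)
    (hu : ∀ h k, B (u h : g) (u' k : g) = if h = k then 1 else 0)
    (ha : ∀ i j, B (a i : g) (a' j : g) = if i = j then 1 else 0) {p w : g}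
    (hp : p ∈ cent0 F f x) (hw : w ∈ gr F x (-2)) :
    wBracket b B f x s z (inc b p) (psi b e f u u' w) =
      Polynomial.C (psi b e f u u' ⁅p, w⁆) + algebraMap F _ (z * B s ⁅p, w⁆) := by
  have hp0 := (mem_cent0.1 hp).2
  refine eq_of_forall_eval_C fun l => ?_
  rw [← H.incS_of_zero (z := z) hs hp0, H.eval_wBracket_psi hs l (H.leftInv_incS b hs hp) hw,
    H.adL_incS_psiS hs hu ha hp hw,
    H.psi_eq (B := B) (z := z) b hs (lie_mem_gr hp0 hw (by norm_num)), Polynomial.eval_add,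
    Polynomial.algebraMap_apply, Polynomial.eval_C, Polynomial.eval_C, sub_add_cancel]

lemma wBracket_psi_inc (H : ShortTriple B e f x) (hs : s ∈ gr F x 2)
    (hu : ∀ h k, B (u h : g) (u' k : g) = if h = k then 1 else 0)
    (ha : ∀ i j, B (a i : g) (a' j : g) = if i = j then 1 else 0) {w q : g}
    (hw : w ∈ gr F x (-2)) (hq : q ∈ cent0 F f x) :
    wBracket b B f x s z (psi b e f u u' w) (inc b q) =
      Polynomial.C (psi b e f u u' ⁅w, q⁆) + algebraMap F _ (z * B s ⁅w, q⁆) := by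
  have hq0 := (mem_cent0.1 hq).2
  refine eq_of_forall_eval_C fun l => ?_
  rw [← H.incS_of_zero (z := z) hs hq0, H.psi_eq (B := B) (z := z) b hs hw,
    wBracket_sub_algebraMap,
    H.eval_wBracket_of_leftInv l (H.leftInv_psiS b hs hu hw) (incS_mem (H.mem_grLE_of_zero hq0)),
    H.adL_psiS_incS hs hu ha hw hq,
    H.psi_eq (B := B) (z := z) b hs (lie_mem_gr hw hq0 (by norm_num)), Polynomial.eval_add,
    Polynomial.algebraMap_apply, Polynomial.eval_C, Polynomial.eval_C, sub_add_cancel]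

/-- Contraction of `(s|w∘u_k)` with `[y,u^k]^♯`. -/
lemma sum_form_jord_smul {M : Type*} [AddCommGroup M] [Module F M] (H : ShortTriple B e f x)
    (hs : s ∈ gr F x 2) (hu : ∀ h k, B (u h : g) (u' k : g) = if h = k then 1 else 0) {w y : g}
    (hw : w ∈ gr F x (-2)) (hy : y ∈ gr F x (-2)) (φ : g →ₗ[F] M) :
    ∑ k, B s (jord e w (u k)) • φ (sharp F e f x ⁅y, (u' k : g)⁆) =
      φ (sharp F e f x ⁅⁅e, w⁆, ⁅s, y⁆⁆) - φ (sharp F e f x ⁅s, jord e w y⁆) := by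
  have h := sum_form_smul (H.dual_symm hu) (lie_mem_gr hs (H.lie_e_mem hw) (by norm_num))
    (φ ∘ₗ sharp F e f x ∘ₗ (LieAlgebra.ad F g y : g →ₗ[F] g))
  simp only [LinearMap.comp_apply, LieAlgebra.ad_apply] at h
  have h1 : ⁅y, ⁅s, ⁅e, w⁆⁆⁆ = ⁅⁅e, w⁆, ⁅s, y⁆⁆ - ⁅s, jord e w y⁆ := by
    rw [leibniz_lie, H.lie_neg_lie_e hw hy, H.jord_comm hy hw, ← lie_skew ⁅y, s⁆, ← lie_skew y s,
      lie_neg, neg_neg, lie_neg, sub_eq_add_neg]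
  rw [← map_sub, ← map_sub, ← h1, ← h]
  exact Finset.sum_congr rfl fun k _ => by rw [H.inv, jord]

lemma wBracket_psi_psi (H : ShortTriple B e f x) (hs : s ∈ gr F x 2)
    (hu : ∀ h k, B (u h : g) (u' k : g) = if h = k then 1 else 0)
    (ha : ∀ i j, B (a i : g) (a' j : g) = if i = j then 1 else 0) {w y : g}
    (hw : w ∈ gr F x (-2)) (hy : y ∈ gr F x (-2)) :
    wBracket b B f x s z (psi b e f u u' w) (psi b e f u u' y) =
        (1 / 2 : F) • ∑ k, Polynomial.C (psi b e f u u' (jord e w (u k))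
            * inc b (sharp F e f x ⁅y, (u' k : g)⁆))
        - (1 / 2 : F) • ∑ k, Polynomial.C (psi b e f u u' (jord e y (u k))
            * inc b (sharp F e f x ⁅w, (u' k : g)⁆))
        + (1 / 4 : F) • ∑ h, ∑ k, Polynomial.C (inc b ⁅⁅e, (u h : g)⁆, ⁅e, (u k : g)⁆⁆
            * inc b (sharp F e f x ⁅w, (u' h : g)⁆) * inc b (sharp F e f x ⁅y, (u' k : g)⁆))
        - (1 / 2 : F) • (Polynomial.C (del (psi b e f u u' (jord e w y)))
            + 2 * Polynomial.X * Polynomial.C (psi b e f u u' (jord e w y)))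
        + (1 / 4 : F) •
            (Polynomial.C (del (∑ k, inc b ⁅⁅e, w⁆, ⁅e, (u k : g)⁆⁆
                * inc b (sharp F e f x ⁅y, (u' k : g)⁆)))
              + 2 * Polynomial.X * Polynomial.C (∑ k, inc b ⁅⁅e, w⁆, ⁅e, (u k : g)⁆⁆
                * inc b (sharp F e f x ⁅y, (u' k : g)⁆)))
        + (1 / 4 : F) • ∑ k, Polynomial.C (inc b ⁅⁅e, y⁆, ⁅e, (u k : g)⁆⁆)
            * (Polynomial.C (del (inc b (sharp F e f x ⁅w, (u' k : g)⁆)))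
              + Polynomial.X * Polynomial.C (inc b (sharp F e f x ⁅w, (u' k : g)⁆)))
        - (1 / 4 : F) • (3 * Polynomial.X ^ 2 * Polynomial.C (inc b ⁅⁅e, w⁆, ⁅e, y⁆⁆)
            + 3 * Polynomial.X * Polynomial.C (del (inc b ⁅⁅e, w⁆, ⁅e, y⁆⁆))
            + Polynomial.C (del (del (inc b ⁅⁅e, w⁆, ⁅e, y⁆⁆))))
        + algebraMap F _ (1 / 4 * B e (jord e w y)) * Polynomial.X ^ 3
        + (1 / 2 * z : F) • Polynomial.C (inc b (sharp F e f x ⁅⁅e, w⁆, ⁅s, y⁆⁆)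
            - inc b (sharp F e f x ⁅⁅e, y⁆, ⁅s, w⁆⁆))
        - algebraMap F _ (z * B s (jord e w y)) * Polynomial.X := by
  refine eq_of_forall_eval_C fun l => ?_
  rw [H.psi_eq (B := B) (z := z) b hs hw, wBracket_sub_algebraMap,
    H.eval_wBracket_psi hs l (H.leftInv_psiS b hs hu hw) hy, H.adL_psiS_psiS hs hu ha hw hy]
  -- passing from `ψ` to the shifted generators produces the terms linear in `z`
  have hsum : ∀ {w y : g}, w ∈ gr F x (-2) → y ∈ gr F x (-2) →
      ∑ k, psi b e f u u' (jord e w (u k)) * inc b (sharp F e f x ⁅y, (u' k : g)⁆) =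
      ∑ k, psiS b B e f s z u u' (jord e w (u k)) * inc b (sharp F e f x ⁅y, (u' k : g)⁆)
        - z • (inc b (sharp F e f x ⁅⁅e, w⁆, ⁅s, y⁆⁆) - inc b (sharp F e f x ⁅s, jord e w y⁆)) := by
    intro w y hw hy
    rw [← H.sum_form_jord_smul hs hu hw hy (inc b), Finset.smul_sum, ← Finset.sum_sub_distrib]
    refine Finset.sum_congr rfl fun k _ => ?_
    rw [H.psi_eq (B := B) (z := z) b hs (H.jord_mem hw (u k).2), sub_mul, smul_smul,
      Algebra.smul_def]
  simp only [Polynomial.eval_add, Polynomial.eval_sub, Polynomial.eval_smul, Polynomial.eval_mul,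
    Polynomial.eval_finsetSum, Polynomial.eval_C, Polynomial.eval_X, Polynomial.eval_pow,
    Polynomial.eval_ofNat, Polynomial.algebraMap_apply, hsum hw hy, hsum hy hw, H.jord_comm hy hw,
    H.psi_eq (B := B) (z := z) b hs (H.jord_mem hw hy), map_sub, del_algebraMap,
    ← MvPolynomial.algebraMap_eq]
  have e1 : ∑ k, inc b ⁅⁅e, y⁆, ⁅e, (u k : g)⁆⁆ * shift l (inc b (sharp F e f x ⁅w, (u' k : g)⁆)) =
      ∑ k, inc b ⁅⁅e, y⁆, ⁅e, (u k : g)⁆⁆ * (del (inc b (sharp F e f x ⁅w, (u' k : g)⁆)) +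
        algebraMap F _ l * inc b (sharp F e f x ⁅w, (u' k : g)⁆)) :=
    Finset.sum_congr rfl fun k _ => by rw [shift_apply, Algebra.smul_def, add_comm]
  have h4 : algebraMap F (DPoly ι F) (1 / 2) * 2 = 1 := by
    rw [← map_ofNat (algebraMap F (DPoly ι F)) 2, ← map_mul]; simp
  rw [e1]
  simp only [Algebra.smul_def, map_mul, map_pow, map_ofNat]
  linear_combination -(algebraMap F (DPoly ι F) z * algebraMap F _ (B s (jord e w y)) *
    algebraMap F _ l) * h4

lemma virasoro_eq_sub (H : ShortTriple B e f x) (hs : s ∈ gr F x 2)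
    (hu : ∀ h k, B (u h : g) (u' k : g) = if h = k then 1 else 0)
    (ha : ∀ i j, B (a i : g) (a' j : g) = if i = j then 1 else 0)
    {J₀ : Type*} [Fintype J₀] [DecidableEq J₀] {c c' : Module.Basis J₀ F (gr F x 0)}
    (hc : ∀ i j, B (c i : g) (c' j : g) = if i = j then 1 else 0)
    {Jh : Type*} [Fintype Jh] (v v' : Module.Basis Jh F (gr F x 1)) :
    virasoro b f x c c' v v' = psiS b B e f s z u u' f
      + (1 / 2 : F) • ∑ i, incS b B s z (a i) * incS b B s z (a' i)
      - algebraMap F _ (z * B s f) := by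
  rw [H.virasoro_eq b hu ha hc, H.psi_eq (B := B) (z := z) b hs H.f_mem]
  simp only [H.incS_of_zero (b := b) (z := z) hs (mem_cent0.1 (a _).2).2,
    H.incS_of_zero (b := b) (z := z) hs (mem_cent0.1 (a' _).2).2]
  abel

lemma wBracket_virasoro_inc (H : ShortTriple B e f x) (hs : s ∈ gr F x 2)
    (hu : ∀ h k, B (u h : g) (u' k : g) = if h = k then 1 else 0)
    (ha : ∀ i j, B (a i : g) (a' j : g) = if i = j then 1 else 0)
    {J₀ : Type*} [Fintype J₀] [DecidableEq J₀] {c c' : Module.Basis J₀ F (gr F x 0)}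
    (hc : ∀ i j, B (c i : g) (c' j : g) = if i = j then 1 else 0)
    {Jh : Type*} [Fintype Jh] (v v' : Module.Basis Jh F (gr F x 1)) {p : g}
    (hp : p ∈ cent0 F f x) :
    wBracket b B f x s z (virasoro b f x c c' v v') (inc b p) =
      Polynomial.C (del (inc b p)) + Polynomial.X * Polynomial.C (inc b p) := by
  refine eq_of_forall_eval_C fun l => ?_
  have hp0 := (mem_cent0.1 hp).2
  rw [← H.incS_of_zero (z := z) hs hp0, H.virasoro_eq_sub hs hu ha hc, wBracket_sub_algebraMap,
    H.eval_wBracket_of_leftInv l (H.leftInv_virasoro hs hu) (incS_mem (H.mem_grLE_of_zero hp0)),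
    H.adL_virasoro_incS hs hu ha hp, shift_eq_C_mul]
  simp only [Polynomial.eval_add, Polynomial.eval_mul, Polynomial.eval_C, Polynomial.eval_X]
  exact add_comm _ _

lemma wBracket_virasoro_psi (H : ShortTriple B e f x) (hs : s ∈ gr F x 2)
    (hu : ∀ h k, B (u h : g) (u' k : g) = if h = k then 1 else 0)
    (ha : ∀ i j, B (a i : g) (a' j : g) = if i = j then 1 else 0)
    {J₀ : Type*} [Fintype J₀] [DecidableEq J₀] {c c' : Module.Basis J₀ F (gr F x 0)}
    (hc : ∀ i j, B (c i : g) (c' j : g) = if i = j then 1 else 0)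
    {Jh : Type*} [Fintype Jh] (v v' : Module.Basis Jh F (gr F x 1)) {w : g}
    (hw : w ∈ gr F x (-2)) :
    wBracket b B f x s z (virasoro b f x c c' v v') (psi b e f u u' w) =
      Polynomial.C (del (psi b e f u u' w))
        + 2 * Polynomial.X * Polynomial.C (psi b e f u u' w)
        - algebraMap F _ (1 / 2 * B e w) * Polynomial.X ^ 3
        + algebraMap F _ (2 * z * B s w) * Polynomial.X := by
  refine eq_of_forall_eval_C fun l => ?_
  rw [H.virasoro_eq_sub hs hu ha hc, wBracket_sub_algebraMap,
    H.eval_wBracket_psi hs l (H.leftInv_virasoro hs hu) hw, H.adL_virasoro_psiS hs hu ha hw,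
    H.psi_eq (B := B) (z := z) b hs hw]
  simp only [Polynomial.eval_add, Polynomial.eval_sub, Polynomial.eval_mul, Polynomial.eval_C,
    Polynomial.eval_X, Polynomial.eval_pow, Polynomial.eval_ofNat, Polynomial.algebraMap_apply,
    map_sub, del_algebraMap, ← MvPolynomial.algebraMap_eq]
  simp only [Algebra.smul_def, map_mul, map_pow, map_ofNat]
  ring

end ShortTriple

end WAlgebra

end

end ClassicalW

open ClassicalW Polynomial in
theorem theorem5p4
    {F : Type*} [Field F] [IsAlgClosed F] [CharZero F]
    {g : Type*} [LieRing g] [LieAlgebra F g] [Module.Finite F g] [LieAlgebra.IsSimple F g]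
    -- a non-degenerate symmetric invariant bilinear form
    (B : LinearMap.BilinForm F g) (hBn : B.Nondegenerate) (hBs : B.IsSymm)
    (hBi : ∀ p q r : g, B ⁅p, q⁆ r = B p ⁅q, r⁆)
    -- an `sl₂`-triple `{f, 2x, e}` with `f` short, `s ∈ g_1`, and a scalar `z`
    (e f x : g) (ht : IsSl2Triple ((2 : F) • x) e f) (hshort : IsShort F x)
    (s : g) (hs : s ∈ gr F x 2) (z : F)
    -- a basis of `g`, which provides coordinates on `V(g)`
    {ι : Type*} [Fintype ι] (b : Module.Basis ι F g)
    -- dual bases of `g_{-1}` and `g_1`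
    {K : Type*} [Fintype K] [DecidableEq K]
    (u : Module.Basis K F (gr F x (-2))) (u' : Module.Basis K F (gr F x 2))
    (hu : ∀ h k, B (u h : g) (u' k : g) = if h = k then 1 else 0)
    -- dual bases of `g_0^f`
    {J : Type*} [Fintype J] [DecidableEq J] (a a' : Module.Basis J F (cent0 F f x))
    (ha : ∀ i j, B (a i : g) (a' j : g) = if i = j then 1 else 0)
    -- dual bases of `g_0`
    {J₀ : Type*} [Fintype J₀] [DecidableEq J₀] (c c' : Module.Basis J₀ F (gr F x 0))
    (hc : ∀ i j, B (c i : g) (c' j : g) = if i = j then 1 else 0)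
    -- dual bases of `g_{1/2}` (which is zero here) for the form `(f|[·,·])`
    {Jh : Type*} [Fintype Jh] [DecidableEq Jh] (v v' : Module.Basis Jh F (gr F x 1))
    (hv : ∀ h k, B f ⁅(v h : g), (v' k : g)⁆ = if h = k then 1 else 0) :
    -- the elements of `g_0^f` and the `ψ(w)`, `w ∈ g_{-1}`, generate the differential algebra W
    W b B f x s z = (Algebra.adjoin F {P | ∃ n : ℕ,
      (∃ p ∈ cent0 F f x, P = del^[n] (inc b p)) ∨
      (∃ w ∈ gr F x (-2), P = del^[n] (psi b e f u u' w))} :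
        Set (DPoly ι F)) ∧
    -- the table of brackets
    (∀ p ∈ cent0 F f x, ∀ q ∈ cent0 F f x,
      wBracket b B f x s z (inc b p) (inc b q) = C (inc b ⁅p, q⁆) + algebraMap F _ (B p q) * X) ∧
    (∀ p ∈ cent0 F f x, ∀ w ∈ gr F x (-2),
      wBracket b B f x s z (inc b p) (psi b e f u u' w) =
        C (psi b e f u u' ⁅p, w⁆) + algebraMap F _ (z * B s ⁅p, w⁆)) ∧
    (∀ w ∈ gr F x (-2), ∀ q ∈ cent0 F f x,
      wBracket b B f x s z (psi b e f u u' w) (inc b q) =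
        C (psi b e f u u' ⁅w, q⁆) + algebraMap F _ (z * B s ⁅w, q⁆)) ∧
    (∀ w ∈ gr F x (-2), ∀ w₁ ∈ gr F x (-2),
      wBracket b B f x s z (psi b e f u u' w) (psi b e f u u' w₁) =
        (1 / 2 : F) • ∑ k, C (psi b e f u u' (jord e w (u k))
            * inc b (sharp F e f x ⁅w₁, (u' k : g)⁆))
        - (1 / 2 : F) • ∑ k, C (psi b e f u u' (jord e w₁ (u k))
            * inc b (sharp F e f x ⁅w, (u' k : g)⁆))
        + (1 / 4 : F) • ∑ h, ∑ k, C (inc b ⁅⁅e, (u h : g)⁆, ⁅e, (u k : g)⁆⁆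
            * inc b (sharp F e f x ⁅w, (u' h : g)⁆) * inc b (sharp F e f x ⁅w₁, (u' k : g)⁆))
        - (1 / 2 : F) • (C (del (psi b e f u u' (jord e w w₁)))
            + 2 * X * C (psi b e f u u' (jord e w w₁)))
        + (1 / 4 : F) •
            (C (del (∑ k, inc b ⁅⁅e, w⁆, ⁅e, (u k : g)⁆⁆
                * inc b (sharp F e f x ⁅w₁, (u' k : g)⁆)))
              + 2 * X * C (∑ k, inc b ⁅⁅e, w⁆, ⁅e, (u k : g)⁆⁆
                * inc b (sharp F e f x ⁅w₁, (u' k : g)⁆)))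
        + (1 / 4 : F) • ∑ k, C (inc b ⁅⁅e, w₁⁆, ⁅e, (u k : g)⁆⁆)
            * (C (del (inc b (sharp F e f x ⁅w, (u' k : g)⁆)))
              + X * C (inc b (sharp F e f x ⁅w, (u' k : g)⁆)))
        - (1 / 4 : F) • (3 * X ^ 2 * C (inc b ⁅⁅e, w⁆, ⁅e, w₁⁆⁆)
            + 3 * X * C (del (inc b ⁅⁅e, w⁆, ⁅e, w₁⁆⁆))
            + C (del (del (inc b ⁅⁅e, w⁆, ⁅e, w₁⁆⁆))))
        + algebraMap F _ (1 / 4 * B e (jord e w w₁)) * X ^ 3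
        + (1 / 2 * z : F) •
            C (inc b (sharp F e f x ⁅⁅e, w⁆, ⁅s, w₁⁆⁆) - inc b (sharp F e f x ⁅⁅e, w₁⁆, ⁅s, w⁆⁆))
        - algebraMap F _ (z * B s (jord e w w₁)) * X) ∧
    -- the Virasoro element
    virasoro b f x c c' v v' =
      psi b e f u u' f + (1 / 2 : F) • ∑ i, inc b (a i : g) * inc b (a' i : g) ∧
    (∀ p ∈ cent0 F f x, wBracket b B f x s z (virasoro b f x c c' v v') (inc b p) =
        C (del (inc b p)) + X * C (inc b p)) ∧
    (∀ w ∈ gr F x (-2), wBracket b B f x s z (virasoro b f x c c' v v') (psi b e f u u' w) =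
        C (del (psi b e f u u' w)) + 2 * X * C (psi b e f u u' w)
        - algebraMap F _ (1 / 2 * B e w) * X ^ 3 + algebraMap F _ (2 * z * B s w) * X) := by
  have two_ne : (2 : F) ≠ 0 := two_ne_zero
  have H : ShortTriple B e f x :=
    { symm := fun p q => hBs.eq p q
      inv := hBi
      lie_x_e := by
        have h := ht.lie_h_e_nsmul
        rw [smul_lie, ← Nat.cast_smul_eq_nsmul F, Nat.cast_ofNat] at h
        exact smul_right_injective g two_ne h
      lie_x_f := by
        have h := ht.lie_h_f_nsmul
        rw [smul_lie, ← Nat.cast_smul_eq_nsmul F, Nat.cast_ofNat, ← smul_neg] at h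
        exact smul_right_injective g two_ne h
      lie_e_f := ht.lie_e_f
      short := hshort }
  exact ⟨H.W_eq_adjoin hs hu ha,
    fun p hp q hq => H.wBracket_inc_inc hs hp hq,
    fun p hp w hw => H.wBracket_inc_psi hs hu ha hp hw,
    fun w hw q hq => H.wBracket_psi_inc hs hu ha hw hq,
    fun w hw y hy => H.wBracket_psi_psi hs hu ha hw hy,
    H.virasoro_eq b hu ha hc v v',
    fun p hp => H.wBracket_virasoro_inc hs hu ha hc v v' hp,
    fun w hw => H.wBracket_virasoro_psi hs hu ha hc v v' hw⟩
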